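/- Let $\omega,\mu,\epsilon_L>0$ and let $k>0$ satisfy $k^2=\omega^2\epsilon_L\mu$. For $r\neq r'$ in $\mathbb R^3$ and $R=|r-r'|$ put $$g(r,r')=\frac{e^{-ikR}}{4\pi R},\qquad g_0(r,r')=\frac1{4\pi R},\qquad \tilde g=g-g_0,\qquad \overline{\mathbf G}_{\mathbf E}(r,r')=\Big(\mathbf I+\frac1{k^2}\nabla\nabla\Big)g(r,r'),$$ where $\nabla\nabla$ denotes the matrix of second partial derivatives in $r$. Let $\Omega\subset\mathbb R^3$ be bounded and measurable, let $\Delta\epsilon:\mathbb R^3\to\mathbb C$ vanish outside $\Omega$, and let $\mathbf J_e:\mathbb R^3\to\mathbb C^3$ be integrable with compact support disjoint from $\Omega$. Let $\mathbf E:\mathbb R^3\to\mathbb C^3$ be locally integrable with $\Delta\epsilon\,\mathbf E$ integrable, and suppose that * $\nabla\times\frac1\mu\nabla\times\mathbf E-\omega^2(\epsilon_L+\Delta\epsilon)\mathbf E=-i\omega\mathbf J_e$ in $\mathbb R^3$ in the sense of distributions, and * $\mathbf E$ is differentiable outside some ball and its Cartesian components satisfy the Sommerfeld radiation condition $\partial\mathbf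 E/\partial|x|+ik\mathbf E=o(1/|x|)$ as $|x|\to\infty$, uniformly in all directions. Let $r$ be a point at which $\mathbf E$ is continuous and near which $\Delta\epsilon\,\mathbf E$ is Hölder continuous with exponent $\alpha>0$. Put $$\mathbf E^{\rm inc}(r)=-i\omega\mu\int_{\mathbb R^3}\overline{\mathbf G}_{\mathbf E}(r,r')\cdot\mathbf J_e(r')\,dr'.$$ Then for every measurable neighbourhood $V$ of $r$ with $V\subset\Omega$ (for instance $V=B(r,\delta)$ for any $\delta>0$ with $B(r,\delta)\subset\Omega$), the function $x\mapsto\int_V\frac{dr'}{4\pi|x-r'|}$ is smooth at $r$, and with $$\mathbf L_V=-\nabla\nabla\int_V\frac{dr'}{4\pi|r-r'|},\qquad \mathbf C=\mathbf I+\frac{\Delta\epsilon(r)}{\epsilon_L}\mathbf L_V,$$ we have $$\begin{aligned}\mathbf C\cdot\mathbf E(r)=\ &\mathbf E^{\rm inc}(r)-i\omega\mu\int_{\Omega\setminus V}i\omega\,\Delta\epsilon(r')\,\overline{\mathbf G}_{\mathbf E}(r,r')\cdot\mathbf E(r')\,dr'\\&+\omega^2\mu\int_V\Delta\epsilon(r')\,g(r,r')\,\mathbf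 E(r')\,dr'+\frac{\omega^2\mu}{k^2}\int_V\Delta\epsilon(r')\,\nabla\nabla\tilde g(r,r')\cdot\mathbf E(r')\,dr'\\&+\frac{\omega^2\mu}{k^2}\int_V\nabla\nabla g_0(r,r')\cdot\big[\Delta\epsilon(r')\mathbf E(r')-\Delta\epsilon(r)\mathbf E(r)\big]\,dr',\end{aligned}$$ where all the integrals, including the one that defines $\mathbf E^{\rm inc}(r)$, converge absolutely. The integrands of the three integrals over $V$ are weakly singular: as $r'\to r$ they are $O(|r-r'|^{-1})$, $O(|r-r'|^{-1})$ and $O(|r-r'|^{\alpha-3})$, respectively. Moreover, if $V$ has a surface measure $\sigma$ on $\partial V$ and an outward unit normal $n$ (in De Giorgi's sense: $\sigma$ is a finite measure concentrated on $\partial V$, $n$ is measurable with $|n|=1$ $\sigma$-almost everywhere, and $\int_V\nabla\cdot\varphi\,dx=\int\varphi\cdot n\,d\sigma$ for all compactly supported $C^1$ vector fields $\varphi$ on $\mathbb R^3$), then $$(\mathbf L_V)_{ij}=\int_{\partial V}\frac{(r'-r)_i\,n_j(r')}{4\pi|r'-r|^3}\,d\sigma(r').$$ For every ball $B(r,\delta)$,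 $\delta>0$, one has $\mathbf L_{B(r,\delta)}=\frac13\mathbf I$. -/

import Mathlib

open MeasureTheory Filter Topology Asymptotics
open scoped NNReal Matrix

noncomputable section

namespace VIE

/-- Physical space `ℝ³` with its Euclidean norm. -/
abbrev Space : Type := EuclideanSpace ℝ (Fin 3)

/-- Values of complex vector fields. -/
abbrev CVec : Type := Fin 3 → ℂ

/-- `3 × 3` dyadics. -/
abbrev Dyadic : Type := Matrix (Fin 3) (Fin 3) ℂ

/-- Partial derivative `∂ᵢ f (x)`. -/
def pderiv (i : Fin 3) (f : Space → ℂ) (x : Space) : ℂ :=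
  fderiv ℝ f x (EuclideanSpace.single i 1)

/-- The dyadic `∇∇f (x)`, with entries `∂ᵢ ∂ⱼ f (x)`. -/
def hess (f : Space → ℂ) (x : Space) : Dyadic :=
  Matrix.of fun i j => pderiv i (pderiv j f) x

/-- `∇ × F`. -/
def curl (F : Space → CVec) (x : Space) : CVec :=
  ![pderiv 1 (fun y => F y 2) x - pderiv 2 (fun y => F y 1) x,
    pderiv 2 (fun y => F y 0) x - pderiv 0 (fun y => F y 2) x,
    pderiv 0 (fun y => F y 1) x - pderiv 1 (fun y => F y 0) x]

/-- The outgoing Helmholtz kernel `g(r, r') = exp(-ikR) / (4πR)`, `R = |r - r'|`. -/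
def g (k : ℝ) (r r' : Space) : ℂ :=
  Complex.exp (-Complex.I * k * ‖r - r'‖) / (4 * Real.pi * ‖r - r'‖)

/-- The static kernel `g₀(r, r') = 1 / (4πR)`. -/
def g₀ (r r' : Space) : ℂ :=
  1 / (4 * Real.pi * ‖r - r'‖)

/-- The regular part `g - g₀`. -/
def gReg (k : ℝ) (r r' : Space) : ℂ :=
  g k r r' - g₀ r r'

/-- `∇∇g(r, r')`, derivatives being taken in `r`. -/
def hessG (k : ℝ) (r r' : Space) : Dyadic := hess (fun x => g k x r') r

/-- `∇∇g₀(r, r')`, derivatives being taken in `r`. -/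
def hessG₀ (r r' : Space) : Dyadic := hess (fun x => g₀ x r') r

/-- `∇∇(g - g₀)(r, r')`, derivatives being taken in `r`. -/
def hessGReg (k : ℝ) (r r' : Space) : Dyadic := hess (fun x => gReg k x r') r

/-- The dyadic Green's function of the homogeneous medium, `(I + k⁻² ∇∇) g(r, r')`. -/
def GE (k : ℝ) (r r' : Space) : Dyadic :=
  g k r r' • (1 : Dyadic) + (1 / (k : ℂ) ^ 2) • hessG k r r'

/-- The incident field `-iωμ ∫ G_E(r, r') · J_e(r') dr'` of the current `J_e`. -/
def incidentField (ω μ k : ℝ) (Je : Space → CVec) (r : Space) : CVec :=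
  (-Complex.I * ω * μ) • ∫ r', GE k r r' *ᵥ Je r'

/-- The vector wave equation `∇ × (1/μ) ∇ × E - ω² ε E = -iω J_e` on all of `ℝ³` in the sense of
distributions, for constant `μ`. -/
def IsWeakWaveSolution (ω μ : ℝ) (ε : Space → ℂ) (Je E : Space → CVec) : Prop :=
  ∀ φ : Space → CVec, ContDiff ℝ (⊤ : ℕ∞) φ → HasCompactSupport φ →
    (1 / (μ : ℂ)) * (∫ x, E x ⬝ᵥ curl (curl φ) x) - (ω : ℂ) ^ 2 * (∫ x, (ε x • E x) ⬝ᵥ φ x)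
      = -Complex.I * ω * ∫ x, Je x ⬝ᵥ φ x

/-- The Sommerfeld radiation condition `∂E/∂|x| + ikE = o(1/|x|)` as `|x| → ∞`, uniformly in all
directions, for the Cartesian components of a field that is differentiable near infinity. -/
def IsRadiating (k : ℝ) (E : Space → CVec) : Prop :=
  (∀ᶠ x in Bornology.cobounded Space, DifferentiableAt ℝ E x) ∧
    Tendsto (fun x : Space =>
        ‖x‖ • (fderiv ℝ E x (‖x‖⁻¹ • x) + (Complex.I * k) • E x))
      (Bornology.cobounded Space) (𝓝 0)

/-- `∫_V dr' / (4π|x - r'|)` as a function of `x`. -/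
def newtonPotential (V : Set Space) (x : Space) : ℂ :=
  ∫ r' in V, g₀ x r'

/-- The dyadic `L_V` at `r`: `-∇∇ ∫_V dr' / (4π|r - r'|)`. -/
def LDyadic (V : Set Space) (r : Space) : Dyadic :=
  -hess (newtonPotential V) r

/-- `σ` is the surface (perimeter) measure of `∂V` and `n` the outward unit normal, in the sense of
De Giorgi: the distributional gradient of the indicator function of `V` is `-n σ`. For a bounded
Lipschitz domain these are the surface area on `∂V` and the usual outward normal. -/
structure HasBoundary (V : Set Space) (σ : Measure Space) (n : Space → Space) : Prop where
  finite : IsFiniteMeasure σ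
  concentrated : σ (frontier V)ᶜ = 0
  measurable : Measurable n
  unit : ∀ᵐ x ∂σ, ‖n x‖ = 1
  gauss_green : ∀ φ : Space → Space, ContDiff ℝ 1 φ → HasCompactSupport φ →
    ∫ x in V, ∑ i, (fderiv ℝ φ x (EuclideanSpace.single i 1)) i = ∫ x, inner ℝ (φ x) (n x) ∂σ

end VIE

end

/-!
The volume integral equation comes from testing the wave equation with smoothed columns of the
dyadic Green's function, and from removing the smoothing at the pole and the cut-off at infinity.

For a test function `ζ`, the distributional equation tested with `∇∂ⱼζ` and with `ζ eⱼ` gives, after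
elimination of the divergence of `E`, a scalar Helmholtz equation for the component `Eⱼ` with the
source `-iωμ Jₑ + ω²μ Δε E` acting through `I + k⁻²∇∇` (`weak_helmholtz`). Take `ζ = S(ρ) g`, where
`ρ` is the distance to the observation point `r` and `S` vanishes for small and for large `ρ`. Since
`g` solves the Helmholtz equation away from `r`, the residual `(Δ + k²)(S g)` lives only where `S'`
does not vanish (`laplacian_cutG`): near the pole and near infinity.

At infinity no `L²` estimate for the radiating field is needed. Along a ray `t ↦ tθ` from the origin
the radiation condition says that `exp(ikt) E` has derivative `o(1/t)`, so on a transition region of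
bounded width it is a constant of size `o(t)` up to an error `o(1/t)`, while the residual times
`t²` is `O(t)`. The error is therefore harmless. For the constant, an integration by parts leaves
`∫ S'(ρ) exp(-2ikρ) dρ` and a remainder `O(1/t)`, and the integral vanishes if `S` descends in two
equal steps at distance `π / (2k)` (`integral_deriv_outerCut_mul_cexp`, `exists_ray_bound`). Hence
the residual at infinity contributes nothing in the limit (`tendsto_integral_cutRes_outerCut`).

At the pole the residual is minus an approximate identity (`tendsto_integral_cutRes_innerCut`) and
reproduces `E(r)`. On the other side of the equation the exclusion volume is split off. There
the smoothed `∇∇g` is the smoothed `∇∇(g - g₀)` plus the smoothed `∇∇g₀`, and the latter is applied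
to `[Δε E](x) - [Δε E](r)` and to the constant `[Δε E](r)`. Every term but the last converges by
dominated convergence, thanks to bounds that are uniform in the smoothing radius
(`weaklySingular_limit`). The last one does not depend on the smoothing at all: modifying the
kernel `1/(4πρ)` inside a ball contained in `V` changes the Newton potential of `V` near `r` only by
a constant, so the integral of the smoothed Hessian over `V` is `-L_V` (`LDyadic_eq`). The same
observation gives the smoothness of the potential, and with the Gauss–Green formula the surface
integral for `L_V` (`LDyadic_eq_surface_integral`). For a ball, symmetry makes `L_V` a multiple of
the identity whose trace is the total mass `1` of the approximate identity (`LDyadic_ball`).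
-/

noncomputable section

namespace VIE

/-! ### Radial functions -/

/-- The unit vector `(x - r) / ‖x - r‖`, in coordinates. -/
def dir (r x : Space) (i : Fin 3) : ℝ := (x - r) i / ‖x - r‖

lemma abs_dir_le (r x : Space) (i : Fin 3) : |dir r x i| ≤ 1 := by
  rw [dir, abs_div, abs_norm]
  exact div_le_one_of_le₀ (by simpa using PiLp.norm_apply_le (x - r) i) (norm_nonneg _)

lemma sum_dir_sq {r x : Space} (h : x ≠ r) : ∑ i, dir r x i ^ 2 = 1 := by
  have h0 : ‖x - r‖ ≠ 0 := norm_ne_zero_iff.2 (sub_ne_zero.2 h)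
  simp only [dir, div_pow, ← Finset.sum_div]
  rw [← EuclideanSpace.real_norm_sq_eq, div_self (pow_ne_zero 2 h0)]

lemma hasFDerivAt_norm_sub {r x : Space} (h : x ≠ r) :
    HasFDerivAt (fun y : Space => ‖y - r‖) (‖x - r‖⁻¹ • innerSL ℝ (x - r)) x := by
  have h0 : ‖x - r‖ ≠ 0 := norm_ne_zero_iff.2 (sub_ne_zero.2 h)
  have h1 : HasFDerivAt (fun y : Space => ‖y - r‖ ^ 2) (2 • innerSL ℝ (x - r)) x := by
    have h2 : HasFDerivAt (fun y : Space => y - r) (ContinuousLinearMap.id ℝ Space) x :=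
      (hasFDerivAt_id x).sub_const r
    exact (hasStrictFDerivAt_norm_sq (x - r)).hasFDerivAt.comp x h2
  have h2 := h1.sqrt (pow_ne_zero 2 h0)
  simp only [Real.sqrt_sq (norm_nonneg _)] at h2
  refine h2.congr_fderiv ?_
  rw [← Nat.cast_smul_eq_nsmul ℝ, smul_smul]
  congr 1
  field_simp
  simp

/-- The chain rule for a radial function. -/
lemma hasFDerivAt_radial {q : ℝ → ℂ} {q' : ℂ} {r x : Space} (h : x ≠ r)
    (hq : HasDerivAt q q' ‖x - r‖) :
    HasFDerivAt (fun y : Space => q ‖y - r‖)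
      ((‖x - r‖⁻¹ • innerSL ℝ (x - r)).smulRight q') x := by
  refine HasFDerivAt.congr_fderiv (hq.hasFDerivAt.comp x (hasFDerivAt_norm_sub h)) ?_
  ext v; simp; ring

lemma pderiv_radial {q : ℝ → ℂ} {q' : ℂ} {r x : Space} (h : x ≠ r)
    (hq : HasDerivAt q q' ‖x - r‖) (i : Fin 3) :
    pderiv i (fun y : Space => q ‖y - r‖) x = q' * dir r x i := by
  rw [pderiv, (hasFDerivAt_radial h hq).fderiv]
  simp [dir, EuclideanSpace.inner_single_right, div_eq_inv_mul, mul_comm]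

lemma HasFDerivAt.pderiv_eq {f : Space → ℂ} {f' : Space →L[ℝ] ℂ} {x : Space}
    (h : HasFDerivAt f f' x) (i : Fin 3) : pderiv i f x = f' (EuclideanSpace.single i 1) := by
  rw [pderiv, h.fderiv]

lemma pderiv_congr {f₁ f₂ : Space → ℂ} {x : Space} (h : f₁ =ᶠ[𝓝 x] f₂) (i : Fin 3) :
    pderiv i f₁ x = pderiv i f₂ x := by
  rw [pderiv, pderiv, h.fderiv_eq]

lemma pderiv_eventuallyEq {f₁ f₂ : Space → ℂ} {x : Space} (h : f₁ =ᶠ[𝓝 x] f₂) (i : Fin 3) :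
    pderiv i f₁ =ᶠ[𝓝 x] pderiv i f₂ := by
  filter_upwards [h.eventuallyEq_nhds] with y hy using pderiv_congr hy i

lemma hess_congr {f₁ f₂ : Space → ℂ} {x : Space} (h : f₁ =ᶠ[𝓝 x] f₂) :
    hess f₁ x = hess f₂ x := by
  ext i j
  exact pderiv_congr (pderiv_eventuallyEq h j) i

/-- The Hessian of a radial function `q(‖x - r‖)` with `q' = a`, `q'' = b`. -/
def radialHess (a b : ℂ) (r x : Space) : Dyadic :=
  Matrix.of fun i j => b * (dir r x i * dir r x j) +
    a / ‖x - r‖ * ((if i = j then 1 else 0) - dir r x i * dir r x j)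

lemma hess_radial {q q' : ℝ → ℂ} {q'' : ℂ} {r x : Space} (h : x ≠ r)
    (hq : ∀ t, 0 < t → HasDerivAt q (q' t) t) (hq' : HasDerivAt q' q'' ‖x - r‖) :
    hess (fun y => q ‖y - r‖) x = radialHess (q' ‖x - r‖) q'' r x := by
  have h0 : ‖x - r‖ ≠ 0 := norm_ne_zero_iff.2 (sub_ne_zero.2 h)
  have h0' : (‖x - r‖ : ℂ) ≠ 0 := by exact_mod_cast h0
  ext i j
  have hev : pderiv j (fun y => q ‖y - r‖) =ᶠ[𝓝 x]
      fun y => (q' ‖y - r‖ * ((‖y - r‖⁻¹ : ℝ) : ℂ)) * (((y - r) j : ℝ) : ℂ) := by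
    filter_upwards [isOpen_ne.mem_nhds h] with y hy
    rw [pderiv_radial hy (hq _ (norm_pos_iff.2 (sub_ne_zero.2 hy)))]
    simp [dir]; ring
  have h1 := hasFDerivAt_radial (q := fun t => q' t * ((t⁻¹ : ℝ) : ℂ)) h
    (hq'.mul ((hasDerivAt_inv h0).ofReal_comp))
  have h2 : HasFDerivAt (fun y : Space => (((y - r) j : ℝ) : ℂ))
      (Complex.ofRealCLM.comp (EuclideanSpace.proj j : Space →L[ℝ] ℝ)) x := by
    have : HasFDerivAt (fun y : Space => (Complex.ofRealCLM.comp
      (EuclideanSpace.proj j : Space →L[ℝ] ℝ)) (y - r)) _ x :=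
      ((Complex.ofRealCLM.comp (EuclideanSpace.proj j : Space →L[ℝ] ℝ)).hasFDerivAt
        (x := x - r)).comp x ((hasFDerivAt_id x).sub_const r)
    simpa using this
  have h3 : HasFDerivAt
      (fun y : Space => (q' ‖y - r‖ * ((‖y - r‖⁻¹ : ℝ) : ℂ)) * (((y - r) j : ℝ) : ℂ)) _ x :=
    h1.mul h2
  change pderiv i (pderiv j _) x = _
  rw [pderiv_congr hev, HasFDerivAt.pderiv_eq h3]
  simp [radialHess, dir, EuclideanSpace.inner_single_right]
  by_cases hij : i = j
  · subst hij
    simp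
    field_simp
    ring
  · have : ¬ j = i := fun hh => hij hh.symm
    simp [hij, this]
    field_simp

lemma norm_radialHess_le (a b : ℂ) (r x : Space) (i j : Fin 3) :
    ‖radialHess a b r x i j‖ ≤ ‖b‖ + 2 * (‖a‖ / ‖x - r‖) := by
  have h1 : ‖(dir r x i * dir r x j : ℂ)‖ ≤ 1 := by
    rw [norm_mul, Complex.norm_real, Complex.norm_real]
    exact mul_le_one₀ (abs_dir_le r x i) (norm_nonneg _) (abs_dir_le r x j)
  have h2 : ‖((if i = j then 1 else 0) - dir r x i * dir r x j : ℂ)‖ ≤ 2 := by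
    refine (norm_sub_le _ _).trans ?_
    have : ‖(if i = j then 1 else 0 : ℂ)‖ ≤ 1 := by split_ifs <;> simp
    linarith
  rw [radialHess, Matrix.of_apply]
  refine (norm_add_le _ _).trans ?_
  rw [norm_mul, norm_mul _ (_ - _), norm_div, Complex.norm_real, norm_norm]
  have := mul_le_mul_of_nonneg_left h1 (norm_nonneg b)
  have := mul_le_mul_of_nonneg_left h2 (div_nonneg (norm_nonneg a) (norm_nonneg (x - r)))
  linarith

lemma radialHess_add (a a' b b' : ℂ) (r x : Space) :
    radialHess (a + a') (b + b') r x = radialHess a b r x + radialHess a' b' r x := by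
  ext i j; simp [radialHess]; ring

lemma radialHess_comm (a b : ℂ) (r x : Space) (i j : Fin 3) :
    radialHess a b r x i j = radialHess a b r x j i := by
  simp only [radialHess, Matrix.of_apply, eq_comm (a := i)]; ring

lemma dir_swap (r x : Space) (i : Fin 3) : dir x r i = - dir r x i := by
  rw [dir, dir, norm_sub_rev, ← neg_sub x r, PiLp.neg_apply, neg_div]

lemma radialHess_swap (a b : ℂ) (r x : Space) : radialHess a b x r = radialHess a b r x := by
  ext i j
  rw [radialHess, radialHess, Matrix.of_apply, Matrix.of_apply, dir_swap r, dir_swap r,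
    norm_sub_rev r x]
  push_cast
  ring

lemma trace_radialHess {r x : Space} (h : x ≠ r) (a b : ℂ) :
    ∑ i, radialHess a b r x i i = b + 2 * (a / ‖x - r‖) := by
  have h1 : ∑ i, (dir r x i : ℂ) * dir r x i = 1 := by
    rw [← Complex.ofReal_one, ← sum_dir_sq h]; push_cast
    exact Finset.sum_congr rfl fun i _ => (sq _).symm
  simp only [radialHess, Matrix.of_apply, Finset.sum_add_distrib, ← Finset.mul_sum,
    Finset.sum_sub_distrib, h1]
  simp; ring

lemma contDiffAt_radial {q : ℝ → ℂ} {n : ℕ∞} {r x : Space} (h : x ≠ r)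
    (hq : ContDiffAt ℝ n q ‖x - r‖) : ContDiffAt ℝ n (fun y : Space => q ‖y - r‖) x :=
  ContDiffAt.comp (g := q) (f := fun y : Space => ‖y - r‖) x hq
    ((contDiffAt_id.sub contDiffAt_const).norm ℝ (sub_ne_zero.2 h))

/-- A radial function is smooth as soon as its profile is smooth away from the origin and vanishes
near the origin. -/
lemma contDiff_radial {q : ℝ → ℂ} {n : ℕ∞} {r : Space} {t₀ : ℝ} (ht₀ : 0 < t₀)
    (h0 : ∀ t < t₀, q t = 0) (hq : ∀ t, 0 < t → ContDiffAt ℝ n q t) :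
    ContDiff ℝ n (fun y : Space => q ‖y - r‖) := by
  rw [contDiff_iff_contDiffAt]
  intro x
  by_cases h : x = r
  · have : (fun y : Space => q ‖y - r‖) =ᶠ[𝓝 x] fun _ => 0 := by
      filter_upwards [Metric.ball_mem_nhds x ht₀] with y hy
      exact h0 _ (by simpa [h, dist_eq_norm] using hy)
    exact contDiffAt_const.congr_of_eventuallyEq this
  · exact contDiffAt_radial h (hq _ (norm_pos_iff.2 (sub_ne_zero.2 h)))

lemma hasCompactSupport_radial {q : ℝ → ℂ} {r : Space} {t₁ : ℝ}
    (h1 : ∀ t, t₁ < t → q t = 0) : HasCompactSupport (fun y : Space => q ‖y - r‖) :=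
  HasCompactSupport.intro (isCompact_closedBall r t₁) fun x hx => h1 _ (by
    simpa [dist_eq_norm] using hx)

/-! ### The Helmholtz kernels and their second derivatives -/

/-- The profile `exp(-iκt) / (4πt)` of the outgoing Helmholtz kernel; `κ = 0` gives the static
kernel. -/
def outProf (κ t : ℝ) : ℂ := Complex.exp (-Complex.I * κ * t) / (4 * Real.pi * t)

/-- The first derivative of `outProf`. -/
def outProf₁ (κ t : ℝ) : ℂ :=
  Complex.exp (-Complex.I * κ * t) / (4 * Real.pi) * (-(Complex.I * κ) / t - 1 / t ^ 2)

/-- The second derivative of `outProf`. -/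
def outProf₂ (κ t : ℝ) : ℂ :=
  Complex.exp (-Complex.I * κ * t) / (4 * Real.pi) *
    (-(κ : ℂ) ^ 2 / t + 2 * (Complex.I * κ) / t ^ 2 + 2 / t ^ 3)

lemma hasDerivAt_cexp (κ t : ℝ) : HasDerivAt (fun t : ℝ => Complex.exp (-Complex.I * κ * t))
    (-(Complex.I * κ) * Complex.exp (-Complex.I * κ * t)) t := by
  have ht1 : HasDerivAt (fun t : ℝ => (t : ℂ)) 1 t := (hasDerivAt_id t).ofReal_comp
  exact (ht1.const_mul (-Complex.I * κ)).cexp.congr_deriv (by ring)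

lemma hasDerivAt_outProf (κ : ℝ) {t : ℝ} (ht : 0 < t) :
    HasDerivAt (outProf κ) (outProf₁ κ t) t := by
  have h0 : (t : ℂ) ≠ 0 := by exact_mod_cast ht.ne'
  have hpi : (Real.pi : ℂ) ≠ 0 := by exact_mod_cast Real.pi_ne_zero
  have ht1 : HasDerivAt (fun t : ℝ => (t : ℂ)) 1 t := (hasDerivAt_id t).ofReal_comp
  refine ((hasDerivAt_cexp κ t).div (ht1.const_mul (4 * Real.pi : ℂ))
    (by simp [h0, hpi])).congr_deriv ?_
  rw [outProf₁]
  field_simp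

lemma hasDerivAt_outProf₁ (κ : ℝ) {t : ℝ} (ht : 0 < t) :
    HasDerivAt (outProf₁ κ) (outProf₂ κ t) t := by
  have h0 : (t : ℂ) ≠ 0 := by exact_mod_cast ht.ne'
  have hpi : (Real.pi : ℂ) ≠ 0 := by exact_mod_cast Real.pi_ne_zero
  have ht1 : HasDerivAt (fun t : ℝ => (t : ℂ)) 1 t := (hasDerivAt_id t).ofReal_comp
  refine (((hasDerivAt_cexp κ t).div_const (4 * Real.pi : ℂ)).mul
    (((hasDerivAt_const t (-(Complex.I * κ))).div ht1 h0).sub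
      ((hasDerivAt_const t (1 : ℂ)).div (ht1.pow 2) (pow_ne_zero 2 h0)))).congr_deriv ?_
  simp only [outProf₂, Pi.div_apply, Pi.sub_apply, Pi.pow_apply]
  have hI : Complex.I ^ 2 = -1 := Complex.I_sq
  field_simp
  push_cast
  ring_nf
  simp only [hI]
  ring

lemma contDiffAt_outProf (κ : ℝ) {n : ℕ∞} {t : ℝ} (ht : 0 < t) : ContDiffAt ℝ n (outProf κ) t := by
  have h0 : (t : ℂ) ≠ 0 := by exact_mod_cast ht.ne'
  have hpi : (Real.pi : ℂ) ≠ 0 := by exact_mod_cast Real.pi_ne_zero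
  have ht1 : ContDiffAt ℝ n (fun t : ℝ => (t : ℂ)) t := Complex.ofRealCLM.contDiff.contDiffAt
  have h1 : ContDiffAt ℝ n (fun t : ℝ => Complex.exp (-Complex.I * κ * t)) t :=
    (contDiffAt_const.mul ht1).cexp
  have h2 : ContDiffAt ℝ n (fun t : ℝ => (4 * Real.pi * t : ℂ)) t := contDiffAt_const.mul ht1
  exact h1.mul (h2.inv (by simp [h0, hpi]))

lemma norm_cexp (κ t : ℝ) : ‖Complex.exp (-Complex.I * κ * t)‖ = 1 := by
  rw [Complex.norm_exp]; simp

lemma norm_outProf (κ : ℝ) {t : ℝ} (ht : 0 < t) : ‖outProf κ t‖ = 1 / (4 * Real.pi * t) := by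
  rw [outProf, norm_div, norm_cexp]
  simp [abs_of_pos ht, abs_of_pos Real.pi_pos]

lemma norm_outProf_le (κ : ℝ) {t : ℝ} (ht : 0 < t) : ‖outProf κ t‖ ≤ 1 / t := by
  rw [norm_outProf κ ht]
  gcongr
  nlinarith [Real.pi_gt_three]

lemma norm_outProf₁_zero_le {t : ℝ} (ht : 0 < t) : ‖outProf₁ 0 t‖ ≤ 1 / t ^ 2 := by
  rw [outProf₁, norm_mul, norm_div, norm_cexp]
  simp only [Complex.ofReal_zero, mul_zero, neg_zero, zero_div, zero_sub, norm_neg, norm_div,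
    norm_one, norm_pow, Complex.norm_real, norm_mul, Real.norm_of_nonneg ht.le,
    Real.norm_of_nonneg Real.pi_pos.le]
  refine mul_le_of_le_one_left (by positivity) ?_
  rw [div_le_one (by norm_num; positivity)]
  norm_num
  linarith [Real.pi_gt_three]

lemma norm_outProf₂_zero_le {t : ℝ} (ht : 0 < t) : ‖outProf₂ 0 t‖ ≤ 1 / t ^ 3 := by
  rw [outProf₂, norm_mul, norm_div, norm_cexp]
  simp only [Complex.ofReal_zero, mul_zero, zero_div, norm_div, ne_eq, OfNat.ofNat_ne_zero,
    not_false_eq_true, zero_pow, neg_zero, zero_add,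
    norm_pow, Complex.norm_real, norm_mul, Real.norm_of_nonneg ht.le,
    Real.norm_of_nonneg Real.pi_pos.le]
  norm_num
  rw [div_eq_mul_inv 2, ← mul_assoc]
  refine mul_le_of_le_one_left (by positivity) ?_
  have := Real.pi_gt_three
  field_simp
  linarith

/-- The profile of `g - g₀` and its first two derivatives are bounded near the origin. -/
lemma exists_bound_outProf_sub (κ M : ℝ) : ∃ C, 0 ≤ C ∧ ∀ t, 0 < t → t ≤ M →
    ‖outProf κ t - outProf 0 t‖ ≤ C ∧ ‖outProf₁ κ t - outProf₁ 0 t‖ ≤ C ∧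
      ‖outProf₂ κ t - outProf₂ 0 t‖ ≤ C := by
  set X := Real.exp (|κ| * |M|) with hX
  have hX0 : 0 ≤ X := (Real.exp_pos _).le
  refine ⟨(|κ| + 2 * |κ| ^ 2 + 5 * |κ| ^ 3) * X, by positivity, fun t ht htM => ?_⟩
  have h0 : (t : ℂ) ≠ 0 := by exact_mod_cast ht.ne'
  have hpi : (Real.pi : ℂ) ≠ 0 := by exact_mod_cast Real.pi_ne_zero
  set z : ℂ := -Complex.I * κ * t with hz
  have hzn : ‖z‖ = |κ| * t := by simp [hz, abs_of_pos ht]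
  have hzX : Real.exp ‖z‖ ≤ X := by
    rw [hzn]; exact Real.exp_le_exp.2 (by gcongr; exact htM.trans (le_abs_self M))
  have e0 : Complex.exp (-Complex.I * (0 : ℝ) * t) = 1 := by simp
  have r1 : ‖Complex.exp z - 1‖ ≤ ‖z‖ * X := by
    have := Complex.norm_exp_sub_sum_le_norm_mul_exp z 1
    simp at this
    exact this.trans (by gcongr)
  have r2 : ‖Complex.exp z - 1 - z‖ ≤ ‖z‖ ^ 2 * X := by
    have := Complex.norm_exp_sub_sum_le_norm_mul_exp z 2
    simp [Finset.sum_range_succ] at this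
    rw [sub_sub]
    exact this.trans (by gcongr)
  have r3 : ‖Complex.exp z - 1 - z - z ^ 2 / 2‖ ≤ ‖z‖ ^ 3 * X := by
    have := Complex.norm_exp_sub_sum_le_norm_mul_exp z 3
    simp [Finset.sum_range_succ, Nat.factorial] at this
    rw [sub_sub, sub_sub, ← add_assoc]
    exact this.trans (by gcongr)
  have h4 : (1 : ℝ) ≤ 4 * Real.pi := by linarith [Real.pi_gt_three]
  have n4 : ∀ n : ℕ, ‖(4 * Real.pi * (t : ℂ) ^ n : ℂ)‖ = 4 * Real.pi * t ^ n := fun n => by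
    simp [abs_of_pos ht, abs_of_pos Real.pi_pos]
  have key : ∀ (w : ℂ) (n : ℕ) (B : ℝ), 0 ≤ B → ‖w‖ ≤ B * t ^ n →
      ‖w / (4 * Real.pi * (t : ℂ) ^ n)‖ ≤ B := by
    intro w n B hB hw
    rw [norm_div, n4, div_le_iff₀ (by positivity)]
    refine hw.trans ?_
    gcongr
    exact le_mul_of_one_le_left (by positivity) h4
  have hk := abs_nonneg κ
  refine ⟨?_, ?_, ?_⟩
  · have : outProf κ t - outProf 0 t = (Complex.exp z - 1) / (4 * Real.pi * (t : ℂ) ^ 1) := by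
      rw [outProf, outProf, e0, ← hz]; field_simp
    rw [this]
    refine (key _ 1 (|κ| * X) (by positivity) ?_).trans ?_
    · refine r1.trans_eq ?_; rw [hzn]; ring
    · gcongr; nlinarith [pow_nonneg hk 2, pow_nonneg hk 3]
  · have : outProf₁ κ t - outProf₁ 0 t =
        (z * (Complex.exp z - 1) - (Complex.exp z - 1 - z)) / (4 * Real.pi * (t : ℂ) ^ 2) := by
      rw [outProf₁, outProf₁, e0, ← hz]
      have : -(Complex.I * κ) / t = z / (t : ℂ) ^ 2 := by rw [hz]; field_simp
      rw [this]
      simp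
      field_simp
      ring
    rw [this]
    refine (key _ 2 (2 * |κ| ^ 2 * X) (by positivity) ?_).trans ?_
    · refine (norm_sub_le _ _).trans ?_
      rw [norm_mul]
      have := mul_le_mul_of_nonneg_left r1 (norm_nonneg z)
      rw [hzn] at *
      nlinarith
    · gcongr; nlinarith [pow_nonneg hk 2, pow_nonneg hk 3]
  · have : outProf₂ κ t - outProf₂ 0 t =
        (z ^ 2 * (Complex.exp z - 1) - 2 * z * (Complex.exp z - 1 - z) +
          2 * (Complex.exp z - 1 - z - z ^ 2 / 2)) / (4 * Real.pi * (t : ℂ) ^ 3) := by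
      rw [outProf₂, outProf₂, e0, ← hz]
      have h1 : -(κ : ℂ) ^ 2 / t = z ^ 2 / (t : ℂ) ^ 3 := by
        rw [hz, mul_pow, mul_pow, neg_sq, Complex.I_sq]; field_simp
      have h2 : 2 * (Complex.I * κ) / (t : ℂ) ^ 2 = - 2 * z / (t : ℂ) ^ 3 := by
        rw [hz]; field_simp
      rw [h1, h2]
      simp
      field_simp
      ring
    rw [this]
    refine (key _ 3 (5 * |κ| ^ 3 * X) (by positivity) ?_).trans ?_
    · refine (norm_add_le _ _).trans ?_
      refine (add_le_add (norm_sub_le _ _) le_rfl).trans ?_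
      rw [norm_mul, norm_mul (2 * z), norm_mul 2 z, norm_mul 2, norm_pow, Complex.norm_ofNat]
      have a1 := mul_le_mul_of_nonneg_left r1 (pow_nonneg (norm_nonneg z) 2)
      have a2 := mul_le_mul_of_nonneg_left r2 (norm_nonneg z)
      rw [hzn] at *
      nlinarith
    · gcongr; nlinarith [pow_nonneg hk 2, pow_nonneg hk 3]

lemma g_eq (k : ℝ) (x y : Space) : g k x y = outProf k ‖x - y‖ := rfl

lemma g₀_eq (x y : Space) : g₀ x y = outProf 0 ‖x - y‖ := by simp [g₀, outProf]

lemma gReg_eq (k : ℝ) (x y : Space) : gReg k x y = outProf k ‖x - y‖ - outProf 0 ‖x - y‖ := by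
  rw [gReg, g_eq, g₀_eq]

lemma hessG_eq (k : ℝ) {x y : Space} (h : x ≠ y) :
    hessG k x y = radialHess (outProf₁ k ‖x - y‖) (outProf₂ k ‖x - y‖) y x :=
  hess_radial h (fun _ ht => hasDerivAt_outProf k ht)
    (hasDerivAt_outProf₁ k (norm_pos_iff.2 (sub_ne_zero.2 h)))

lemma hessG₀_eq {x y : Space} (h : x ≠ y) :
    hessG₀ x y = radialHess (outProf₁ 0 ‖x - y‖) (outProf₂ 0 ‖x - y‖) y x := by
  rw [← hessG_eq 0 h, hessG₀, hessG]
  congr 1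
  ext z
  rw [g₀_eq, g_eq]

lemma hessGReg_eq (k : ℝ) {x y : Space} (h : x ≠ y) :
    hessGReg k x y = radialHess (outProf₁ k ‖x - y‖ - outProf₁ 0 ‖x - y‖)
      (outProf₂ k ‖x - y‖ - outProf₂ 0 ‖x - y‖) y x := by
  simp only [hessGReg, gReg_eq]
  exact hess_radial (q := fun t => outProf k t - outProf 0 t)
    (q' := fun t => outProf₁ k t - outProf₁ 0 t) h
    (fun _ ht => (hasDerivAt_outProf k ht).sub (hasDerivAt_outProf 0 ht))
    ((hasDerivAt_outProf₁ k (norm_pos_iff.2 (sub_ne_zero.2 h))).sub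
      (hasDerivAt_outProf₁ 0 (norm_pos_iff.2 (sub_ne_zero.2 h))))

/-! ### Cut-off Green's functions -/

/-- The Helmholtz kernel with pole `r`, multiplied by the radial cut-off function `S`. -/
def cutG (κ : ℝ) (S : ℝ → ℝ) (r x : Space) : ℂ := S ‖x - r‖ * outProf κ ‖x - r‖

/-- The Hessian of `cutG` away from the pole. -/
def cutHess (κ : ℝ) (S : ℝ → ℝ) (r x : Space) : Dyadic :=
  radialHess (deriv S ‖x - r‖ * outProf κ ‖x - r‖ + S ‖x - r‖ * outProf₁ κ ‖x - r‖)
    (deriv (deriv S) ‖x - r‖ * outProf κ ‖x - r‖ + 2 * deriv S ‖x - r‖ * outProf₁ κ ‖x - r‖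
      + S ‖x - r‖ * outProf₂ κ ‖x - r‖) r x

variable {S : ℝ → ℝ}

lemma hasDerivAt_of_smooth (hS : ContDiff ℝ (⊤ : ℕ∞) S) (t : ℝ) :
    HasDerivAt S (deriv S t) t ∧ HasDerivAt (deriv S) (deriv (deriv S) t) t := by
  have h1 : ContDiff ℝ (⊤ : ℕ∞) (deriv S) := (contDiff_infty_iff_deriv.1 hS).2
  exact ⟨((hS.differentiable (by simp)) t).hasDerivAt, ((h1.differentiable (by simp)) t).hasDerivAt⟩

lemma hess_cutG (κ : ℝ) (hS : ContDiff ℝ (⊤ : ℕ∞) S) {r x : Space} (h : x ≠ r) :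
    hess (cutG κ S r) x = cutHess κ S r x := by
  have hpos := norm_pos_iff.2 (sub_ne_zero.2 h)
  refine hess_radial (q := fun t => S t * outProf κ t)
    (q' := fun t => deriv S t * outProf κ t + S t * outProf₁ κ t) h
    (fun t ht => (hasDerivAt_of_smooth hS t).1.ofReal_comp.mul (hasDerivAt_outProf κ ht)) ?_
  refine (((hasDerivAt_of_smooth hS ‖x - r‖).2.ofReal_comp.mul (hasDerivAt_outProf κ hpos)).add
    ((hasDerivAt_of_smooth hS ‖x - r‖).1.ofReal_comp.mul
      (hasDerivAt_outProf₁ κ hpos))).congr_deriv ?_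
  ring

lemma laplacian_cutG (κ : ℝ) (hS : ContDiff ℝ (⊤ : ℕ∞) S) {r x : Space} (h : x ≠ r) :
    ∑ i, hess (cutG κ S r) x i i + κ ^ 2 * cutG κ S r x =
      (deriv (deriv S) ‖x - r‖ - 2 * (Complex.I * κ) * deriv S ‖x - r‖) * outProf κ ‖x - r‖ := by
  have hpos := norm_pos_iff.2 (sub_ne_zero.2 h)
  have h0 : (‖x - r‖ : ℂ) ≠ 0 := by exact_mod_cast hpos.ne'
  have hpi : (Real.pi : ℂ) ≠ 0 := by exact_mod_cast Real.pi_ne_zero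
  rw [hess_cutG κ hS h, cutHess, trace_radialHess h, cutG, outProf, outProf₁, outProf₂]
  field_simp
  ring

lemma contDiff_cutG (κ : ℝ) (hS : ContDiff ℝ (⊤ : ℕ∞) S) {t₀ : ℝ} (ht₀ : 0 < t₀)
    (h0 : ∀ t < t₀, S t = 0) (r : Space) : ContDiff ℝ (⊤ : ℕ∞) (cutG κ S r) :=
  contDiff_radial (q := fun t => S t * outProf κ t) ht₀ (fun t ht => by simp [h0 t ht]) fun t ht =>
    (Complex.ofRealCLM.contDiff.comp hS).contDiffAt.mul (contDiffAt_outProf κ ht)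

lemma hasCompactSupport_cutG (κ : ℝ) {t₁ : ℝ} (h1 : ∀ t, t₁ < t → S t = 0) (r : Space) :
    HasCompactSupport (cutG κ S r) :=
  hasCompactSupport_radial (q := fun t => S t * outProf κ t) (t₁ := t₁) fun t ht => by
    simp [h1 t ht]

/-! ### The wave equation tested against scalar potentials -/

section TestFunctions

variable {ζ : Space → ℂ}

lemma contDiff_pderiv (hζ : ContDiff ℝ (⊤ : ℕ∞) ζ) (i : Fin 3) :
    ContDiff ℝ (⊤ : ℕ∞) (pderiv i ζ) :=
  (hζ.fderiv_right (m := (⊤ : ℕ∞)) (by simp)).clm_apply contDiff_const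

lemma hasCompactSupport_pderiv (hc : HasCompactSupport ζ) (i : Fin 3) :
    HasCompactSupport (pderiv i ζ) :=
  hc.fderiv_apply (𝕜 := ℝ) _

lemma contDiff_hess (hζ : ContDiff ℝ (⊤ : ℕ∞) ζ) (i j : Fin 3) :
    ContDiff ℝ (⊤ : ℕ∞) (fun x => hess ζ x i j) :=
  contDiff_pderiv (contDiff_pderiv hζ j) i

lemma hasCompactSupport_hess (hc : HasCompactSupport ζ) (i j : Fin 3) :
    HasCompactSupport (fun x => hess ζ x i j) :=
  hasCompactSupport_pderiv (hasCompactSupport_pderiv hc j) i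

lemma pderiv_comm (hζ : ContDiff ℝ (⊤ : ℕ∞) ζ) (i j : Fin 3) (x : Space) :
    pderiv i (pderiv j ζ) x = pderiv j (pderiv i ζ) x := by
  have hd : DifferentiableAt ℝ (fderiv ℝ ζ) x :=
    (hζ.fderiv_right (m := (⊤ : ℕ∞)) (by simp)).differentiable (by simp) x
  have key : ∀ a b : Fin 3, pderiv a (pderiv b ζ) x =
      fderiv ℝ (fderiv ℝ ζ) x (EuclideanSpace.single a 1) (EuclideanSpace.single b 1) := by
    intro a b
    have := (hd.hasFDerivAt.clm_apply
      (hasFDerivAt_const (EuclideanSpace.single b (1 : ℝ) : Space) x)).fderiv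
    change fderiv ℝ (fun y => fderiv ℝ ζ y (EuclideanSpace.single b 1)) x _ = _
    rw [this]
    simp
  rw [key, key]
  exact (hζ.contDiffAt.isSymmSndFDerivAt (by
    simpa using (WithTop.coe_le_coe.2 (le_top : (2 : ℕ∞) ≤ ⊤) : ((2 : ℕ∞) : WithTop ℕ∞) ≤ _))) _ _

lemma pderiv_zero' (i : Fin 3) (x : Space) : pderiv i (fun _ => 0) x = 0 := by
  simp [pderiv]

lemma pderiv_neg' {f : Space → ℂ} (i : Fin 3) (x : Space) :
    pderiv i (fun y => - f y) x = - pderiv i f x := by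
  simp [pderiv, fderiv_fun_neg]

/-- The gradient, as a vector field. -/
def grad (ζ : Space → ℂ) (x : Space) : CVec := fun i => pderiv i ζ x

lemma curl_grad (hζ : ContDiff ℝ (⊤ : ℕ∞) ζ) : curl (grad ζ) = 0 := by
  ext x i
  fin_cases i <;> simp [curl, grad] <;> rw [sub_eq_zero] <;> exact pderiv_comm hζ _ _ x

lemma curl_zero : curl (0 : Space → CVec) = 0 := by
  ext x i
  fin_cases i <;> simp [curl, pderiv]

lemma curl_curl_single (hζ : ContDiff ℝ (⊤ : ℕ∞) ζ) (j : Fin 3) (x : Space) :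
    curl (curl (fun y => Pi.single j (ζ y))) x =
      fun i => hess ζ x i j - if i = j then ∑ l, hess ζ x l l else 0 := by
  ext i
  fin_cases j <;> fin_cases i <;>
    simp [curl, pderiv_zero', hess, Fin.sum_univ_three, pderiv_neg', Pi.single,
      Function.update, pderiv_comm hζ 1 0, pderiv_comm hζ 2 0, pderiv_comm hζ 2 1] <;> ring

lemma LocallyIntegrable.integrable_mul_test {f : Space → CVec} (hf : LocallyIntegrable f)
    {h : Space → ℂ} (hh : Continuous h) (hc : HasCompactSupport h) (i : Fin 3) :
    Integrable (fun x => f x i * h x) := by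
  have := (hf.integrable_smul_left_of_hasCompactSupport hh hc).eval i
  simpa [mul_comm] using this

end TestFunctions

/-- The total source `-iωμ J_e + ω²μ P` of the homogeneous medium, `P = Δε E` being the
polarization. -/
def source (ω μ : ℝ) (Je P : Space → CVec) (x : Space) : CVec :=
  (-Complex.I * ω * μ) • Je x + ((ω : ℂ) ^ 2 * μ) • P x

/-- Testing the wave equation with `∇∂ⱼζ` and with `ζ eⱼ` and eliminating the divergence of `E`
shows that each Cartesian component of `E` solves a scalar Helmholtz equation. -/
theorem weak_helmholtz {ω μ εL k : ℝ} (hω : 0 < ω) (hμ : 0 < μ)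
    (hk : 0 < k) (hk2 : k ^ 2 = ω ^ 2 * εL * μ) {Δε : Space → ℂ} {Je E : Space → CVec}
    (hJe : Integrable Je) (hE : LocallyIntegrable E) (hΔεE : Integrable (fun x => Δε x • E x))
    (hwave : IsWeakWaveSolution ω μ (fun x => (εL : ℂ) + Δε x) Je E)
    {ζ : Space → ℂ} (hζ : ContDiff ℝ (⊤ : ℕ∞) ζ) (hc : HasCompactSupport ζ) (j : Fin 3) :
    ∫ x, E x j * (∑ i, hess ζ x i i + (k : ℂ) ^ 2 * ζ x) =
      -(∫ x, source ω μ Je (fun x => Δε x • E x) x j * ζ x) -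
        1 / (k : ℂ) ^ 2 *
          ∫ x, ∑ i, source ω μ Je (fun x => Δε x • E x) x i * hess ζ x i j := by
  set P : Space → CVec := fun x => Δε x • E x with hP
  have hω' : (ω : ℂ) ≠ 0 := by exact_mod_cast hω.ne'
  have hμ' : (μ : ℂ) ≠ 0 := by exact_mod_cast hμ.ne'
  have hk' : (k : ℂ) ≠ 0 := by exact_mod_cast hk.ne'
  have hk2' : (k : ℂ) ^ 2 = ω ^ 2 * εL * μ := by exact_mod_cast hk2
  have hH := contDiff_hess hζ
  have hHc := hasCompactSupport_hess hc
  have iE : ∀ i {h : Space → ℂ}, ContDiff ℝ (⊤ : ℕ∞) h → HasCompactSupport h →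
      Integrable (fun x => E x i * h x) :=
    fun i h h1 h2 => LocallyIntegrable.integrable_mul_test hE h1.continuous h2 i
  have iP : ∀ i {h : Space → ℂ}, ContDiff ℝ (⊤ : ℕ∞) h → HasCompactSupport h →
      Integrable (fun x => P x i * h x) :=
    fun i h h1 h2 => LocallyIntegrable.integrable_mul_test hΔεE.locallyIntegrable h1.continuous h2 i
  have iJ : ∀ i {h : Space → ℂ}, ContDiff ℝ (⊤ : ℕ∞) h → HasCompactSupport h →
      Integrable (fun x => Je x i * h x) :=
    fun i h h1 h2 => LocallyIntegrable.integrable_mul_test hJe.locallyIntegrable h1.continuous h2 i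
  -- the divergence equation, tested with `∂ⱼζ`
  have hdiv := hwave (grad (pderiv j ζ))
    (contDiff_pi.2 fun i => contDiff_pderiv (contDiff_pderiv hζ j) i)
    (by
      refine HasCompactSupport.of_support_subset_isCompact (K := tsupport ζ) hc fun x hx => ?_
      by_contra hxn
      refine hx (funext fun i => ?_)
      exact image_eq_zero_of_notMem_tsupport (f := pderiv i (pderiv j ζ)) fun hh => hxn
        ((tsupport_fderiv_apply_subset ℝ _).trans (tsupport_fderiv_apply_subset ℝ _) hh))
  rw [curl_grad (contDiff_pderiv hζ j), curl_zero] at hdiv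
  -- the vector equation, tested with `ζ eⱼ`
  have hvec := hwave (fun y => Pi.single j (ζ y))
    (contDiff_pi.2 fun i => by
      by_cases h : i = j
      · subst h; simpa using hζ
      · simpa [h] using contDiff_const)
    (hc.comp_left (g := fun z : ℂ => (Pi.single j z : CVec)) (by simp))
  have hgr : ∀ x, grad (pderiv j ζ) x = fun i => hess ζ x i j := fun x => rfl
  simp only [curl_curl_single hζ, hgr, dotProduct, Pi.zero_apply, mul_zero, Finset.sum_const_zero,
    integral_zero, zero_sub, Pi.smul_apply, smul_eq_mul] at hdiv hvec
  have e1 : ∀ x, ∑ i, (εL + Δε x) * E x i * hess ζ x i j =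
      εL * (∑ i, E x i * hess ζ x i j) + ∑ i, P x i * hess ζ x i j := by
    intro x
    simp only [hP, Pi.smul_apply, smul_eq_mul, Finset.mul_sum, ← Finset.sum_add_distrib]
    exact Finset.sum_congr rfl fun i _ => by ring
  have e2 : ∀ x, ∑ i, (εL + Δε x) * E x i * (Pi.single j (ζ x) : CVec) i =
      εL * (E x j * ζ x) + P x j * ζ x := by
    intro x
    simp [hP, Pi.single_apply]; ring
  have e3 : ∀ x, ∑ i, Je x i * (Pi.single j (ζ x) : CVec) i = Je x j * ζ x := by
    intro x; simp [Pi.single_apply]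
  have e4 : ∀ x, ∑ i, E x i * (hess ζ x i j - if i = j then ∑ l, hess ζ x l l else 0) =
      (∑ i, E x i * hess ζ x i j) - E x j * ∑ l, hess ζ x l l := by
    intro x; simp [mul_sub, Finset.sum_sub_distrib]
  simp only [e1, e2, e3, e4] at hdiv hvec
  have hL : ContDiff ℝ (⊤ : ℕ∞) (fun x => ∑ l, hess ζ x l l) := ContDiff.sum fun i _ => hH i i
  have hLc : HasCompactSupport (fun x => ∑ l, hess ζ x l l) := by
    simp only [Fin.sum_univ_three]; exact ((hHc 0 0).add (hHc 1 1)).add (hHc 2 2)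
  have s1 : Integrable (fun x => ∑ i, E x i * hess ζ x i j) :=
    integrable_finsetSum _ fun i _ => iE i (hH i j) (hHc i j)
  have s2 : Integrable (fun x => ∑ i, P x i * hess ζ x i j) :=
    integrable_finsetSum _ fun i _ => iP i (hH i j) (hHc i j)
  have s3 : Integrable (fun x => ∑ i, Je x i * hess ζ x i j) :=
    integrable_finsetSum _ fun i _ => iJ i (hH i j) (hHc i j)
  rw [integral_add (s1.const_mul _) s2, integral_const_mul] at hdiv
  rw [integral_add ((iE j hζ hc).const_mul _) (iP j hζ hc), integral_const_mul,
    integral_sub s1 (iE j hL hLc)] at hvec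
  have f1 : ∀ x, E x j * (∑ i, hess ζ x i i + (k : ℂ) ^ 2 * ζ x) =
      E x j * (∑ i, hess ζ x i i) + (k : ℂ) ^ 2 * (E x j * ζ x) := fun x => by ring
  have f2 : ∀ x, source ω μ Je P x j * ζ x =
      (-Complex.I * ω * μ) * (Je x j * ζ x) + (ω ^ 2 * μ) * (P x j * ζ x) := fun x => by
    simp [source]; ring
  have f3 : ∀ x, ∑ i, source ω μ Je P x i * hess ζ x i j =
      (-Complex.I * ω * μ) * (∑ i, Je x i * hess ζ x i j) +
        (ω ^ 2 * μ) * (∑ i, P x i * hess ζ x i j) := fun x => by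
    simp only [Finset.mul_sum, ← Finset.sum_add_distrib]
    exact Finset.sum_congr rfl fun i _ => by simp [source]; ring
  simp only [f1, f2, f3]
  rw [integral_add (iE j hL hLc) ((iE j hζ hc).const_mul _),
    integral_add ((iJ j hζ hc).const_mul _) ((iP j hζ hc).const_mul _),
    integral_add (s3.const_mul _) (s2.const_mul _)]
  simp only [integral_const_mul]
  generalize (∫ x, ∑ i, E x i * hess ζ x i j) = a1 at *
  generalize (∫ x, ∑ i, P x i * hess ζ x i j) = a2 at *
  generalize (∫ x, ∑ i, Je x i * hess ζ x i j) = a3 at *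
  generalize (∫ x, E x j * ∑ i, hess ζ x i i) = a4 at *
  generalize (∫ x, E x j * ζ x) = a5 at *
  generalize (∫ x, P x j * ζ x) = a6 at *
  generalize (∫ x, Je x j * ζ x) = a7 at *
  have g1 : (ω : ℂ) ^ 2 * εL * a1 = Complex.I * ω * a3 - ω ^ 2 * a2 := by linear_combination -hdiv
  have g2 : a4 = a1 - μ * (ω ^ 2 * (εL * a5 + a6) - Complex.I * ω * a7) := by
    field_simp at hvec
    linear_combination -hvec
  have g3 : a1 = (1 / (k : ℂ) ^ 2) * (μ * (Complex.I * ω * a3 - ω ^ 2 * a2)) := by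
    rw [← g1]; field_simp; rw [hk2']; ring
  rw [g2, g3, hk2']
  ring

/-! ### Radial cut-off functions -/

lemma contDiff_deriv_of_smooth {S : ℝ → ℝ} (hS : ContDiff ℝ (⊤ : ℕ∞) S) :
    ContDiff ℝ (⊤ : ℕ∞) (deriv S) := (contDiff_infty_iff_deriv.1 hS).2

lemma contDiff_smoothTransition : ContDiff ℝ (⊤ : ℕ∞) Real.smoothTransition :=
  Real.smoothTransition.contDiff

lemma deriv_eq_zero_of_eqOn_Iic {S : ℝ → ℝ} (hS : ContDiff ℝ (⊤ : ℕ∞) S) {a c : ℝ}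
    (h : ∀ t ≤ a, S t = c) : ∀ t ≤ a, deriv S t = 0 := by
  have h1 : ∀ t < a, deriv S t = 0 := fun t ht => by
    have : S =ᶠ[𝓝 t] fun _ => c := by
      filter_upwards [Iio_mem_nhds ht] with u hu using h u (le_of_lt hu)
    rw [this.deriv_eq, deriv_const]
  have hcl : IsClosed {t | deriv S t = 0} :=
    isClosed_eq (contDiff_deriv_of_smooth hS).continuous continuous_const
  intro t ht
  have : closure (Set.Iio a) ⊆ {t | deriv S t = 0} := hcl.closure_subset_iff.2 h1
  exact this (by rw [closure_Iio]; exact ht)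

lemma deriv_eq_zero_of_eqOn_Ici {S : ℝ → ℝ} (hS : ContDiff ℝ (⊤ : ℕ∞) S) {a c : ℝ}
    (h : ∀ t, a ≤ t → S t = c) : ∀ t, a ≤ t → deriv S t = 0 := by
  have h1 : ∀ t, a < t → deriv S t = 0 := fun t ht => by
    have : S =ᶠ[𝓝 t] fun _ => c := by
      filter_upwards [Ioi_mem_nhds ht] with u hu using h u (le_of_lt hu)
    rw [this.deriv_eq, deriv_const]
  have hcl : IsClosed {t | deriv S t = 0} :=
    isClosed_eq (contDiff_deriv_of_smooth hS).continuous continuous_const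
  intro t ht
  have : closure (Set.Ioi a) ⊆ {t | deriv S t = 0} := hcl.closure_subset_iff.2 h1
  exact this (by rw [closure_Ioi]; exact ht)

/-- The cut-off function that removes the ball of radius `η / 2` about the pole and is `1`
outside the ball of radius `η`. -/
def innerCut (η t : ℝ) : ℝ := Real.smoothTransition (2 * (t / η) - 1)

/-- The cut-off function at infinity: it descends from `1` to `0` in two equal steps that are
a distance `π / (2k)` apart, so that `t ↦ exp(-2ikt)` is orthogonal to its derivative. -/
def outerCut (k R t : ℝ) : ℝ :=
  1 - (Real.smoothTransition (t - R) + Real.smoothTransition (t - Real.pi / (2 * k) - R)) / 2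

/-- The width of the transition region of `outerCut`. -/
def outerWidth (k : ℝ) : ℝ := 1 + Real.pi / (2 * k)

section InnerCut

variable {η t : ℝ}

lemma contDiff_innerCut (η : ℝ) : ContDiff ℝ (⊤ : ℕ∞) (innerCut η) :=
  contDiff_smoothTransition.comp (((contDiff_id.div_const η).const_smul (2 : ℝ)).sub contDiff_const)

lemma innerCut_of_le (hη : 0 < η) (ht : t ≤ η / 2) : innerCut η t = 0 := by
  refine Real.smoothTransition.zero_of_nonpos ?_
  have : t / η ≤ 1 / 2 := by rw [div_le_iff₀ hη]; linarith
  linarith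

lemma innerCut_of_ge (hη : 0 < η) (ht : η ≤ t) : innerCut η t = 1 := by
  refine Real.smoothTransition.one_of_one_le ?_
  have : 1 ≤ t / η := by rwa [one_le_div hη]
  linarith

lemma abs_innerCut_le (η t : ℝ) : |innerCut η t| ≤ 1 := by
  rw [innerCut, abs_of_nonneg (Real.smoothTransition.nonneg _)]
  exact Real.smoothTransition.le_one _

lemma innerCut_scale (η t : ℝ) : innerCut η t = innerCut 1 (t / η) := by simp [innerCut]

lemma deriv_innerCut (η t : ℝ) : deriv (innerCut η) t = deriv (innerCut 1) (t / η) / η := by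
  have h1 : innerCut η = fun t => innerCut 1 (t / η) := funext (innerCut_scale η)
  have h2 := (hasDerivAt_of_smooth (contDiff_innerCut 1) (t / η)).1
  have h3 : HasDerivAt (fun t => t / η) (1 / η) t := (hasDerivAt_id t).div_const η
  have h4 := HasDerivAt.comp (h₂ := innerCut 1) t h2 h3
  rw [h1, ← Function.comp_def, h4.deriv]; ring

lemma deriv_deriv_innerCut (η t : ℝ) :
    deriv (deriv (innerCut η)) t = deriv (deriv (innerCut 1)) (t / η) / η ^ 2 := by
  have h1 : deriv (innerCut η) = fun t => deriv (innerCut 1) (t / η) / η :=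
    funext (deriv_innerCut η)
  have h2 := (hasDerivAt_of_smooth (contDiff_innerCut 1) (t / η)).2
  have h3 : HasDerivAt (fun t => t / η) (1 / η) t := (hasDerivAt_id t).div_const η
  have h4 := (HasDerivAt.comp (h₂ := deriv (innerCut 1)) t h2 h3).div_const η
  simp only [Function.comp_apply] at h4
  rw [h1, h4.deriv]; ring

lemma deriv_innerCut_of_le (hη : 0 < η) : ∀ t ≤ η / 2, deriv (innerCut η) t = 0 :=
  deriv_eq_zero_of_eqOn_Iic (contDiff_innerCut η) fun _ => innerCut_of_le hη

lemma deriv_innerCut_of_ge (hη : 0 < η) : ∀ t, η ≤ t → deriv (innerCut η) t = 0 :=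
  deriv_eq_zero_of_eqOn_Ici (contDiff_innerCut η) fun _ => innerCut_of_ge hη

lemma deriv_deriv_innerCut_of_le (hη : 0 < η) : ∀ t ≤ η / 2, deriv (deriv (innerCut η)) t = 0 :=
  deriv_eq_zero_of_eqOn_Iic (contDiff_deriv_of_smooth (contDiff_innerCut η))
    (deriv_innerCut_of_le hη)

lemma deriv_deriv_innerCut_of_ge (hη : 0 < η) :
    ∀ t, η ≤ t → deriv (deriv (innerCut η)) t = 0 :=
  deriv_eq_zero_of_eqOn_Ici (contDiff_deriv_of_smooth (contDiff_innerCut η))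
    (deriv_innerCut_of_ge hη)

/-- The derivatives of the inner cut-off function are bounded by inverse powers of the distance
to the pole, uniformly in the cut-off radius. -/
lemma exists_bound_deriv_innerCut : ∃ C, 0 ≤ C ∧ ∀ η, 0 < η → ∀ t,
    |deriv (innerCut η) t| ≤ C / η ∧ |deriv (deriv (innerCut η)) t| ≤ C / η ^ 2 ∧
    (0 < t → |deriv (innerCut η) t| ≤ C / t ∧ |deriv (deriv (innerCut η)) t| ≤ C / t ^ 2) := by
  have c1 := contDiff_deriv_of_smooth (contDiff_innerCut 1)
  have c2 := contDiff_deriv_of_smooth c1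
  obtain ⟨C₁, h₁⟩ := (isCompact_Icc (a := (0 : ℝ)) (b := 1)).exists_bound_of_continuousOn
    c1.continuous.continuousOn
  obtain ⟨C₂, h₂⟩ := (isCompact_Icc (a := (0 : ℝ)) (b := 1)).exists_bound_of_continuousOn
    c2.continuous.continuousOn
  set C := max (max C₁ C₂) 0
  have hC : 0 ≤ C := le_max_right _ _
  have b1 : ∀ t, |deriv (innerCut 1) t| ≤ C := fun t => by
    by_cases ht : t ∈ Set.Icc (0 : ℝ) 1
    · exact (h₁ t ht).trans ((le_max_left _ _).trans (le_max_left _ _))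
    · rcases lt_or_ge t 0 with h | h
      · simpa [deriv_innerCut_of_le one_pos t (by linarith)] using hC
      · have : 1 ≤ t := by by_contra hh; exact ht ⟨h, by linarith⟩
        simpa [deriv_innerCut_of_ge one_pos t this] using hC
  have b2 : ∀ t, |deriv (deriv (innerCut 1)) t| ≤ C := fun t => by
    by_cases ht : t ∈ Set.Icc (0 : ℝ) 1
    · exact (h₂ t ht).trans ((le_max_right _ _).trans (le_max_left _ _))
    · rcases lt_or_ge t 0 with h | h
      · simpa [deriv_deriv_innerCut_of_le one_pos t (by linarith)] using hC
      · have : 1 ≤ t := by by_contra hh; exact ht ⟨h, by linarith⟩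
        simpa [deriv_deriv_innerCut_of_ge one_pos t this] using hC
  refine ⟨C, hC, fun η hη t => ?_⟩
  have d1 : |deriv (innerCut η) t| ≤ C / η := by
    rw [deriv_innerCut, abs_div, abs_of_pos hη]
    gcongr; exact b1 _
  have d2 : |deriv (deriv (innerCut η)) t| ≤ C / η ^ 2 := by
    rw [deriv_deriv_innerCut, abs_div, abs_of_pos (pow_pos hη 2)]
    gcongr; exact b2 _
  refine ⟨d1, d2, fun ht => ?_⟩
  rcases le_or_gt η t with h | h
  · rw [deriv_innerCut_of_ge hη t h, deriv_deriv_innerCut_of_ge hη t h, abs_zero]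
    constructor <;> positivity
  · exact ⟨d1.trans (by gcongr), d2.trans (by gcongr)⟩

end InnerCut

section OuterCut

variable {k R t : ℝ}

lemma contDiff_outerCut (k R : ℝ) : ContDiff ℝ (⊤ : ℕ∞) (outerCut k R) :=
  contDiff_const.sub (((contDiff_smoothTransition.comp (contDiff_id.sub contDiff_const)).add
    (contDiff_smoothTransition.comp
      ((contDiff_id.sub contDiff_const).sub contDiff_const))).div_const 2)

lemma outerCut_of_le (hk : 0 < k) (ht : t ≤ R) : outerCut k R t = 1 := by
  have : 0 < Real.pi / (2 * k) := by positivity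
  rw [outerCut, Real.smoothTransition.zero_of_nonpos (by linarith),
    Real.smoothTransition.zero_of_nonpos (by linarith)]
  simp

lemma outerCut_of_ge (hk : 0 < k) (ht : R + outerWidth k ≤ t) : outerCut k R t = 0 := by
  have : 0 < Real.pi / (2 * k) := by positivity
  rw [outerWidth] at ht
  rw [outerCut, Real.smoothTransition.one_of_one_le (by linarith),
    Real.smoothTransition.one_of_one_le (by linarith)]
  norm_num

lemma deriv_outerCut_of_le (hk : 0 < k) : ∀ t ≤ R, deriv (outerCut k R) t = 0 :=
  deriv_eq_zero_of_eqOn_Iic (contDiff_outerCut k R) fun _ => outerCut_of_le hk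

lemma deriv_outerCut_of_ge (hk : 0 < k) : ∀ t, R + outerWidth k ≤ t → deriv (outerCut k R) t = 0 :=
  deriv_eq_zero_of_eqOn_Ici (contDiff_outerCut k R) fun _ => outerCut_of_ge hk

lemma deriv_deriv_outerCut_of_le (hk : 0 < k) : ∀ t ≤ R, deriv (deriv (outerCut k R)) t = 0 :=
  deriv_eq_zero_of_eqOn_Iic (contDiff_deriv_of_smooth (contDiff_outerCut k R))
    (deriv_outerCut_of_le hk)

lemma deriv_deriv_outerCut_of_ge (hk : 0 < k) :
    ∀ t, R + outerWidth k ≤ t → deriv (deriv (outerCut k R)) t = 0 :=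
  deriv_eq_zero_of_eqOn_Ici (contDiff_deriv_of_smooth (contDiff_outerCut k R))
    (deriv_outerCut_of_ge hk)

lemma deriv_outerCut (k R t : ℝ) : deriv (outerCut k R) t = deriv (outerCut k 0) (t - R) := by
  have : outerCut k R = fun t => outerCut k 0 (t - R) := by
    funext t; simp only [outerCut, sub_zero]; ring_nf
  rw [this, deriv_comp_sub_const]

lemma deriv_deriv_outerCut (k R t : ℝ) :
    deriv (deriv (outerCut k R)) t = deriv (deriv (outerCut k 0)) (t - R) := by
  rw [show deriv (outerCut k R) = fun t => deriv (outerCut k 0) (t - R) from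
    funext (deriv_outerCut k R), deriv_comp_sub_const]

lemma exists_bound_deriv_outerCut (hk : 0 < k) : ∃ C, 0 ≤ C ∧ ∀ R t,
    |deriv (outerCut k R) t| ≤ C ∧ |deriv (deriv (outerCut k R)) t| ≤ C := by
  have c1 := contDiff_deriv_of_smooth (contDiff_outerCut k 0)
  have c2 := contDiff_deriv_of_smooth c1
  obtain ⟨C₁, h₁⟩ := (isCompact_Icc (a := (0 : ℝ)) (b := outerWidth k)).exists_bound_of_continuousOn
    c1.continuous.continuousOn
  obtain ⟨C₂, h₂⟩ := (isCompact_Icc (a := (0 : ℝ)) (b := outerWidth k)).exists_bound_of_continuousOn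
    c2.continuous.continuousOn
  set C := max (max C₁ C₂) 0
  have hC : 0 ≤ C := le_max_right _ _
  refine ⟨C, hC, fun R t => ?_⟩
  rw [deriv_outerCut, deriv_deriv_outerCut]
  set s := t - R
  by_cases hs : s ∈ Set.Icc (0 : ℝ) (outerWidth k)
  · exact ⟨(h₁ s hs).trans ((le_max_left _ _).trans (le_max_left _ _)),
      (h₂ s hs).trans ((le_max_right _ _).trans (le_max_left _ _))⟩
  · rcases lt_or_ge s 0 with h | h
    · rw [deriv_outerCut_of_le hk s h.le, deriv_deriv_outerCut_of_le hk s h.le]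
      simpa using hC
    · have : 0 + outerWidth k ≤ s := by by_contra hh; exact hs ⟨h, by linarith⟩
      rw [deriv_outerCut_of_ge hk s this, deriv_deriv_outerCut_of_ge hk s this]
      simpa using hC

/-- The two steps of the outer cut-off function are half a wavelength of `exp(-2ikt)` apart, so
their contributions cancel. -/
lemma integral_deriv_outerCut_mul_cexp (hk : 0 < k) (R : ℝ) :
    ∫ t : ℝ, ((deriv (outerCut k R) t : ℝ) : ℂ) *
      Complex.exp (-Complex.I * (2 * k : ℝ) * t) = 0 := by
  set s' := deriv Real.smoothTransition with hs'
  set w : ℝ → ℂ := fun t => Complex.exp (-Complex.I * (2 * k : ℝ) * t) with hw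
  have hd : ∀ t, HasDerivAt Real.smoothTransition (s' t) t := fun t =>
    (hasDerivAt_of_smooth contDiff_smoothTransition t).1
  have hcont : Continuous s' := (contDiff_deriv_of_smooth contDiff_smoothTransition).continuous
  have hsupp : HasCompactSupport s' :=
    HasCompactSupport.intro (isCompact_Icc (a := (0 : ℝ)) (b := 1)) fun t ht => by
      rcases le_or_gt t 0 with h | h
      · exact deriv_eq_zero_of_eqOn_Iic contDiff_smoothTransition
          (fun u hu => Real.smoothTransition.zero_of_nonpos hu) t h
      · exact deriv_eq_zero_of_eqOn_Ici contDiff_smoothTransition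
          (fun u hu => Real.smoothTransition.one_of_one_le hu) t (by
            by_contra hh; exact ht ⟨h.le, by linarith⟩)
  have hwc : Continuous w := by fun_prop
  set I : (ℝ → ℂ) := fun t => (s' t : ℂ) * w t with hI
  have hIi : Integrable I := by
    refine (Continuous.mul (Complex.continuous_ofReal.comp hcont)
      hwc).integrable_of_hasCompactSupport ?_
    exact (hsupp.comp_left (g := Complex.ofReal) rfl).mul_right
  have hder : ∀ t, deriv (outerCut k R) t = -(s' (t - R) + s' (t - Real.pi / (2 * k) - R)) / 2 := by
    intro t
    have h1 : HasDerivAt (fun t => Real.smoothTransition (t - R)) (s' (t - R)) t :=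
      (hd (t - R)).comp_sub_const t R
    have h2 : HasDerivAt (fun t => Real.smoothTransition (t - Real.pi / (2 * k) - R))
        (s' (t - Real.pi / (2 * k) - R)) t := by
      have := (hd (t - (Real.pi / (2 * k) + R))).comp_sub_const t _
      simpa only [sub_sub] using this
    have h3 : HasDerivAt (outerCut k R) _ t := ((h1.add h2).div_const 2).const_sub 1
    rw [h3.deriv]; ring
  have e1 : ∀ t, ((deriv (outerCut k R) t : ℝ) : ℂ) * w t =
      -(w R / 2) * I (t - R) + (w R / 2) * I (t - (Real.pi / (2 * k) + R)) := by
    intro t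
    have w1 : w t = w R * w (t - R) := by
      simp only [hw]; rw [← Complex.exp_add]; congr 1; push_cast; ring
    have w2 : w t = - w R * w (t - (Real.pi / (2 * k) + R)) := by
      have : w R = - (w R * Complex.exp (-(Real.pi * Complex.I))) := by
        rw [Complex.exp_neg, Complex.exp_pi_mul_I]; norm_num
      simp only [hw] at this ⊢
      rw [this, neg_neg, ← Complex.exp_add, ← Complex.exp_add]
      congr 1
      have hk' : (k : ℂ) ≠ 0 := by exact_mod_cast hk.ne'
      push_cast
      field_simp
      ring
    rw [hder]
    push_cast
    simp only [hI, sub_sub]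
    have : (-(s' (t - R) + s' (t - (Real.pi / (2 * k) + R))) / 2 : ℂ) * w t =
      -(s' (t - R) / 2 * w t) - s' (t - (Real.pi / (2 * k) + R)) / 2 * w t := by ring
    rw [this]
    nth_rewrite 1 [w1]
    rw [w2]
    ring
  refine (integral_congr_ae (Eventually.of_forall e1)).trans ?_
  rw [integral_add ((hIi.comp_sub_right R).const_mul _) ((hIi.comp_sub_right _).const_mul _),
    integral_const_mul, integral_const_mul, integral_sub_right_eq_self I,
    integral_sub_right_eq_self I]
  ring

end OuterCut

/-! ### Polar coordinates -/

/-- An integral over space is bounded by the area of the unit sphere times a bound for the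
integrals along rays. -/
lemma norm_integral_le_of_ray {f : Space → ℂ} (hf : Integrable f) {B : ℝ}
    (h : ∀ θ : Space, ‖θ‖ = 1 → ‖∫ t in Set.Ioi (0 : ℝ), ((t ^ 2 : ℝ) : ℂ) * f (t • θ)‖ ≤ B) :
    ‖∫ x, f x‖ ≤ B * (volume : Measure Space).toSphere.real Set.univ := by
  have hdim : Module.finrank ℝ Space = 3 := by simp
  have hmp := (volume : Measure Space).measurePreserving_homeomorphUnitSphereProd
  have hme := (homeomorphUnitSphereProd Space).measurableEmbedding
  set F : Metric.sphere (0 : Space) 1 × Set.Ioi (0 : ℝ) → ℂ := fun p => f (p.2.1 • p.1.1) with hF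
  have hFc : ∀ x : ({0}ᶜ : Set Space), F (homeomorphUnitSphereProd Space x) = f x := by
    intro x
    have hx : ‖x.1‖ ≠ 0 := norm_ne_zero_iff.2 x.2
    simp [hF, smul_smul, hx]
  have h1 : ∫ x, f x = ∫ p, F p ∂((volume : Measure Space).toSphere.prod
      (Measure.volumeIoiPow (Module.finrank ℝ Space - 1))) := by
    rw [← hmp.integral_comp hme]
    simp only [hFc]
    rw [integral_subtype_comap (measurableSet_singleton _).compl f, restrict_compl_singleton]
  have h2 : Integrable F ((volume : Measure Space).toSphere.prod
      (Measure.volumeIoiPow (Module.finrank ℝ Space - 1))) := by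
    rw [← hmp.integrable_comp_emb hme]
    have : F ∘ homeomorphUnitSphereProd Space = fun x : ({0}ᶜ : Set Space) => f x := funext hFc
    rw [this]
    have := (integrableOn_iff_comap_subtypeVal (μ := (volume : Measure Space)) (f := f)
      (measurableSet_singleton (0 : Space)).compl).1 hf.integrableOn
    exact this
  rw [h1, integral_prod _ h2]
  refine norm_integral_le_of_norm_le_const (Eventually.of_forall fun θ => ?_)
  have hθ : ‖θ.1‖ = 1 := by simp
  refine le_of_eq_of_le ?_ (h θ.1 hθ)
  congr 1
  rw [hdim]
  simp only [Measure.volumeIoiPow, ENNReal.ofReal]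
  rw [integral_withDensity_eq_integral_smul (measurable_subtype_coe.pow_const _).real_toNNReal,
    integral_subtype_comap measurableSet_Ioi fun a : ℝ => Real.toNNReal (a ^ (3 - 1)) • f (a • θ.1)]
  refine setIntegral_congr_fun measurableSet_Ioi fun x hx => ?_
  rw [NNReal.smul_def, Real.coe_toNNReal _ (pow_nonneg (le_of_lt hx) _)]
  simp

/-! ### The radiation condition -/

/-- The residual `(Δ + κ²) (S g)` of a cut-off Green's function. -/
def cutRes (κ : ℝ) (S : ℝ → ℝ) (r x : Space) : ℂ :=
  (deriv (deriv S) ‖x - r‖ - 2 * (Complex.I * κ) * deriv S ‖x - r‖) * outProf κ ‖x - r‖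

section Ray

variable {r θ : Space} {t : ℝ}

lemma norm_ray_sub_sq (hθ : ‖θ‖ = 1) (r : Space) (t : ℝ) :
    ‖t • θ - r‖ ^ 2 = (t - inner ℝ r θ) ^ 2 + (‖r‖ ^ 2 - inner ℝ r θ ^ 2) := by
  rw [norm_sub_sq_real, norm_smul, hθ, inner_smul_left, real_inner_comm]
  simp; ring

lemma abs_inner_ray_le (hθ : ‖θ‖ = 1) (r : Space) : |inner ℝ r θ| ≤ ‖r‖ := by
  simpa [hθ] using abs_real_inner_le_norm r θ

lemma norm_ray_sub_ge (hθ : ‖θ‖ = 1) (r : Space) (ht : 0 ≤ t) : t - ‖r‖ ≤ ‖t • θ - r‖ := by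
  have := norm_sub_norm_le (t • θ) r
  rwa [norm_smul, hθ, mul_one, Real.norm_of_nonneg ht] at this

lemma norm_ray_sub_le (hθ : ‖θ‖ = 1) (r : Space) (ht : 0 ≤ t) : ‖t • θ - r‖ ≤ t + ‖r‖ := by
  have := norm_sub_le (t • θ) r
  rwa [norm_smul, hθ, mul_one, Real.norm_of_nonneg ht] at this

lemma hasDerivAt_norm_ray_sub (hθ : ‖θ‖ = 1) (h : t • θ ≠ r) :
    HasDerivAt (fun t : ℝ => ‖t • θ - r‖) ((t - inner ℝ r θ) / ‖t • θ - r‖) t := by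
  have h1 : HasDerivAt (fun t : ℝ => t • θ) θ t := by
    simpa using (hasDerivAt_id t).smul_const θ
  refine HasDerivAt.congr_deriv
    (HasFDerivAt.comp_hasDerivAt (f := fun t : ℝ => t • θ) t (hasFDerivAt_norm_sub h) h1) ?_
  simp [hθ]
  rw [div_eq_inv_mul]

/-- Along a ray the distance to a fixed point has derivative `1 + O(t⁻²)`. -/
lemma one_sub_deriv_norm_ray (hθ : ‖θ‖ = 1) (h1 : 1 ≤ t) (h2 : 2 * ‖r‖ ≤ t) :
    |(t - inner ℝ r θ) / ‖t • θ - r‖| ≤ 1 ∧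
      |(t - inner ℝ r θ) / ‖t • θ - r‖ - 1| ≤ 4 * ‖r‖ ^ 2 / t ^ 2 := by
  have hp := abs_le.1 (abs_inner_ray_le hθ r)
  have hsq := norm_ray_sub_sq hθ r t
  have hge := norm_ray_sub_ge hθ r (zero_le_one.trans h1)
  set p := inner ℝ r θ
  set ρ := ‖t • θ - r‖
  have hb := norm_nonneg r
  have hρ : 0 < ρ := by linarith
  have htp : 0 < t - p := by linarith
  have hd : 0 ≤ ‖r‖ ^ 2 - p ^ 2 := by nlinarith
  have hle : t - p ≤ ρ := by nlinarith
  refine ⟨by rw [abs_of_pos (by positivity)]; exact (div_le_one hρ).2 hle, ?_⟩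
  rw [abs_sub_comm, abs_of_nonneg (sub_nonneg.2 ((div_le_one hρ).2 hle))]
  have e : 1 - (t - p) / ρ = (‖r‖ ^ 2 - p ^ 2) / (ρ * (ρ + (t - p))) := by
    field_simp
    nlinarith
  rw [e, div_le_div_iff₀ (by positivity) (by positivity)]
  have a1 : t / 2 ≤ ρ := by linarith
  have a2 : t / 2 ≤ t - p := by linarith
  have a3 : t / 2 * (t / 2 + t / 2) ≤ ρ * (ρ + (t - p)) := by gcongr
  have a4 : ‖r‖ ^ 2 - p ^ 2 ≤ ‖r‖ ^ 2 := by nlinarith [sq_nonneg p]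
  calc (‖r‖ ^ 2 - p ^ 2) * t ^ 2 ≤ ‖r‖ ^ 2 * t ^ 2 := by gcongr
    _ ≤ 4 * ‖r‖ ^ 2 * (t / 2 * (t / 2 + t / 2)) := by
      nlinarith [mul_nonneg (sq_nonneg ‖r‖) (sq_nonneg t)]
    _ ≤ _ := by gcongr

lemma norm_cexp' (a : ℝ) : ‖Complex.exp (Complex.I * a)‖ = 1 := by
  rw [Complex.norm_exp]; simp

/-- Against the outgoing phase `exp(-ikt)` along a ray from the origin, the residual of the
Green's function cut off at infinity integrates to `O(1 / R)`: after integration by parts the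
leading term is a multiple of `∫ χ'(s) exp(-2iks) ds = 0`. -/
lemma exists_ray_bound {k : ℝ} (hk : 0 < k) (r : Space) : ∃ C, 0 ≤ C ∧
    ∀ (R : ℝ) (θ : Space), ‖θ‖ = 1 → 1 ≤ R - ‖r‖ → 2 * ‖r‖ ≤ R - ‖r‖ →
      ‖∫ t in (R - ‖r‖)..(R + outerWidth k + ‖r‖), Complex.exp (-Complex.I * k * t) *
        (((t ^ 2 : ℝ) : ℂ) * cutRes k (outerCut k R) r (t • θ))‖ ≤ C / (R - ‖r‖) := by
  obtain ⟨C₀, hC₀, hχ⟩ := exists_bound_deriv_outerCut hk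
  set b := ‖r‖ with hb
  have hb0 : 0 ≤ b := norm_nonneg r
  set L := outerWidth k with hL
  have hL0 : 0 ≤ L := by rw [hL, outerWidth]; positivity
  set Cε := 4 * k * b ^ 2 * (L + 2 * b) + 8 * b ^ 2 + 8 * k * b ^ 2 with hCε
  have hCε0 : 0 ≤ Cε := by positivity
  refine ⟨(L + 2 * b) * C₀ * Cε, by positivity, fun R θ hθ h1 h2 => ?_⟩
  set R₁ := R - b with hR₁
  set R₂ := R + L + b with hR₂
  have hR12 : R₁ ≤ R₂ := by linarith
  set p : ℝ := inner ℝ r θ with hp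
  have hpb := abs_le.1 (abs_inner_ray_le hθ r)
  rw [← hp, ← hb] at hpb
  set ρ : ℝ → ℝ := fun t => ‖t • θ - r‖ with hρ
  set c : ℝ → ℝ := fun t => (t - p) / ρ t with hc
  have hρpos : ∀ t, R₁ ≤ t → 0 < ρ t := fun t ht => by
    have := norm_ray_sub_ge (t := t) hθ r (by linarith)
    simp only [hρ]; linarith
  have htp : ∀ t, R₁ ≤ t → t / 2 ≤ t - p := fun t ht => by linarith
  have hρd : ∀ t, R₁ ≤ t → HasDerivAt ρ (c t) t := fun t ht =>
    hasDerivAt_norm_ray_sub hθ (fun hh => by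
      have := hρpos t ht; simp [hρ, hh] at this)
  have hc1 : ∀ t, R₁ ≤ t → |c t| ≤ 1 ∧ |c t - 1| ≤ 4 * b ^ 2 / t ^ 2 := fun t ht =>
    one_sub_deriv_norm_ray hθ (h1.trans ht) (h2.trans ht)
  -- the product of the two phases is `exp(-2ikρ)` times the slowly varying factor `u`, and the
  -- amplitude `t² / ρ` is `v` times the derivative `c` of `ρ`
  set u : ℝ → ℂ := fun t => Complex.exp (Complex.I * ((k * (ρ t - t) : ℝ) : ℂ)) with hu
  have hun : ∀ t, ‖u t‖ = 1 := fun t => norm_cexp' _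
  have hud : ∀ t, R₁ ≤ t → HasDerivAt u (Complex.I * ((k * (c t - 1) : ℝ) : ℂ) * u t) t := by
    intro t ht
    have a1 : HasDerivAt (fun t => k * (ρ t - t)) (k * (c t - 1)) t :=
      ((hρd t ht).sub (hasDerivAt_id t)).const_mul k
    refine (a1.ofReal_comp.const_mul Complex.I).cexp.congr_deriv ?_
    ring
  set v : ℝ → ℝ := fun t => t ^ 2 / (t - p) with hv
  have hvd : ∀ t, R₁ ≤ t → HasDerivAt v (1 - p ^ 2 / (t - p) ^ 2) t := by
    intro t ht
    have h0 : t - p ≠ 0 := by have := htp t ht; intro hh; linarith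
    refine ((hasDerivAt_pow 2 t).div ((hasDerivAt_id t).sub_const p) h0).congr_deriv ?_
    simp only [id]
    field_simp
    push_cast
    ring
  set G : ℝ → ℂ := fun s => ((deriv (outerCut k R) s : ℝ) : ℂ) *
    Complex.exp (-Complex.I * (2 * k : ℝ) * s) with hG
  set G' : ℝ → ℂ := fun s => (((deriv (deriv (outerCut k R)) s : ℝ) : ℂ) -
    2 * (Complex.I * k) * ((deriv (outerCut k R) s : ℝ) : ℂ)) *
    Complex.exp (-Complex.I * (2 * k : ℝ) * s) with hG'
  have hS := contDiff_outerCut k R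
  have hS1 := contDiff_deriv_of_smooth hS
  have hS2 := contDiff_deriv_of_smooth hS1
  have hGd : ∀ s, HasDerivAt G (G' s) s := by
    intro s
    refine ((hasDerivAt_of_smooth hS s).2.ofReal_comp.mul
      (hasDerivAt_cexp (2 * k) s)).congr_deriv ?_
    simp only [hG']
    push_cast; ring
  have hGc : Continuous G := (Complex.continuous_ofReal.comp hS1.continuous).mul (by fun_prop)
  have hG'c : Continuous G' := by
    have := Complex.continuous_ofReal.comp hS1.continuous
    have := Complex.continuous_ofReal.comp hS2.continuous
    simp only [Function.comp_def] at *
    fun_prop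
  have hGn : ∀ s, ‖G s‖ ≤ C₀ := fun s => by
    simp only [hG, norm_mul, norm_cexp, mul_one, Complex.norm_real]
    exact (hχ R s).1
  have hG0 : ∀ s, s ≤ R ∨ R + L ≤ s → G s = 0 := by
    rintro s (hs | hs)
    · simp [hG, deriv_outerCut_of_le hk s hs]
    · simp [hG, deriv_outerCut_of_ge hk s hs]
  have hρc : Continuous ρ := by fun_prop
  have hcc : ContinuousOn c (Set.uIcc R₁ R₂) := by
    refine ContinuousOn.div (by fun_prop) hρc.continuousOn fun t ht => ?_
    rw [Set.uIcc_of_le hR12] at ht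
    exact (hρpos t ht.1).ne'
  have hmem : ∀ t ∈ Set.uIcc R₁ R₂, R₁ ≤ t := fun t ht => by
    rw [Set.uIcc_of_le hR12] at ht; exact ht.1
  have hccC : ContinuousOn (fun t => (c t : ℂ)) (Set.uIcc R₁ R₂) :=
    Complex.continuous_ofReal.comp_continuousOn hcc
  set m' : ℝ → ℂ := fun t => Complex.I * ((k * (c t - 1) : ℝ) : ℂ) * u t * ((v t : ℝ) : ℂ) +
    u t * ((1 - p ^ 2 / (t - p) ^ 2 : ℝ) : ℂ) with hm'
  have hmd : ∀ t ∈ Set.uIcc R₁ R₂, HasDerivAt (fun t => u t * ((v t : ℝ) : ℂ)) (m' t) t :=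
    fun t ht => (hud t (hmem t ht)).mul (hvd t (hmem t ht)).ofReal_comp
  have hGρd : ∀ t ∈ Set.uIcc R₁ R₂, HasDerivAt (fun t => G (ρ t)) (c t • G' (ρ t)) t :=
    fun t ht => (hGd (ρ t)).scomp t (hρd t (hmem t ht))
  have huc : Continuous u := by fun_prop
  have hvc : ContinuousOn (fun t => ((v t : ℝ) : ℂ)) (Set.uIcc R₁ R₂) :=
    Complex.continuous_ofReal.comp_continuousOn
      (ContinuousOn.div (by fun_prop) (by fun_prop) fun t ht => by
        have := htp t (hmem t ht); have := hmem t ht; intro hh; linarith)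
  have hqc : ContinuousOn (fun t => ((1 - p ^ 2 / (t - p) ^ 2 : ℝ) : ℂ)) (Set.uIcc R₁ R₂) :=
    Complex.continuous_ofReal.comp_continuousOn
      (continuousOn_const.sub (ContinuousOn.div (by fun_prop) (by fun_prop) fun t ht => by
        have := htp t (hmem t ht); have := hmem t ht
        refine pow_ne_zero 2 fun hh => ?_
        linarith))
  have hm'c : ContinuousOn m' (Set.uIcc R₁ R₂) :=
    (((continuousOn_const.mul (Complex.continuous_ofReal.comp_continuousOn
      (continuousOn_const.mul (hcc.sub continuousOn_const)))).mul huc.continuousOn).mul hvc).add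
      (huc.continuousOn.mul hqc)
  have hGρc : Continuous fun t => G (ρ t) := hGc.comp hρc
  have hcG' : ContinuousOn (fun t => c t • G' (ρ t)) (Set.uIcc R₁ R₂) :=
    hcc.smul (hG'c.comp hρc).continuousOn
  have hker : ∀ t ∈ Set.uIcc R₁ R₂, Complex.exp (-Complex.I * k * t) *
      (((t ^ 2 : ℝ) : ℂ) * cutRes k (outerCut k R) r (t • θ)) =
      (1 / (4 * Real.pi) : ℂ) * ((u t * ((v t : ℝ) : ℂ)) * (c t • G' (ρ t))) := by
    intro t ht
    have n1 : ((ρ t : ℝ) : ℂ) ≠ 0 := by exact_mod_cast (hρpos t (hmem t ht)).ne'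
    have n2 : (t - p : ℂ) ≠ 0 := by
      have := htp t (hmem t ht); have := hmem t ht
      have : t - p ≠ 0 := by intro hh; linarith
      exact_mod_cast this
    have hpi : (Real.pi : ℂ) ≠ 0 := by exact_mod_cast Real.pi_ne_zero
    have hexp : u t * Complex.exp (-Complex.I * (2 * k : ℝ) * ρ t) =
        Complex.exp (-Complex.I * k * t) * Complex.exp (-Complex.I * k * ρ t) := by
      simp only [hu]
      rw [← Complex.exp_add, ← Complex.exp_add]
      congr 1; push_cast; ring
    have hr : (u t * ((v t : ℝ) : ℂ)) * (c t • G' (ρ t)) =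
        (u t * Complex.exp (-Complex.I * (2 * k : ℝ) * ρ t)) * (v t * c t : ℝ) *
          (((deriv (deriv (outerCut k R)) (ρ t) : ℝ) : ℂ) -
            2 * (Complex.I * k) * ((deriv (outerCut k R) (ρ t) : ℝ) : ℂ)) := by
      simp only [hG', Complex.real_smul]; push_cast; ring
    rw [hr, hexp]
    simp only [hv, hc, cutRes, outProf]
    change _ * (_ * (_ * (_ / (4 * Real.pi * ((ρ t : ℝ) : ℂ))))) = _
    push_cast
    field_simp
    ring
  rw [intervalIntegral.integral_congr hker, intervalIntegral.integral_const_mul,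
    intervalIntegral.integral_mul_deriv_eq_deriv_mul hmd hGρd hm'c.intervalIntegrable
      hcG'.intervalIntegrable]
  have z1 : G (ρ R₁) = 0 := hG0 _ (Or.inl (by
    have := norm_ray_sub_le (t := R₁) hθ r (by linarith)
    simp only [hρ]; linarith))
  have z2 : G (ρ R₂) = 0 := hG0 _ (Or.inr (by
    have := norm_ray_sub_ge (t := R₂) hθ r (by linarith)
    simp only [hρ]; linarith))
  rw [z1, z2, mul_zero, mul_zero, sub_zero, zero_sub]
  -- the leading term of the amplitude contributes nothing
  have hzero : ∫ t in R₁..R₂, u R₁ * (c t • G (ρ t)) = 0 := by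
    rw [intervalIntegral.integral_const_mul]
    have e1 := intervalIntegral.integral_deriv_smul_comp' (f := ρ) (f' := c) (g := G)
      (fun t ht => hρd t (hmem t ht)) hcc hGc.continuousOn
    simp only [Function.comp_def] at e1
    rw [e1, intervalIntegral.integral_eq_integral_of_support_subset,
      integral_deriv_outerCut_mul_cexp hk, mul_zero]
    intro s hs
    have q1 := norm_ray_sub_le (t := R₁) hθ r (by linarith)
    have q2 := norm_ray_sub_ge (t := R₂) hθ r (by linarith)
    by_contra hh
    refine hs (hG0 s ?_)
    by_contra hcon
    push Not at hcon
    refine hh ⟨?_, ?_⟩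
    · simp only [hρ]; linarith
    · simp only [hρ]; linarith
  have hint1 : IntervalIntegrable (fun t => m' t * G (ρ t)) volume R₁ R₂ :=
    (hm'c.mul hGρc.continuousOn).intervalIntegrable
  have hint2 : IntervalIntegrable (fun t => u R₁ * (c t • G (ρ t))) volume R₁ R₂ :=
    (continuousOn_const.mul (hcc.smul hGρc.continuousOn)).intervalIntegrable
  have hdiff : ∫ t in R₁..R₂, m' t * G (ρ t) =
      ∫ t in R₁..R₂, (m' t - u R₁ * c t) * G (ρ t) := by
    rw [← sub_zero (∫ t in R₁..R₂, m' t * G (ρ t)), ← hzero,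
      ← intervalIntegral.integral_sub hint1 hint2]
    refine intervalIntegral.integral_congr fun t _ => ?_
    simp only [Complex.real_smul]; ring
  rw [hdiff]
  have hR₁pos : 0 < R₁ := by linarith
  have hu0 : ∀ t ∈ Set.Icc R₁ R₂, ‖u t - u R₁‖ ≤ k * (4 * b ^ 2 / R₁ ^ 2) * (L + 2 * b) := by
    intro t ht
    have := Convex.norm_image_sub_le_of_norm_hasDerivWithin_le (f := u)
      (f' := fun t => Complex.I * ((k * (c t - 1) : ℝ) : ℂ) * u t) (s := Set.Icc R₁ R₂)
      (C := k * (4 * b ^ 2 / R₁ ^ 2)) (x := R₁) (y := t)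
      (fun s hs => (hud s hs.1).hasDerivWithinAt) (fun s hs => by
        rw [norm_mul, norm_mul, hun, Complex.norm_I, Complex.norm_real, one_mul, mul_one,
          Real.norm_eq_abs, abs_mul, abs_of_pos hk]
        gcongr
        refine (hc1 s hs.1).2.trans ?_
        gcongr
        exact hs.1)
      (convex_Icc _ _) ⟨le_rfl, hR12⟩ ht
    refine this.trans ?_
    gcongr
    rw [Real.norm_eq_abs, abs_of_nonneg (by linarith [ht.1])]
    linarith [ht.2]
  have herr : ∀ t ∈ Set.Icc R₁ R₂, ‖m' t - u R₁ * c t‖ ≤ Cε / R₁ := by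
    intro t ht
    have ht0 : 0 < t := hR₁pos.trans_le ht.1
    have e : m' t - u R₁ * c t = (u t - u R₁) * c t + u t * ((1 - c t : ℝ) : ℂ) +
        Complex.I * ((k * (c t - 1) : ℝ) : ℂ) * u t * ((v t : ℝ) : ℂ) -
        u t * ((p ^ 2 / (t - p) ^ 2 : ℝ) : ℂ) := by
      simp only [hm']; push_cast; ring
    have hcb := hc1 t ht.1
    have t1 : ‖(u t - u R₁) * c t‖ ≤ k * (4 * b ^ 2 / R₁) * (L + 2 * b) := by
      rw [norm_mul, Complex.norm_real]
      refine (mul_le_of_le_one_right (norm_nonneg _) hcb.1).trans ((hu0 t ht).trans ?_)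
      gcongr
      exact le_self_pow₀ h1 two_ne_zero
    have t2' : 4 * b ^ 2 / t ^ 2 ≤ 4 * b ^ 2 / R₁ := by
      gcongr
      exact ht.1.trans (le_self_pow₀ (h1.trans ht.1) two_ne_zero)
    have t2 : ‖u t * ((1 - c t : ℝ) : ℂ)‖ ≤ 4 * b ^ 2 / R₁ := by
      rw [norm_mul, hun, one_mul, Complex.norm_real, Real.norm_eq_abs, abs_sub_comm]
      exact hcb.2.trans t2'
    have htp' := htp t ht.1
    have t3 : ‖Complex.I * ((k * (c t - 1) : ℝ) : ℂ) * u t * ((v t : ℝ) : ℂ)‖ ≤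
        k * (8 * b ^ 2 / R₁) := by
      rw [norm_mul, norm_mul, norm_mul, hun, Complex.norm_I, Complex.norm_real, Complex.norm_real,
        one_mul, mul_one, Real.norm_eq_abs, Real.norm_eq_abs, abs_mul, abs_of_pos hk, mul_assoc]
      gcongr
      have vb : |v t| ≤ 2 * t := by
        simp only [hv]
        rw [abs_of_nonneg (div_nonneg (sq_nonneg t) (by linarith)), div_le_iff₀ (by linarith)]
        nlinarith
      calc |c t - 1| * |v t| ≤ 4 * b ^ 2 / t ^ 2 * (2 * t) := by gcongr; exact hcb.2
        _ = 8 * b ^ 2 / t := by field_simp; ring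
        _ ≤ 8 * b ^ 2 / R₁ := by gcongr; exact ht.1
    have t4 : ‖u t * ((p ^ 2 / (t - p) ^ 2 : ℝ) : ℂ)‖ ≤ 4 * b ^ 2 / R₁ := by
      rw [norm_mul, hun, one_mul, Complex.norm_real, Real.norm_eq_abs,
        abs_of_nonneg (by positivity)]
      have hpp : p ^ 2 ≤ b ^ 2 := by nlinarith
      calc p ^ 2 / (t - p) ^ 2 ≤ b ^ 2 / (t / 2) ^ 2 := by gcongr
        _ = 4 * b ^ 2 / t ^ 2 := by field_simp; ring
        _ ≤ _ := t2'
    rw [e]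
    refine (norm_sub_le _ _).trans ((add_le_add (norm_add_le _ _) le_rfl).trans
      ((add_le_add (add_le_add (norm_add_le _ _) le_rfl) le_rfl).trans ?_))
    refine (add_le_add (add_le_add (add_le_add t1 t2) t3) t4).trans_eq ?_
    rw [hCε]; ring
  have hfin := intervalIntegral.norm_integral_le_of_norm_le_const (a := R₁) (b := R₂)
    (f := fun t => (m' t - u R₁ * c t) * G (ρ t)) (C := Cε / R₁ * C₀) (fun t ht => by
      rw [Set.uIoc_of_le hR12] at ht
      rw [norm_mul]
      exact mul_le_mul (herr t ⟨ht.1.le, ht.2⟩) (hGn _) (norm_nonneg _) (by positivity))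
  rw [norm_mul, norm_neg]
  have h4 : ‖(1 / (4 * Real.pi) : ℂ)‖ ≤ 1 := by
    rw [norm_div, norm_mul, Complex.norm_real, Real.norm_of_nonneg Real.pi_pos.le]
    simp only [norm_one, Complex.norm_ofNat]
    rw [div_le_one (by positivity)]
    linarith [Real.pi_gt_three]
  refine (mul_le_of_le_one_left (norm_nonneg _) h4).trans (hfin.trans_eq ?_)
  rw [abs_of_nonneg (by linarith), show R₂ - R₁ = L + 2 * b by rw [hR₂, hR₁]; ring]
  ring

end Ray

lemma contDiff_cutRes (κ : ℝ) {S : ℝ → ℝ} (hS : ContDiff ℝ (⊤ : ℕ∞) S) {t₀ : ℝ} (ht₀ : 0 < t₀)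
    (h1 : ∀ t < t₀, deriv S t = 0) (h2 : ∀ t < t₀, deriv (deriv S) t = 0) (r : Space) :
    ContDiff ℝ (⊤ : ℕ∞) (cutRes κ S r) := by
  have c1 := contDiff_deriv_of_smooth hS
  have c2 := contDiff_deriv_of_smooth c1
  refine contDiff_radial (q := fun t => (deriv (deriv S) t - 2 * (Complex.I * κ) * deriv S t) *
    outProf κ t) ht₀ (fun t ht => by simp [h1 t ht, h2 t ht]) fun t ht => ?_
  exact ((Complex.ofRealCLM.contDiff.comp c2).contDiffAt.sub
    (contDiffAt_const.mul (Complex.ofRealCLM.contDiff.comp c1).contDiffAt)).mul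
    (contDiffAt_outProf κ ht)

lemma hasCompactSupport_cutRes (κ : ℝ) {S : ℝ → ℝ} {t₁ : ℝ}
    (h1 : ∀ t, t₁ < t → deriv S t = 0) (h2 : ∀ t, t₁ < t → deriv (deriv S) t = 0) (r : Space) :
    HasCompactSupport (cutRes κ S r) :=
  hasCompactSupport_radial (q := fun t => (deriv (deriv S) t - 2 * (Complex.I * κ) * deriv S t) *
    outProf κ t) (t₁ := t₁) fun t ht => by simp [h1 t ht, h2 t ht]

lemma contDiff_cutRes_outerCut {k R : ℝ} (hk : 0 < k) (hR : 0 < R) (r : Space) :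
    ContDiff ℝ (⊤ : ℕ∞) (cutRes k (outerCut k R) r) :=
  contDiff_cutRes k (contDiff_outerCut k R) hR (fun t ht => deriv_outerCut_of_le hk t ht.le)
    (fun t ht => deriv_deriv_outerCut_of_le hk t ht.le) r

lemma hasCompactSupport_cutRes_outerCut {k R : ℝ} (hk : 0 < k) (r : Space) :
    HasCompactSupport (cutRes k (outerCut k R) r) :=
  hasCompactSupport_cutRes k (fun t ht => deriv_outerCut_of_ge hk t ht.le)
    (fun t ht => deriv_deriv_outerCut_of_ge hk t ht.le) r

/-- Along a ray, `exp(ikt) e(tθ)` has derivative `exp(ikt) (∂e/∂|x| + ik e)`. -/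
lemma hasDerivAt_demodulated (k : ℝ) {e : Space → ℂ} {θ : Space} {t : ℝ}
    (he : DifferentiableAt ℝ e (t • θ)) :
    HasDerivAt (fun t : ℝ => Complex.exp (Complex.I * ((k * t : ℝ) : ℂ)) * e (t • θ))
      (Complex.exp (Complex.I * ((k * t : ℝ) : ℂ)) *
        (fderiv ℝ e (t • θ) θ + Complex.I * k * e (t • θ))) t := by
  have h1 : HasDerivAt (fun t : ℝ => t • θ) θ t := by
    simpa using (hasDerivAt_id t).smul_const θ
  have h2 : HasDerivAt (fun t : ℝ => e (t • θ)) (fderiv ℝ e (t • θ) θ) t :=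
    he.hasFDerivAt.comp_hasDerivAt t h1
  have h3 : HasDerivAt (fun t : ℝ => k * t) k t := by
    simpa using (hasDerivAt_id t).const_mul k
  refine ((h3.ofReal_comp.const_mul Complex.I).cexp.mul h2).congr_deriv ?_
  ring

/-- A radiating function is asymptotically orthogonal to the residual at infinity of a cut-off
outgoing Green's function. Along each ray `exp(ikt) e(tθ)` is `o(t)` and varies by `o(1 / R)`
over the transition region, and against a constant amplitude the residual integrates to
`O(1 / R)`. -/
theorem tendsto_integral_cutRes_outerCut {k : ℝ} (hk : 0 < k) (r : Space) {e : Space → ℂ}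
    (he : LocallyIntegrable e)
    (hd : ∀ᶠ x in Bornology.cobounded Space, DifferentiableAt ℝ e x)
    (hrad : Tendsto (fun x : Space =>
        ‖x‖ • (fderiv ℝ e x (‖x‖⁻¹ • x) + (Complex.I * k) * e x))
      (Bornology.cobounded Space) (𝓝 0)) :
    Tendsto (fun R => ∫ x, e x * cutRes k (outerCut k R) r x) atTop (𝓝 0) := by
  obtain ⟨C, hC, hray⟩ := exists_ray_bound hk r
  obtain ⟨C₀, hC₀, hχ⟩ := exists_bound_deriv_outerCut hk
  set b := ‖r‖ with hb
  have hb0 : 0 ≤ b := norm_nonneg r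
  set L := outerWidth k with hL
  have hL0 : 0 ≤ L := by rw [hL, outerWidth]; positivity
  set A : ℝ := (volume : Measure Space).toSphere.real Set.univ with hA
  have hA0 : 0 ≤ A := measureReal_nonneg
  set D := L + 2 * b with hD
  have hD0 : 0 ≤ D := by positivity
  set K : ℝ := C + D ^ 2 * (4 * C₀ * (1 + 2 * k)) with hK
  have hK0 : 0 ≤ K := by positivity
  rw [Metric.tendsto_atTop]
  intro ε hε
  set δ := ε / (2 * (K * A + 1)) with hδ
  have hδ0 : 0 < δ := by positivity
  have hev := hd.and (hrad.eventually (Metric.ball_mem_nhds 0 hδ0))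
  obtain ⟨R₀', hR₀'⟩ :=
    (Metric.hasBasis_cobounded_compl_closedBall (0 : Space)).eventually_iff.1 hev
  set R₀ := max (R₀' + 1) 1 with hR₀
  have hR₀1 : 1 ≤ R₀ := le_max_right _ _
  have hout : ∀ x : Space, R₀ ≤ ‖x‖ → DifferentiableAt ℝ e x ∧
      ‖fderiv ℝ e x (‖x‖⁻¹ • x) + (Complex.I * k) * e x‖ ≤ δ / ‖x‖ := by
    intro x hx
    have hx' : x ∈ (Metric.closedBall (0 : Space) R₀')ᶜ := by
      have : R₀' + 1 ≤ R₀ := le_max_left _ _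
      simp; linarith
    have h1 := hR₀'.2 hx'
    refine ⟨h1.1, ?_⟩
    have h2 := h1.2
    rw [dist_zero_right, norm_smul, norm_norm] at h2
    rw [le_div_iff₀ (by linarith), mul_comm]
    exact h2.le
  obtain ⟨M, hM⟩ := (isCompact_sphere (0 : Space) R₀).exists_bound_of_continuousOn
    (f := e) fun x hx => ((hout x (by simp at hx; exact hx.ge)).1.continuousAt).continuousWithinAt
  set M' := max M 0
  set N := max (max R₀ (2 * b)) D + b with hN
  obtain ⟨N', hN'⟩ : ∃ N', ∀ R, N' ≤ R → M' * C * A / (R - b) < ε / 2 := by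
    have : Tendsto (fun R : ℝ => M' * C * A / (R - b)) atTop (𝓝 0) :=
      Tendsto.div_atTop tendsto_const_nhds (tendsto_atTop_add_const_right _ _ tendsto_id)
    exact eventually_atTop.1 (this.eventually_lt_const (half_pos hε))
  refine ⟨max N N', fun R hR => ?_⟩
  have hRN : N ≤ R := (le_max_left _ _).trans hR
  set R₁ := R - b with hR₁
  have hR₁0 : R₀ ≤ R₁ := by
    have : R₀ ≤ max (max R₀ (2 * b)) D := (le_max_left _ _).trans (le_max_left _ _)
    linarith
  have hR₁b : 2 * b ≤ R₁ := by
    have : 2 * b ≤ max (max R₀ (2 * b)) D := (le_max_right _ _).trans (le_max_left _ _)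
    linarith
  have hR₁D : D ≤ R₁ := by
    have : D ≤ max (max R₀ (2 * b)) D := le_max_right _ _
    linarith
  have hR₁1 : 1 ≤ R₁ := hR₀1.trans hR₁0
  have hR₁p : 0 < R₁ := by linarith
  have hRp : 0 < R := by linarith
  set R₂ := R + L + b with hR₂
  have hR12 : R₁ ≤ R₂ := by linarith
  have hcs := hasCompactSupport_cutRes_outerCut (R := R) hk r
  have hcont := (contDiff_cutRes_outerCut hk hRp r).continuous
  have hint : Integrable (fun x => e x * cutRes k (outerCut k R) r x) := by
    have := he.integrable_smul_left_of_hasCompactSupport hcont hcs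
    simpa [mul_comm] using this
  rw [dist_zero_right]
  refine (norm_integral_le_of_ray hint (B := M' * C / R₁ + δ * K) fun θ hθ => ?_).trans_lt ?_
  swap
  · have h1 := hN' R ((le_max_right _ _).trans hR)
    have h2 : δ * K * A < ε / 2 := by
      rw [hδ, div_mul_eq_mul_div, div_mul_eq_mul_div, div_lt_div_iff₀ (by positivity) two_pos]
      nlinarith [mul_nonneg hK0 hA0]
    calc _ = M' * C * A / R₁ + δ * K * A := by rw [← hA]; ring
      _ < ε := by linarith
  have hnorm : ∀ t : ℝ, R₀ ≤ t → ‖t • θ‖ = t := fun t ht => by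
    rw [norm_smul, hθ, mul_one, Real.norm_of_nonneg (by linarith)]
  set a : ℝ → ℂ := fun t => Complex.exp (Complex.I * ((k * t : ℝ) : ℂ)) * e (t • θ) with ha
  set κ : ℝ → ℂ := fun t => Complex.exp (-Complex.I * k * t) *
    (((t ^ 2 : ℝ) : ℂ) * cutRes k (outerCut k R) r (t • θ)) with hκ
  set a' : ℝ → ℂ := fun t => Complex.exp (Complex.I * ((k * t : ℝ) : ℂ)) *
        (fderiv ℝ e (t • θ) θ + Complex.I * k * e (t • θ)) with ha'
  have had : ∀ t, R₀ ≤ t → HasDerivAt a (a' t) t := fun t ht =>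
    hasDerivAt_demodulated k (hout (t • θ) (by rw [hnorm t ht]; exact ht)).1
  have hadn : ∀ t, R₀ ≤ t → ‖a' t‖ ≤ δ / t := fun t ht => by
    have h1 := (hout (t • θ) (by rw [hnorm t ht]; exact ht)).2
    rw [hnorm t ht, smul_smul, inv_mul_cancel₀ (by linarith), one_smul] at h1
    simp only [ha']
    rw [norm_mul, norm_cexp', one_mul]
    exact h1
  have hvar : ∀ s t, R₀ ≤ s → s ≤ t → ‖a t - a s‖ ≤ δ / s * (t - s) := by
    intro s t hs hst
    have := Convex.norm_image_sub_le_of_norm_hasDerivWithin_le (f := a) (f' := a')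
      (s := Set.Icc s t) (C := δ / s) (x := s) (y := t)
      (fun u hu => (had u (hs.trans hu.1)).hasDerivWithinAt)
      (fun u hu => (hadn u (hs.trans hu.1)).trans (by gcongr; exacts [by linarith, hu.1]))
      (convex_Icc _ _) ⟨le_rfl, hst⟩ ⟨hst, le_rfl⟩
    rwa [Real.norm_of_nonneg (by linarith)] at this
  have haR₁ : ‖a R₁‖ ≤ M' + δ * R₁ := by
    have h1 := hvar R₀ R₁ le_rfl hR₁0
    have h2 : ‖a R₀‖ ≤ M' := by
      simp only [ha]
      rw [norm_mul, norm_cexp', one_mul]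
      exact (hM _ (by simpa using hnorm R₀ le_rfl)).trans (le_max_left _ _)
    have h3 : δ / R₀ * (R₁ - R₀) ≤ δ * R₁ := by
      refine mul_le_mul (div_le_self hδ0.le hR₀1) (by linarith) (by linarith) hδ0.le
    calc ‖a R₁‖ = ‖a R₀ + (a R₁ - a R₀)‖ := by ring_nf
      _ ≤ _ := (norm_add_le _ _).trans (add_le_add h2 (h1.trans h3))
  -- the ray integral only sees the transition region
  have hsub : ∫ t in Set.Ioi (0 : ℝ), ((t ^ 2 : ℝ) : ℂ) *
      (e (t • θ) * cutRes k (outerCut k R) r (t • θ)) = ∫ t in R₁..R₂, a t * κ t := by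
    rw [intervalIntegral.integral_of_le hR12]
    have e1 : ∀ t : ℝ, a t * κ t = ((t ^ 2 : ℝ) : ℂ) *
        (e (t • θ) * cutRes k (outerCut k R) r (t • θ)) := by
      intro t
      have : Complex.exp (Complex.I * ((k * t : ℝ) : ℂ)) *
          Complex.exp (-Complex.I * k * t) = 1 := by
        rw [← Complex.exp_add, ← Complex.exp_zero]; congr 1; push_cast; ring
      simp only [ha, hκ]
      linear_combination (((t ^ 2 : ℝ) : ℂ) *
        (e (t • θ) * cutRes k (outerCut k R) r (t • θ))) * this
    simp only [e1]
    refine setIntegral_eq_of_subset_of_forall_sdiff_eq_zero measurableSet_Ioi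
      (fun t ht => hR₁p.trans ht.1) fun t ht => ?_
    have ht0 : 0 < t := ht.1
    have : cutRes k (outerCut k R) r (t • θ) = 0 := by
      have u1 := norm_ray_sub_le hθ r ht0.le
      have u2 := norm_ray_sub_ge hθ r ht0.le
      rcases le_or_gt t R₁ with h | h
      · have : ‖t • θ - r‖ ≤ R := by linarith
        simp [cutRes, deriv_outerCut_of_le hk _ this, deriv_deriv_outerCut_of_le hk _ this]
      · have h3 : R₂ < t := by by_contra hh; exact ht.2 ⟨h, by linarith⟩
        have : R + outerWidth k ≤ ‖t • θ - r‖ := by linarith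
        simp [cutRes, deriv_outerCut_of_ge hk _ this, deriv_deriv_outerCut_of_ge hk _ this]
    simp [this]
  rw [hsub]
  have hmem : ∀ t ∈ Set.uIcc R₁ R₂, R₁ ≤ t := fun t ht => by
    rw [Set.uIcc_of_le hR12] at ht; exact ht.1
  have hκc : Continuous κ := by fun_prop
  have hac : ContinuousOn a (Set.uIcc R₁ R₂) := fun t ht =>
    (had t (hR₁0.trans (hmem t ht))).continuousAt.continuousWithinAt
  have hsplit : ∫ t in R₁..R₂, a t * κ t =
      a R₁ * (∫ t in R₁..R₂, κ t) + ∫ t in R₁..R₂, (a t - a R₁) * κ t := by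
    rw [← intervalIntegral.integral_const_mul, ← intervalIntegral.integral_add]
    · exact intervalIntegral.integral_congr fun t _ => by ring
    · exact (hκc.intervalIntegrable _ _).const_mul _
    · exact ((hac.sub continuousOn_const).mul hκc.continuousOn).intervalIntegrable
  have hκn : ∀ t, R₁ ≤ t → t ≤ R₂ → ‖κ t‖ ≤ 4 * C₀ * (1 + 2 * k) * R₁ := by
    intro t h1 h2
    have ht0 : 0 < t := by linarith
    have u2 := norm_ray_sub_ge hθ r ht0.le
    have u3 : t / 2 ≤ ‖t • θ - r‖ := by linarith
    have n1 : ‖((deriv (deriv (outerCut k R)) ‖t • θ - r‖ : ℝ) : ℂ) -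
        2 * (Complex.I * k) * ((deriv (outerCut k R) ‖t • θ - r‖ : ℝ) : ℂ)‖ ≤ C₀ * (1 + 2 * k) := by
      refine (norm_sub_le _ _).trans ?_
      have v1 := (hχ R ‖t • θ - r‖).1
      have v2 := (hχ R ‖t • θ - r‖).2
      rw [norm_mul, norm_mul, norm_mul, Complex.norm_I, Complex.norm_real, Complex.norm_real,
        Complex.norm_real, Complex.norm_ofNat, Real.norm_eq_abs, Real.norm_eq_abs, Real.norm_eq_abs,
        abs_of_pos hk]
      have := mul_le_mul_of_nonneg_left v1 (by positivity : 0 ≤ 2 * k)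
      linarith
    have n2 : ‖outProf k ‖t • θ - r‖‖ ≤ 2 / t := by
      refine (norm_outProf_le k (by linarith)).trans ?_
      rw [div_le_div_iff₀ (by linarith) ht0]; linarith
    simp only [hκ]
    rw [norm_mul, norm_cexp, one_mul, norm_mul, Complex.norm_real,
      Real.norm_of_nonneg (sq_nonneg t), cutRes, norm_mul]
    calc t ^ 2 * (_ * _) ≤ t ^ 2 * ((C₀ * (1 + 2 * k)) * (2 / t)) := by gcongr
      _ = 2 * C₀ * (1 + 2 * k) * t := by field_simp
      _ ≤ 2 * C₀ * (1 + 2 * k) * (2 * R₁) := by gcongr; linarith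
      _ = _ := by ring
  have hfirst : ‖a R₁ * ∫ t in R₁..R₂, κ t‖ ≤ M' * C / R₁ + δ * C := by
    rw [norm_mul]
    have h1 : ‖∫ t in R₁..R₂, κ t‖ ≤ C / R₁ := hray R θ hθ hR₁1 hR₁b
    have hM0 : 0 ≤ M' := le_max_right _ _
    calc _ ≤ (M' + δ * R₁) * (C / R₁) := by gcongr
      _ = _ := by field_simp
  have hsecond : ‖∫ t in R₁..R₂, (a t - a R₁) * κ t‖ ≤ δ * (D ^ 2 * (4 * C₀ * (1 + 2 * k))) := by
    have := intervalIntegral.norm_integral_le_of_norm_le_const (a := R₁) (b := R₂)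
      (f := fun t => (a t - a R₁) * κ t) (C := δ / R₁ * D * (4 * C₀ * (1 + 2 * k) * R₁))
      (fun t ht => by
        rw [Set.uIoc_of_le hR12] at ht
        rw [norm_mul]
        refine mul_le_mul ((hvar R₁ t hR₁0 ht.1.le).trans ?_) (hκn t ht.1.le ht.2) (norm_nonneg _)
          (by positivity)
        gcongr
        linarith [ht.2])
    refine this.trans_eq ?_
    rw [abs_of_nonneg (by linarith), show R₂ - R₁ = D by rw [hR₂, hR₁, hD]; ring]
    field_simp
  rw [hsplit]
  refine (norm_add_le _ _).trans ((add_le_add hfirst hsecond).trans_eq ?_)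
  rw [hK]; ring

/-! ### The residual at the pole -/

lemma measureReal_ball (r : Space) {δ : ℝ} (hδ : 0 ≤ δ) :
    (volume : Measure Space).real (Metric.ball r δ) = 4 * Real.pi / 3 * δ ^ 3 := by
  rw [measureReal_def, EuclideanSpace.volume_ball_fin_three, ENNReal.toReal_mul,
    ENNReal.toReal_pow, ENNReal.toReal_ofReal hδ, ENNReal.toReal_ofReal (by positivity)]
  ring

lemma integral_radial (f : ℝ → ℂ) (r : Space) :
    ∫ x : Space, f ‖x - r‖ = 4 * Real.pi * ∫ t in Set.Ioi (0 : ℝ), ((t ^ 2 : ℝ) : ℂ) * f t := by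
  rw [integral_sub_right_eq_self (fun x : Space => f ‖x‖) r, integral_fun_norm_addHaar,
    measureReal_ball 0 zero_le_one]
  simp
  ring

lemma cutRes_innerCut_of_ge {κ η : ℝ} (hη : 0 < η) {r x : Space} (h : η ≤ ‖x - r‖) :
    cutRes κ (innerCut η) r x = 0 := by
  simp [cutRes, deriv_innerCut_of_ge hη _ h, deriv_deriv_innerCut_of_ge hη _ h]

lemma contDiff_cutRes_innerCut (κ : ℝ) {η : ℝ} (hη : 0 < η) (r : Space) :
    ContDiff ℝ (⊤ : ℕ∞) (cutRes κ (innerCut η) r) :=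
  contDiff_cutRes κ (contDiff_innerCut η) (half_pos hη)
    (fun t ht => deriv_innerCut_of_le hη t ht.le)
    (fun t ht => deriv_deriv_innerCut_of_le hη t ht.le) r

lemma hasCompactSupport_cutRes_innerCut (κ : ℝ) {η : ℝ} (hη : 0 < η) (r : Space) :
    HasCompactSupport (cutRes κ (innerCut η) r) :=
  hasCompactSupport_cutRes κ (fun t ht => deriv_innerCut_of_ge hη t ht.le)
    (fun t ht => deriv_deriv_innerCut_of_ge hη t ht.le) r

/-- The total mass of the residual at the pole. -/
lemma integral_cutRes_innerCut (κ : ℝ) {η : ℝ} (hη : 0 < η) (r : Space) :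
    ∫ x, cutRes κ (innerCut η) r x =
      -(Complex.exp (-Complex.I * κ * η) * (1 + Complex.I * κ * η)) +
        κ ^ 2 * ∫ t in (0 : ℝ)..η, t * innerCut η t * Complex.exp (-Complex.I * κ * t) := by
  set Θ := innerCut η with hΘ
  have hS := contDiff_innerCut η
  have hS1 := contDiff_deriv_of_smooth hS
  have hS2 := contDiff_deriv_of_smooth hS1
  rw [← hΘ] at hS hS1 hS2
  set w : ℝ → ℂ := fun t => Complex.exp (-Complex.I * κ * t) with hw
  have hwd : ∀ t, HasDerivAt w (-(Complex.I * κ) * w t) t := fun t => hasDerivAt_cexp κ t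
  set f : ℝ → ℂ := fun t => (t : ℂ) * ((((deriv (deriv Θ) t : ℝ) : ℂ) -
    2 * (Complex.I * κ) * ((deriv Θ t : ℝ) : ℂ)) * w t) with hf
  set Q : ℝ → ℂ := fun t => t * ((deriv Θ t : ℝ) : ℂ) * w t -
    ((Θ t : ℝ) : ℂ) * w t * (1 + Complex.I * κ * t) with hQ
  set q : ℝ → ℂ := fun t => t * ((Θ t : ℝ) : ℂ) * w t with hq
  have hd0 := Complex.continuous_ofReal.comp hS.continuous
  have hd1 := Complex.continuous_ofReal.comp hS1.continuous
  have hd2 := Complex.continuous_ofReal.comp hS2.continuous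
  simp only [Function.comp_def] at hd0 hd1 hd2
  have hfc : Continuous f := by fun_prop
  have hqc : Continuous q := by fun_prop
  have hI : Complex.I ^ 2 = -1 := Complex.I_sq
  -- the radial integrand `f` is a derivative up to the term `κ² q`
  have hQd : ∀ t, HasDerivAt Q (f t - κ ^ 2 * q t) t := by
    intro t
    have ht1 : HasDerivAt (fun t : ℝ => (t : ℂ)) 1 t := (hasDerivAt_id t).ofReal_comp
    have h1 := (hasDerivAt_of_smooth hS t).1.ofReal_comp
    have h2 := (hasDerivAt_of_smooth hS t).2.ofReal_comp
    refine (((ht1.mul h2).mul (hwd t)).sub ((h1.mul (hwd t)).mul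
      ((ht1.const_mul (Complex.I * κ)).const_add 1))).congr_deriv ?_
    simp only [hf, hq, Pi.mul_apply]
    linear_combination (t * ((Θ t : ℝ) : ℂ) * w t * κ ^ 2) * hI
  have e1 : ∫ x, cutRes κ Θ r x = ∫ t in (0 : ℝ)..η, f t := by
    have hpi : (Real.pi : ℂ) ≠ 0 := by exact_mod_cast Real.pi_ne_zero
    simp only [cutRes]
    rw [integral_radial (fun t => (((deriv (deriv Θ) t : ℝ) : ℂ) -
      2 * (Complex.I * κ) * ((deriv Θ t : ℝ) : ℂ)) * outProf κ t) r, ← integral_const_mul,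
      intervalIntegral.integral_of_le hη.le]
    have e2 : ∀ t ∈ Set.Ioi (0 : ℝ), 4 * Real.pi * (((t ^ 2 : ℝ) : ℂ) *
        ((((deriv (deriv Θ) t : ℝ) : ℂ) - 2 * (Complex.I * κ) * ((deriv Θ t : ℝ) : ℂ)) *
          outProf κ t)) = f t := by
      intro t ht
      have h0 : (t : ℂ) ≠ 0 := by exact_mod_cast (ne_of_gt ht)
      simp only [hf, hw, outProf]
      push_cast
      field_simp
    rw [setIntegral_congr_fun measurableSet_Ioi e2]
    refine setIntegral_eq_of_subset_of_forall_sdiff_eq_zero measurableSet_Ioi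
      (fun t ht => ht.1) fun t ht => ?_
    have : η ≤ t := by by_contra hh; exact ht.2 ⟨ht.1, by linarith⟩
    simp [hf, hΘ, deriv_innerCut_of_ge hη t this, deriv_deriv_innerCut_of_ge hη t this]
  have e3 := intervalIntegral.integral_eq_sub_of_hasDerivAt (a := (0 : ℝ)) (b := η)
    (fun t _ => hQd t) (by
      have : Continuous fun t => f t - (κ : ℂ) ^ 2 * q t := by fun_prop
      exact this.intervalIntegrable _ _)
  rw [intervalIntegral.integral_sub (hfc.intervalIntegrable _ _)
    ((hqc.const_mul _).intervalIntegrable _ _), intervalIntegral.integral_const_mul] at e3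
  rw [e1, sub_eq_iff_eq_add.1 e3]
  have q0 : Q 0 = 0 := by simp [hQ, hΘ, innerCut_of_le hη (by linarith : (0 : ℝ) ≤ η / 2)]
  have q1 : Q η = -(w η * (1 + Complex.I * κ * η)) := by
    simp [hQ, hΘ, innerCut_of_ge hη le_rfl, deriv_innerCut_of_ge hη η le_rfl]
  rw [q0, q1, sub_zero]

lemma tendsto_integral_cutRes_innerCut_mass (κ : ℝ) (r : Space) :
    Tendsto (fun η => ∫ x, cutRes κ (innerCut η) r x) (𝓝[>] 0) (𝓝 (-1)) := by
  have h1 : Tendsto (fun η : ℝ => -(Complex.exp (-Complex.I * κ * η) * (1 + Complex.I * κ * η)))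
      (𝓝[>] 0) (𝓝 (-1)) := by
    have : Continuous (fun η : ℝ =>
      -(Complex.exp (-Complex.I * κ * η) * (1 + Complex.I * κ * η))) := by fun_prop
    have := this.tendsto 0
    simp at this
    exact (tendsto_nhdsWithin_of_tendsto_nhds (by simpa using this))
  have h2 : Tendsto (fun η : ℝ => (κ : ℂ) ^ 2 * ∫ t in (0 : ℝ)..η,
      t * innerCut η t * Complex.exp (-Complex.I * κ * t)) (𝓝[>] 0) (𝓝 0) := by
    rw [← mul_zero ((κ : ℂ) ^ 2)]
    refine Tendsto.const_mul _ (squeeze_zero_norm' (a := fun η => η * η) ?_ ?_)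
    · filter_upwards [self_mem_nhdsWithin] with η (hη : 0 < η)
      have := intervalIntegral.norm_integral_le_of_norm_le_const (a := 0) (b := η) (C := η)
        (f := fun t : ℝ => (t : ℂ) * innerCut η t * Complex.exp (-Complex.I * κ * t))
        (fun t ht => by
          rw [Set.uIoc_of_le hη.le] at ht
          rw [norm_mul, norm_mul, norm_cexp, mul_one, Complex.norm_real, Complex.norm_real,
            Real.norm_of_nonneg ht.1.le]
          exact (mul_le_of_le_one_right ht.1.le (abs_innerCut_le η t)).trans ht.2)
      simpa [abs_of_pos hη] using this
    · have : Continuous fun η : ℝ => η * η := by fun_prop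
      have := this.tendsto 0
      simp only [mul_zero] at this
      exact tendsto_nhdsWithin_of_tendsto_nhds this
  refine (by simpa using h1.add h2 : Tendsto _ _ _).congr' ?_
  filter_upwards [self_mem_nhdsWithin] with η hη
  rw [integral_cutRes_innerCut κ hη]
  simp

lemma exists_bound_cutRes_innerCut (κ : ℝ) : ∃ C, 0 ≤ C ∧ ∀ η, 0 < η → η ≤ 1 → ∀ r x,
    ‖cutRes κ (innerCut η) r x‖ ≤ C / η ^ 3 := by
  obtain ⟨C, hC, h⟩ := exists_bound_deriv_innerCut
  refine ⟨2 * C * (1 + 2 * |κ|), by positivity, fun η hη hη1 r x => ?_⟩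
  rcases le_or_gt ‖x - r‖ (η / 2) with hx | hx
  · rw [cutRes, deriv_innerCut_of_le hη _ hx, deriv_deriv_innerCut_of_le hη _ hx]
    simp only [Complex.ofReal_zero, mul_zero, sub_zero, zero_mul, norm_zero]
    positivity
  · obtain ⟨b1, b2, -⟩ := h η hη ‖x - r‖
    have b1' : |deriv (innerCut η) ‖x - r‖| ≤ C / η ^ 2 :=
      b1.trans (div_le_div_of_nonneg_left hC (by positivity) (by nlinarith))
    have n1 : ‖((deriv (deriv (innerCut η)) ‖x - r‖ : ℝ) : ℂ) -
        2 * (Complex.I * κ) * ((deriv (innerCut η) ‖x - r‖ : ℝ) : ℂ)‖ ≤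
        C / η ^ 2 * (1 + 2 * |κ|) := by
      refine (norm_sub_le _ _).trans ?_
      rw [norm_mul, norm_mul, norm_mul, Complex.norm_I, Complex.norm_real, Complex.norm_real,
        Complex.norm_real, Complex.norm_ofNat, Real.norm_eq_abs, Real.norm_eq_abs, Real.norm_eq_abs]
      have := mul_le_mul_of_nonneg_left b1' (by positivity : 0 ≤ 2 * |κ|)
      linarith
    have n2 : ‖outProf κ ‖x - r‖‖ ≤ 2 / η := by
      refine (norm_outProf_le κ (by linarith)).trans ?_
      rw [div_le_div_iff₀ (by linarith) hη]; linarith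
    rw [cutRes, norm_mul]
    calc _ ≤ C / η ^ 2 * (1 + 2 * |κ|) * (2 / η) := by gcongr
      _ = _ := by field_simp

/-- The residual at the pole is minus an approximate identity. -/
theorem tendsto_integral_cutRes_innerCut (κ : ℝ) {r : Space} {e : Space → ℂ}
    (he : LocallyIntegrable e) (hr : ContinuousAt e r) :
    Tendsto (fun η => ∫ x, e x * cutRes κ (innerCut η) r x) (𝓝[>] 0) (𝓝 (-e r)) := by
  obtain ⟨C, hC, hb⟩ := exists_bound_cutRes_innerCut κ
  have h1 : Tendsto (fun η => e r * ∫ x, cutRes κ (innerCut η) r x) (𝓝[>] 0) (𝓝 (-e r)) := by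
    simpa using (tendsto_integral_cutRes_innerCut_mass κ r).const_mul (e r)
  have h2 : Tendsto (fun η => ∫ x, (e x - e r) * cutRes κ (innerCut η) r x) (𝓝[>] 0) (𝓝 0) := by
    rw [Metric.tendsto_nhds]
    intro ε hε
    set B := C * (4 * Real.pi / 3) with hB
    have hB0 : 0 ≤ B := by positivity
    obtain ⟨δ, hδ, hball⟩ := Metric.eventually_nhds_iff_ball.1
      (hr.eventually (Metric.ball_mem_nhds _ (by positivity : 0 < ε / (B + 1))))
    filter_upwards [self_mem_nhdsWithin,
      nhdsWithin_le_nhds (Iio_mem_nhds (lt_min hδ one_pos))] with η (hη : 0 < η) hη'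
    have hη1 : η ≤ 1 := (lt_of_lt_of_le hη' (min_le_right _ _)).le
    have hηδ : η < δ := lt_of_lt_of_le hη' (min_le_left _ _)
    rw [dist_zero_right]
    have hz : ∀ x, x ∉ Metric.ball r η → (e x - e r) * cutRes κ (innerCut η) r x = 0 := by
      intro x hx
      rw [cutRes_innerCut_of_ge hη (by simpa [dist_eq_norm] using hx), mul_zero]
    rw [← setIntegral_eq_integral_of_forall_compl_eq_zero hz]
    have := norm_setIntegral_le_of_norm_le_const (μ := (volume : Measure Space))
      (s := Metric.ball r η) (f := fun x => (e x - e r) * cutRes κ (innerCut η) r x)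
      (C := ε / (B + 1) * (C / η ^ 3)) measure_ball_lt_top (fun x hx => by
        rw [norm_mul]
        have h3 := hball x (Metric.ball_subset_ball hηδ.le hx)
        rw [dist_eq_norm] at h3
        exact mul_le_mul h3.le (hb η hη hη1 r x) (norm_nonneg _) (by positivity))
    refine this.trans_lt ?_
    rw [measureReal_ball r hη.le]
    calc ε / (B + 1) * (C / η ^ 3) * (4 * Real.pi / 3 * η ^ 3) = ε * (B / (B + 1)) := by
          rw [hB]; field_simp
      _ < ε * 1 := by
          gcongr
          rw [div_lt_one (by positivity)]; linarith
      _ = ε := mul_one ε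
  refine (by simpa using h1.add h2 : Tendsto _ _ _).congr' ?_
  filter_upwards [self_mem_nhdsWithin] with η hη
  have hc := (contDiff_cutRes_innerCut κ hη r).continuous
  have hcs := hasCompactSupport_cutRes_innerCut κ hη r
  have i1 : Integrable (fun x => e x * cutRes κ (innerCut η) r x) := by
    simpa [mul_comm] using he.integrable_smul_left_of_hasCompactSupport hc hcs
  have i2 : Integrable (fun x => e r * cutRes κ (innerCut η) r x) :=
    (hc.integrable_of_hasCompactSupport hcs).const_mul _
  simp only [sub_mul]
  rw [integral_sub i1 i2, integral_const_mul]
  ring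

/-! ### The Newton potential and the dyadic of an exclusion volume -/

/-- The cut-off function that is supported in an annulus about the pole. -/
def annCut (k η R t : ℝ) : ℝ := innerCut η t + (outerCut k R t - 1)

section AnnCut

variable {k η R t : ℝ}

lemma contDiff_annCut (k η R : ℝ) : ContDiff ℝ (⊤ : ℕ∞) (annCut k η R) :=
  (contDiff_innerCut η).add ((contDiff_outerCut k R).sub contDiff_const)

lemma annCut_of_le_outer (hk : 0 < k) (ht : t ≤ R) : annCut k η R t = innerCut η t := by
  simp [annCut, outerCut_of_le hk ht]

lemma annCut_of_le (hk : 0 < k) (hη : 0 < η) (hR : η ≤ R) (ht : t ≤ η / 2) :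
    annCut k η R t = 0 := by
  rw [annCut_of_le_outer hk (by linarith), innerCut_of_le hη ht]

lemma annCut_of_ge (hk : 0 < k) (hη : 0 < η) (hR : η ≤ R) (ht : R + outerWidth k ≤ t) :
    annCut k η R t = 0 := by
  have : 0 < outerWidth k := by rw [outerWidth]; positivity
  rw [annCut, outerCut_of_ge hk ht, innerCut_of_ge hη (by linarith)]
  ring

lemma deriv_annCut (k η R t : ℝ) :
    deriv (annCut k η R) t = deriv (innerCut η) t + deriv (outerCut k R) t :=
  ((hasDerivAt_of_smooth (contDiff_innerCut η) t).1.add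
    ((hasDerivAt_of_smooth (contDiff_outerCut k R) t).1.sub_const 1)).deriv

lemma deriv_deriv_annCut (k η R t : ℝ) : deriv (deriv (annCut k η R)) t =
    deriv (deriv (innerCut η)) t + deriv (deriv (outerCut k R)) t := by
  rw [show deriv (annCut k η R) = fun t => deriv (innerCut η) t + deriv (outerCut k R) t from
    funext (deriv_annCut k η R)]
  exact ((hasDerivAt_of_smooth (contDiff_innerCut η) t).2.add
    (hasDerivAt_of_smooth (contDiff_outerCut k R) t).2).deriv

lemma cutRes_annCut (κ k η R : ℝ) (r x : Space) : cutRes κ (annCut k η R) r x =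
    cutRes κ (innerCut η) r x + cutRes κ (outerCut k R) r x := by
  simp only [cutRes, deriv_annCut, deriv_deriv_annCut]
  push_cast
  ring

lemma cutG_annCut (κ : ℝ) (hk : 0 < k) {r x : Space} (h : ‖x - r‖ ≤ R) :
    cutG κ (annCut k η R) r x = cutG κ (innerCut η) r x := by
  simp [cutG, annCut_of_le_outer hk h]

lemma cutHess_annCut (κ : ℝ) (hk : 0 < k) {r x : Space} (h : ‖x - r‖ ≤ R) :
    cutHess κ (annCut k η R) r x = cutHess κ (innerCut η) r x := by
  simp [cutHess, annCut_of_le_outer hk h, deriv_annCut, deriv_deriv_annCut,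
    deriv_outerCut_of_le hk _ h, deriv_deriv_outerCut_of_le hk _ h]

lemma contDiff_cutG_annCut (κ : ℝ) (hk : 0 < k) (hη : 0 < η) (hR : η ≤ R) (r : Space) :
    ContDiff ℝ (⊤ : ℕ∞) (cutG κ (annCut k η R) r) :=
  contDiff_cutG κ (contDiff_annCut k η R) (half_pos hη)
    (fun _ ht => annCut_of_le hk hη hR ht.le) r

lemma hasCompactSupport_cutG_annCut (κ : ℝ) (hk : 0 < k) (hη : 0 < η) (hR : η ≤ R) (r : Space) :
    HasCompactSupport (cutG κ (annCut k η R) r) :=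
  hasCompactSupport_cutG κ (fun _ ht => annCut_of_ge hk hη hR ht.le) r

end AnnCut

lemma ae_ne (r : Space) : ∀ᵐ x : Space, x ≠ r := by
  simp [ae_iff]

/-- Differentiation under the integral sign for the potential of a set with a smooth compactly
supported kernel. -/
lemma potential_hasFDerivAt (V : Set Space) (hV : MeasurableSet V) {ψ : Space → ℂ}
    (hψ : ContDiff ℝ (⊤ : ℕ∞) ψ) (hc : HasCompactSupport ψ) :
    ContDiff ℝ (⊤ : ℕ∞) (fun x => ∫ y in V, ψ (x - y)) ∧
      ∀ i x, pderiv i (fun x => ∫ y in V, ψ (x - y)) x = ∫ y in V, pderiv i ψ (x - y) := by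
  set f : Space → ℝ := V.indicator 1 with hf
  have hfl : LocallyIntegrable f :=
    (locallyIntegrable_const (1 : ℝ)).indicator hV
  have key : ∀ {F : Type} [NormedAddCommGroup F] [NormedSpace ℝ F] (φ : Space → F) (x : Space),
      ∫ y in V, φ (x - y) = ∫ y, f y • φ (x - y) := by
    intro F _ _ φ x
    rw [← integral_indicator hV]
    refine integral_congr_ae (Eventually.of_forall fun y => ?_)
    by_cases hy : y ∈ V <;> simp [hf, hy]
  have hconv : (fun x => ∫ y in V, ψ (x - y)) =
      convolution f ψ (ContinuousLinearMap.lsmul ℝ ℝ) volume := by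
    funext x
    rw [key ψ x]; rfl
  refine ⟨by rw [hconv]; exact hc.contDiff_convolution_right _ hfl hψ, fun i x => ?_⟩
  have hd := hc.hasFDerivAt_convolution_right (ContinuousLinearMap.lsmul ℝ ℝ) hfl
    (hψ.of_le (by exact_mod_cast le_top)) x
  rw [hconv, HasFDerivAt.pderiv_eq hd, key]
  have hci : ConvolutionExistsAt f (fderiv ℝ ψ) x
      ((ContinuousLinearMap.lsmul ℝ ℝ : ℝ →L[ℝ] ℂ →L[ℝ] ℂ).precompR Space) volume :=
    (hc.fderiv ℝ).convolutionExists_right _ hfl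
      (hψ.continuous_fderiv (by simp)) x
  rw [convolution_def, ContinuousLinearMap.integral_apply hci]
  rfl

/-- Second derivatives of such a potential. -/
lemma hess_potential (V : Set Space) (hV : MeasurableSet V) {ψ : Space → ℂ}
    (hψ : ContDiff ℝ (⊤ : ℕ∞) ψ) (hc : HasCompactSupport ψ) (x : Space) (i j : Fin 3) :
    hess (fun x => ∫ y in V, ψ (x - y)) x i j = ∫ y in V, hess ψ (x - y) i j := by
  have h1 : pderiv j (fun x => ∫ y in V, ψ (x - y)) = fun x => ∫ y in V, pderiv j ψ (x - y) :=
    funext fun x => (potential_hasFDerivAt V hV hψ hc).2 j x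
  change pderiv i (pderiv j _) x = _
  rw [h1, (potential_hasFDerivAt V hV (contDiff_pderiv hψ j) (hasCompactSupport_pderiv hc j)).2]
  rfl

/-- Powers of the distance larger than `-3` are integrable on balls. -/
lemma integrableOn_norm_sub_rpow {β : ℝ} (hβ : 0 < β) (r : Space) (M : ℝ) :
    IntegrableOn (fun x : Space => ‖x - r‖ ^ (β - 3)) (Metric.ball r M) := by
  have h0 : IntegrableOn (fun x : Space => ‖x‖ ^ (β - 3)) (Metric.ball 0 M) := by
    refine (integrableOn_fun_norm_addHaar (volume : Measure Space) (f := fun t => t ^ (β - 3))).2 ?_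
    have hi : IntegrableOn (fun t : ℝ => t ^ (β - 1)) (Set.Ioo 0 M) := by
      rcases le_or_gt M 0 with hM | hM
      · simp [Set.Ioo_eq_empty (not_lt.2 hM)]
      · exact (intervalIntegral.integrableOn_Ioo_rpow_iff hM).2 (by linarith)
    refine hi.congr_fun (fun t ht => ?_) measurableSet_Ioo
    have hdim : Module.finrank ℝ Space = 3 := by simp
    simp only [hdim, smul_eq_mul]
    rw [← Real.rpow_natCast, ← Real.rpow_add ht.1]
    norm_num
    ring_nf
  have := (measurePreserving_sub_right (volume : Measure Space) r).integrableOn_comp_preimage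
    (MeasurableEquiv.subRight r).measurableEmbedding (f := fun x : Space => ‖x‖ ^ (β - 3))
    (s := Metric.ball 0 M)
  have h2 := this.2 h0
  have h3 : (fun x => x - r) ⁻¹' Metric.ball (0 : Space) M = Metric.ball r M := by
    ext x; simp [dist_eq_norm]
  rw [h3] at h2
  exact h2

lemma cutHess_swap (κ : ℝ) (S : ℝ → ℝ) (r x : Space) : cutHess κ S x r = cutHess κ S r x := by
  rw [cutHess, radialHess_swap, norm_sub_rev]; rfl

lemma dir_sub (r x : Space) (i : Fin 3) : dir r x i = dir 0 (x - r) i := by simp [dir]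

lemma cutHess_eq_sub (κ : ℝ) (S : ℝ → ℝ) (r x : Space) :
    cutHess κ S r x = cutHess κ S 0 (x - r) := by
  ext i j
  simp only [cutHess, radialHess, Matrix.of_apply, dir_sub r x, sub_zero]

/-- Near an interior point of `V` the Newton potential of `V` differs by a constant from a
potential with a smooth kernel. -/
lemma newtonPotential_eventuallyEq {V : Set Space} (hV : MeasurableSet V) {r : Space} {η R : ℝ}
    (hη : 0 < η) (hR : η ≤ R) (hVη : Metric.ball r (2 * η) ⊆ V) (hVR : V ⊆ Metric.ball r (R - η)) :
    ∃ c : ℂ, newtonPotential V =ᶠ[𝓝 r]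
      fun x => c + ∫ y in V, cutG 0 (annCut 1 η R) 0 (x - y) := by
  -- the part of the kernel that the smoothing removes: its translates by points near `r` are
  -- supported in `V`, so its contribution does not depend on the point
  set core : Space → ℂ := fun z => ((1 - innerCut η ‖z‖ : ℝ) : ℂ) * outProf 0 ‖z‖ with hcore
  refine ⟨∫ z, core z, ?_⟩
  have hz : ∀ z, η ≤ ‖z‖ → core z = 0 := fun z h => by simp [hcore, innerCut_of_ge hη h]
  have hmeas : Measurable core := by
    have h1 : Measurable (innerCut η) := (contDiff_innerCut η).continuous.measurable
    have h2 : Measurable (outProf 0) := by unfold outProf; fun_prop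
    have : Measurable fun z : Space => ‖z‖ := measurable_norm
    exact (Complex.measurable_ofReal.comp ((measurable_const.sub h1).comp this)).mul (h2.comp this)
  have hci : Integrable core := by
    have hi : IntegrableOn core (Metric.ball 0 η) := by
      refine Integrable.mono' ((integrableOn_norm_sub_rpow two_pos 0 η).const_mul 2)
        hmeas.aestronglyMeasurable (Eventually.of_forall fun z => ?_)
      by_cases h0 : z = 0
      · simp only [hcore, h0, norm_zero, outProf]
        simp
        positivity
      have hzp : 0 < ‖z‖ := norm_pos_iff.2 h0
      rw [hcore, norm_mul, Complex.norm_real, sub_zero]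
      have h1 := norm_outProf_le 0 hzp
      have h2 : |1 - innerCut η ‖z‖| ≤ 2 := (abs_sub _ _).trans (by
        have := abs_innerCut_le η ‖z‖; rw [abs_one]; linarith)
      have h3 : ‖z‖ ^ ((2 : ℝ) - 3) = 1 / ‖z‖ := by
        rw [show (2 : ℝ) - 3 = -1 by norm_num, Real.rpow_neg_one, one_div]
      rw [h3]
      exact mul_le_mul h2 h1 (norm_nonneg _) two_pos.le
    refine (integrableOn_iff_integrable_of_support_subset (fun z hzs => ?_)).1 hi
    by_contra hh
    exact hzs (hz z (by simpa using hh))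
  filter_upwards [Metric.ball_mem_nhds r hη] with x hx
  have hx' : dist x r < η := hx
  have hcx : Integrable (fun y => core (x - y)) := hci.comp_sub_left x
  have hψ := contDiff_cutG_annCut 0 one_pos hη hR 0
  have hψc := hasCompactSupport_cutG_annCut 0 one_pos hη hR 0
  have hψi : Integrable (fun y => cutG 0 (annCut 1 η R) 0 (x - y)) :=
    (hψ.continuous.integrable_of_hasCompactSupport hψc).comp_sub_left x
  have e1 : ∫ y in V, core (x - y) = ∫ z, core z := by
    rw [setIntegral_eq_integral_of_forall_compl_eq_zero, integral_sub_left_eq_self core]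
    intro y hy
    refine hz _ ?_
    by_contra hh
    push Not at hh
    refine hy (hVη ?_)
    have := dist_triangle y x r
    rw [Metric.mem_ball]
    rw [← dist_eq_norm, dist_comm] at hh
    linarith
  rw [newtonPotential, ← e1, ← integral_add hcx.integrableOn hψi.integrableOn]
  refine setIntegral_congr_fun hV fun y hy => ?_
  have hyR : ‖x - y‖ ≤ R := by
    have h1 := hVR hy
    have := dist_triangle x r y
    rw [Metric.mem_ball] at h1
    rw [← dist_eq_norm]
    rw [dist_comm r y] at this
    linarith
  simp only [hcore, cutG, g₀_eq, sub_zero, annCut_of_le_outer one_pos hyR]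
  push_cast
  ring

section Dyadic

variable {V : Set Space} {r : Space} {η R : ℝ}

lemma contDiffAt_newtonPotential (hV : MeasurableSet V) (hη : 0 < η) (hR : η ≤ R)
    (hVη : Metric.ball r (2 * η) ⊆ V) (hVR : V ⊆ Metric.ball r (R - η)) :
    ContDiffAt ℝ (⊤ : ℕ∞) (newtonPotential V) r := by
  obtain ⟨c, hc⟩ := newtonPotential_eventuallyEq hV hη hR hVη hVR
  refine ContDiffAt.congr_of_eventuallyEq ?_ hc
  exact contDiffAt_const.add (potential_hasFDerivAt V hV (contDiff_cutG_annCut 0 one_pos hη hR 0)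
    (hasCompactSupport_cutG_annCut 0 one_pos hη hR 0)).1.contDiffAt

/-- The dyadic of the exclusion volume is minus the integral over `V` of the Hessian of the static
kernel smoothed near its pole, whatever the smoothing. -/
theorem LDyadic_eq_integral_hess (hV : MeasurableSet V) (hη : 0 < η) (hR : η ≤ R)
    (hVη : Metric.ball r (2 * η) ⊆ V) (hVR : V ⊆ Metric.ball r (R - η)) (i j : Fin 3) :
    LDyadic V r i j = -∫ y in V, hess (cutG 0 (annCut 1 η R) r) y i j := by
  obtain ⟨c, hc⟩ := newtonPotential_eventuallyEq hV hη hR hVη hVR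
  have hψ := contDiff_cutG_annCut 0 one_pos hη hR 0
  have hψc := hasCompactSupport_cutG_annCut 0 one_pos hη hR 0
  rw [LDyadic, Matrix.neg_apply, hess_congr hc]
  congr 1
  have h1 : hess (fun x => c + ∫ y in V, cutG 0 (annCut 1 η R) 0 (x - y)) r i j =
      hess (fun x => ∫ y in V, cutG 0 (annCut 1 η R) 0 (x - y)) r i j := by
    have : pderiv j (fun x => c + ∫ y in V, cutG 0 (annCut 1 η R) 0 (x - y)) =
        pderiv j (fun x => ∫ y in V, cutG 0 (annCut 1 η R) 0 (x - y)) := by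
      funext x; rw [pderiv, pderiv, fderiv_const_add]
    change pderiv i (pderiv j _) r = pderiv i (pderiv j _) r
    rw [this]
  rw [h1, hess_potential V hV hψ hψc]
  refine setIntegral_congr_ae hV ?_
  filter_upwards [ae_ne r] with y hy _
  have hS := contDiff_annCut 1 η R
  rw [hess_cutG 0 hS hy, hess_cutG 0 hS (sub_ne_zero.2 (Ne.symm hy)), ← cutHess_eq_sub 0 _ y r,
    cutHess_swap]

lemma LDyadic_eq (hV : MeasurableSet V) (hη : 0 < η) (hR : η ≤ R)
    (hVη : Metric.ball r (2 * η) ⊆ V) (hVR : V ⊆ Metric.ball r (R - η)) (i j : Fin 3) :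
    LDyadic V r i j = -∫ y in V, cutHess 0 (innerCut η) r y i j := by
  rw [LDyadic_eq_integral_hess hV hη hR hVη hVR]
  congr 1
  refine setIntegral_congr_ae hV ?_
  filter_upwards [ae_ne r] with y hy hyV
  have h1 := hVR hyV
  rw [Metric.mem_ball, dist_eq_norm] at h1
  rw [hess_cutG 0 (contDiff_annCut 1 η R) hy, cutHess_annCut 0 one_pos (by linarith)]

end Dyadic

lemma exists_exclusion_radii {V : Set Space} {r : Space} (hVn : V ∈ 𝓝 r)
    (hVb : Bornology.IsBounded V) : ∃ η₀ > 0, ∃ R₀, ∀ η, 0 < η → η ≤ η₀ →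
      ∀ R, R₀ ≤ R → η ≤ R ∧ Metric.ball r (2 * η) ⊆ V ∧ V ⊆ Metric.ball r (R - η) := by
  obtain ⟨δ, hδ, hball⟩ := Metric.mem_nhds_iff.1 hVn
  obtain ⟨M, hM⟩ := hVb.subset_ball r
  refine ⟨min (δ / 2) 1, by positivity, max (M + 1) 1, fun η hη hη0 R hR => ?_⟩
  have h1 : η ≤ δ / 2 := hη0.trans (min_le_left _ _)
  have h2 : η ≤ 1 := hη0.trans (min_le_right _ _)
  have h3 : M + 1 ≤ R := (le_max_left _ _).trans hR
  have h4 : 1 ≤ R := (le_max_right _ _).trans hR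
  exact ⟨by linarith, (Metric.ball_subset_ball (by linarith)).trans hball,
    hM.trans (Metric.ball_subset_ball (by linarith))⟩

/-! ### The dyadic as a surface integral -/

lemma outProf_zero (t : ℝ) : outProf 0 t = ((1 / (4 * Real.pi * t) : ℝ) : ℂ) := by
  simp [outProf]

lemma outProf₁_zero (t : ℝ) : outProf₁ 0 t = ((-(1 / (4 * Real.pi * t ^ 2)) : ℝ) : ℂ) := by
  simp [outProf₁]; ring

lemma outProf₂_zero (t : ℝ) : outProf₂ 0 t = ((1 / (4 * Real.pi) * (2 / t ^ 3) : ℝ) : ℂ) := by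
  simp [outProf₂]

/-- The static kernel is real, hence so is its cut-off Hessian. -/
lemma ofReal_re_cutHess (S : ℝ → ℝ) (r x : Space) (i j : Fin 3) :
    (((cutHess 0 S r x i j).re : ℝ) : ℂ) = cutHess 0 S r x i j := by
  rw [← Complex.conj_eq_iff_re, cutHess, outProf_zero, outProf₁_zero, outProf₂_zero, radialHess,
    Matrix.of_apply]
  by_cases h : i = j <;> simp [h, map_ofNat]

/-- The Gauss–Green formula for the field `∂ᵢψ eⱼ`, with `ψ` the static kernel smoothed near its
pole, turns the volume integral for the dyadic into a surface integral. -/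
theorem LDyadic_eq_surface_integral {V : Set Space} (hV : MeasurableSet V) {r : Space}
    (hVn : V ∈ 𝓝 r) (hVb : Bornology.IsBounded V) {σ : Measure Space} {n : Space → Space}
    (hB : HasBoundary V σ n) (i j : Fin 3) :
    LDyadic V r i j =
      ((∫ r', (r' - r) i * n r' j / (4 * Real.pi * ‖r' - r‖ ^ 3) ∂σ : ℝ) : ℂ) := by
  obtain ⟨η, hη, R, hηR⟩ := exists_exclusion_radii hVn hVb
  obtain ⟨hR, hVη, hVR⟩ := hηR η hη le_rfl R le_rfl
  set ψ := cutG 0 (annCut 1 η R) r with hψdef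
  have hψ : ContDiff ℝ (⊤ : ℕ∞) ψ := contDiff_cutG_annCut 0 one_pos hη hR r
  have hψc : HasCompactSupport ψ := hasCompactSupport_cutG_annCut 0 one_pos hη hR r
  set f : Space → ℝ := fun x => (pderiv i ψ x).re with hf
  have hfs : ContDiff ℝ (⊤ : ℕ∞) f := Complex.reCLM.contDiff.comp (contDiff_pderiv hψ i)
  have hfc : HasCompactSupport f :=
    (hasCompactSupport_pderiv hψc i).comp_left (g := Complex.re) rfl
  have hdiv : ∀ x, ∑ l, (fderiv ℝ (fun x => f x • EuclideanSpace.single j 1 : Space → Space) x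
      (EuclideanSpace.single l 1)) l = (hess ψ x j i).re := by
    intro x
    have h1 : HasFDerivAt (fun x => f x • EuclideanSpace.single j 1 : Space → Space)
        ((fderiv ℝ f x).smulRight (EuclideanSpace.single j (1 : ℝ))) x :=
      ((hfs.differentiable (by simp)) x).hasFDerivAt.smul_const _
    have h2 : fderiv ℝ f x = Complex.reCLM.comp (fderiv ℝ (pderiv i ψ) x) :=
      (Complex.reCLM.hasFDerivAt.comp x
        (((contDiff_pderiv hψ i).differentiable (by simp)) x).hasFDerivAt).fderiv
    rw [h1.fderiv, h2]
    simp [hess, pderiv]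
  have hGG := hB.gauss_green (fun x => f x • EuclideanSpace.single j 1)
    ((hfs.of_le (by exact_mod_cast le_top)).smul contDiff_const) hfc.smul_right
  simp only [hdiv] at hGG
  have hre : ∫ y in V, hess ψ y i j = ((∫ y in V, (hess ψ y j i).re : ℝ) : ℂ) := by
    rw [← integral_complex_ofReal]
    refine setIntegral_congr_ae hV ?_
    filter_upwards [ae_ne r] with y hy _
    have hsymm : hess ψ y i j = hess ψ y j i := pderiv_comm hψ i j y
    rw [hsymm, hess_cutG 0 (contDiff_annCut 1 η R) hy, ofReal_re_cutHess]
  rw [LDyadic_eq_integral_hess hV hη hR hVη hVR, ← hψdef, hre, hGG, ← Complex.ofReal_neg,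
    ← integral_neg]
  congr 1
  refine integral_congr_ae ?_
  have hfr : ∀ᵐ x ∂σ, x ∈ frontier V := hB.concentrated
  filter_upwards [hfr] with x hx
  -- on the boundary of `V` the cut-off function is `1`
  have hx1 : η < ‖x - r‖ := by
    by_contra hh
    push Not at hh
    refine hx.2 (interior_maximal hVη Metric.isOpen_ball ?_)
    rw [Metric.mem_ball, dist_eq_norm]; linarith
  have hx2 : ‖x - r‖ < R := by
    have h1 := closure_mono hVR hx.1
    have h2 := Metric.closure_ball_subset_closedBall h1
    rw [Metric.mem_closedBall, dist_eq_norm] at h2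
    linarith
  have hxr : x ≠ r := by
    rintro rfl
    simp at hx1
    linarith
  have hev : ψ =ᶠ[𝓝 x] fun y => outProf 0 ‖y - r‖ := by
    have hc : Continuous fun y : Space => ‖y - r‖ := by fun_prop
    filter_upwards [hc.continuousAt.eventually (lt_mem_nhds hx1),
      hc.continuousAt.eventually (gt_mem_nhds hx2)] with y h1 h2
    simp [hψdef, cutG, annCut_of_le_outer one_pos h2.le, innerCut_of_ge hη h1.le]
  have hval : f x = -(1 / (4 * Real.pi * ‖x - r‖ ^ 2)) * dir r x i := by
    simp only [hf]
    rw [pderiv_congr hev, pderiv_radial hxr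
      (hasDerivAt_outProf 0 (norm_pos_iff.2 (sub_ne_zero.2 hxr))), outProf₁_zero,
      ← Complex.ofReal_mul, Complex.ofReal_re]
  rw [inner_smul_left, hval, EuclideanSpace.inner_single_left, dir]
  simp
  ring

/-! ### The dyadic of a ball -/

lemma cutHess_diag_congr (κ : ℝ) (S : ℝ → ℝ) {w z : Space} {i j : Fin 3} (hn : ‖w‖ = ‖z‖)
    (hc : w i = z j) : cutHess κ S 0 w i i = cutHess κ S 0 z j j := by
  have : dir 0 w i = dir 0 z j := by simp [dir, hn, hc]
  simp [cutHess, radialHess, hn, this]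

lemma cutHess_offDiag_flip (κ : ℝ) (S : ℝ → ℝ) {w z : Space} {i j : Fin 3} (hij : i ≠ j)
    (hn : ‖w‖ = ‖z‖) (hi : w i = -z i) (hj : w j = z j) :
    cutHess κ S 0 w i j = -cutHess κ S 0 z i j := by
  have h1 : dir 0 w i = -dir 0 z i := by simp [dir, hn, hi, neg_div]
  have h2 : dir 0 w j = dir 0 z j := by simp [dir, hn, hj]
  simp [cutHess, radialHess, hn, h1, h2, hij]
  ring

lemma setIntegral_ball_isometry (T : Space ≃ₗᵢ[ℝ] Space) (f : Space → ℂ) (δ : ℝ) :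
    ∫ z in Metric.ball 0 δ, f (T z) = ∫ z in Metric.ball 0 δ, f z := by
  have h := T.measurePreserving.setIntegral_preimage_emb
    T.toHomeomorph.measurableEmbedding f (Metric.ball 0 δ)
  have hpre : T ⁻¹' Metric.ball (0 : Space) δ = Metric.ball 0 δ := by
    ext z; simp
  rwa [hpre] at h

/-- By reflection and permutation symmetry the dyadic of a ball is a multiple of the identity, and
its trace is minus the total flux of the static field, that is `1`. -/
theorem LDyadic_ball (r : Space) {δ : ℝ} (hδ : 0 < δ) :
    LDyadic (Metric.ball r δ) r = (1 / 3 : ℂ) • (1 : Dyadic) := by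
  set η := δ / 2 with hη'
  have hη : 0 < η := half_pos hδ
  set R := δ + η with hR'
  have hR : η ≤ R := by linarith
  have hVη : Metric.ball r (2 * η) ⊆ Metric.ball r δ := Metric.ball_subset_ball (by linarith)
  have hVR : Metric.ball r δ ⊆ Metric.ball r (R - η) := Metric.ball_subset_ball (by linarith)
  set I : Fin 3 → Fin 3 → ℂ := fun i j => ∫ z in Metric.ball 0 δ, cutHess 0 (innerCut η) 0 z i j
    with hI
  have hLI : ∀ i j, LDyadic (Metric.ball r δ) r i j = -I i j := by
    intro i j
    rw [LDyadic_eq measurableSet_ball hη hR hVη hVR]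
    have h := (measurePreserving_sub_right (volume : Measure Space) r).setIntegral_preimage_emb
      (MeasurableEquiv.subRight r).measurableEmbedding
      (fun z => cutHess 0 (innerCut η) 0 z i j) (Metric.ball 0 δ)
    have h3 : (fun x => x - r) ⁻¹' Metric.ball (0 : Space) δ = Metric.ball r δ := by
      ext x; simp [dist_eq_norm]
    rw [h3] at h
    simp only [hI]
    rw [← h]
    simp only [← cutHess_eq_sub]
  have hoff : ∀ i j, i ≠ j → I i j = 0 := by
    intro i j hij
    set T : Space ≃ₗᵢ[ℝ] Space := LinearIsometryEquiv.piLpCongrRight 2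
      (fun l : Fin 3 => if l = i then LinearIsometryEquiv.neg ℝ else LinearIsometryEquiv.refl ℝ ℝ)
      with hT
    have h := setIntegral_ball_isometry T (fun z => cutHess 0 (innerCut η) 0 z i j) δ
    have h2 : ∀ z, cutHess 0 (innerCut η) 0 (T z) i j = -cutHess 0 (innerCut η) 0 z i j :=
      fun z => cutHess_offDiag_flip 0 _ hij (T.norm_map z) (by simp [hT])
        (by simp [hT, hij.symm])
    simp only [h2, integral_neg] at h
    exact self_eq_neg.1 h.symm
  have hdiag : ∀ i j, I i i = I j j := by
    intro i j
    set T : Space ≃ₗᵢ[ℝ] Space := LinearIsometryEquiv.piLpCongrLeft 2 ℝ ℝ (Equiv.swap i j) with hT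
    have h := setIntegral_ball_isometry T (fun z => cutHess 0 (innerCut η) 0 z i i) δ
    have h2 : ∀ z, cutHess 0 (innerCut η) 0 (T z) i i = cutHess 0 (innerCut η) 0 z j j :=
      fun z => cutHess_diag_congr 0 _ (T.norm_map z) (by
        simp [hT, LinearIsometryEquiv.piLpCongrLeft_apply, Equiv.piCongrLeft'])
    simp only [h2] at h
    exact h.symm
  have hint : ∀ i, IntegrableOn (fun z => cutHess 0 (innerCut η) 0 z i i) (Metric.ball 0 δ) := by
    intro i
    have h1 : Integrable (fun z => hess (cutG 0 (annCut 1 η R) 0) z i i) :=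
      (contDiff_hess (contDiff_cutG_annCut 0 one_pos hη hR 0)
        i i).continuous.integrable_of_hasCompactSupport
        (hasCompactSupport_hess (hasCompactSupport_cutG_annCut 0 one_pos hη hR 0) i i)
    refine h1.integrableOn.congr_fun_ae ((ae_restrict_iff' measurableSet_ball).2 ?_)
    filter_upwards [ae_ne 0] with y hy hyV
    rw [Metric.mem_ball, dist_eq_norm] at hyV
    rw [hess_cutG 0 (contDiff_annCut 1 η R) hy, cutHess_annCut 0 one_pos (by linarith)]
  have htr : ∑ i, I i i = -1 := by
    simp only [hI]
    rw [← integral_finsetSum _ fun i _ => hint i]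
    have h1 : ∫ z in Metric.ball 0 δ, ∑ i, cutHess 0 (innerCut η) 0 z i i =
        ∫ z in Metric.ball 0 δ, cutRes 0 (innerCut η) 0 z := by
      refine setIntegral_congr_ae measurableSet_ball ?_
      filter_upwards [ae_ne 0] with y hy _
      have := laplacian_cutG 0 (contDiff_innerCut η) hy
      simp only [hess_cutG 0 (contDiff_innerCut η) hy] at this
      simpa [cutRes] using this
    rw [h1, setIntegral_eq_integral_of_forall_compl_eq_zero, integral_cutRes_innerCut 0 hη]
    · simp
    · intro x hx
      refine cutRes_innerCut_of_ge hη ?_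
      have : δ ≤ ‖x - 0‖ := by simpa using hx
      linarith
  have hI0 : ∀ i, I i i = -(1 / 3) := by
    intro i
    rw [Fin.sum_univ_three, hdiag 0 i, hdiag 1 i, hdiag 2 i] at htr
    linear_combination htr / 3
  ext i j
  rw [hLI]
  by_cases hij : i = j
  · subst hij; simp [hI0]
  · simp [hoff i j hij, Matrix.one_apply_ne hij]

/-! ### Kernel estimates -/

lemma radialHess_sub (a a' b b' : ℂ) (r x : Space) :
    radialHess (a - a') (b - b') r x = radialHess a b r x - radialHess a' b' r x := by
  ext i j; simp [radialHess]; ring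

lemma hessG_eq' (k : ℝ) {r x : Space} (h : x ≠ r) :
    hessG k r x = radialHess (outProf₁ k ‖x - r‖) (outProf₂ k ‖x - r‖) r x := by
  rw [hessG_eq k h.symm, radialHess_swap, norm_sub_rev]

lemma hessG₀_eq' {r x : Space} (h : x ≠ r) :
    hessG₀ r x = radialHess (outProf₁ 0 ‖x - r‖) (outProf₂ 0 ‖x - r‖) r x := by
  rw [hessG₀_eq h.symm, radialHess_swap, norm_sub_rev]

lemma hessGReg_eq' (k : ℝ) {r x : Space} (h : x ≠ r) :
    hessGReg k r x = radialHess (outProf₁ k ‖x - r‖ - outProf₁ 0 ‖x - r‖)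
      (outProf₂ k ‖x - r‖ - outProf₂ 0 ‖x - r‖) r x := by
  rw [hessGReg_eq k h.symm, radialHess_swap, norm_sub_rev]

lemma hessG_eq_add (k : ℝ) {r x : Space} (h : x ≠ r) :
    hessG k r x = hessG₀ r x + hessGReg k r x := by
  rw [hessG_eq' k h, hessG₀_eq' h, hessGReg_eq' k h, ← radialHess_add]
  congr 1 <;> ring

lemma norm_hessG₀_le {r x : Space} (h : x ≠ r) (i j : Fin 3) :
    ‖hessG₀ r x i j‖ ≤ 3 / ‖x - r‖ ^ 3 := by
  have hp := norm_pos_iff.2 (sub_ne_zero.2 h)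
  rw [hessG₀_eq' h]
  refine (norm_radialHess_le _ _ _ _ _ _).trans ?_
  have h1 := norm_outProf₁_zero_le hp
  have h2 := norm_outProf₂_zero_le hp
  calc _ ≤ 1 / ‖x - r‖ ^ 3 + 2 * (1 / ‖x - r‖ ^ 2 / ‖x - r‖) := by gcongr
    _ = _ := by field_simp; ring

lemma exists_bound_hessGReg (k M : ℝ) : ∃ C, 0 ≤ C ∧ ∀ r x : Space, x ≠ r → ‖x - r‖ ≤ M →
    ∀ i j, ‖hessGReg k r x i j‖ ≤ C / ‖x - r‖ := by
  obtain ⟨c, hc, hb⟩ := exists_bound_outProf_sub k M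
  refine ⟨c * |M| + 2 * c, by positivity, fun r x h hM i j => ?_⟩
  have hp := norm_pos_iff.2 (sub_ne_zero.2 h)
  obtain ⟨-, h1, h2⟩ := hb _ hp hM
  rw [hessGReg_eq' k h]
  refine (norm_radialHess_le _ _ _ _ _ _).trans ?_
  have hM' : ‖x - r‖ ≤ |M| := hM.trans (le_abs_self M)
  calc _ ≤ c + 2 * (c / ‖x - r‖) := by gcongr
    _ = (c * ‖x - r‖ + 2 * c) / ‖x - r‖ := by field_simp
    _ ≤ _ := by gcongr

lemma norm_g_le (k : ℝ) {r x : Space} (h : x ≠ r) : ‖g k r x‖ ≤ 1 / ‖x - r‖ := by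
  rw [g_eq, norm_sub_rev]
  exact norm_outProf_le k (norm_pos_iff.2 (sub_ne_zero.2 h))

/-- The smoothed Hessian of the static kernel satisfies the same bound as the Hessian itself,
uniformly in the smoothing radius. -/
lemma exists_bound_cutHess_zero : ∃ C, 0 ≤ C ∧ ∀ η, 0 < η → ∀ r x : Space, x ≠ r →
    ∀ i j, ‖cutHess 0 (innerCut η) r x i j‖ ≤ C / ‖x - r‖ ^ 3 := by
  obtain ⟨C, hC, hb⟩ := exists_bound_deriv_innerCut
  refine ⟨5 * C + 3, by positivity, fun η hη r x h i j => ?_⟩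
  have hp := norm_pos_iff.2 (sub_ne_zero.2 h)
  obtain ⟨d1, d2⟩ := (hb η hη ‖x - r‖).2.2 hp
  have d0 := abs_innerCut_le η ‖x - r‖
  have h0 := norm_outProf_le 0 hp
  have h1 := norm_outProf₁_zero_le hp
  have h2 := norm_outProf₂_zero_le hp
  set ρ := ‖x - r‖
  refine (norm_radialHess_le _ _ _ _ _ _).trans ?_
  have n1 : ‖(deriv (innerCut η) ρ * outProf 0 ρ + innerCut η ρ * outProf₁ 0 ρ : ℂ)‖ ≤
      C / ρ * (1 / ρ) + 1 * (1 / ρ ^ 2) := by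
    refine (norm_add_le _ _).trans ?_
    rw [norm_mul, norm_mul, Complex.norm_real, Complex.norm_real, Real.norm_eq_abs,
      Real.norm_eq_abs]
    gcongr
  have n2 : ‖(deriv (deriv (innerCut η)) ρ * outProf 0 ρ + 2 * deriv (innerCut η) ρ * outProf₁ 0 ρ
      + innerCut η ρ * outProf₂ 0 ρ : ℂ)‖ ≤
      C / ρ ^ 2 * (1 / ρ) + 2 * (C / ρ) * (1 / ρ ^ 2) + 1 * (1 / ρ ^ 3) := by
    refine (norm_add_le _ _).trans ((add_le_add (norm_add_le _ _) le_rfl).trans ?_)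
    rw [norm_mul, norm_mul, norm_mul, norm_mul, Complex.norm_real, Complex.norm_real,
      Complex.norm_real, Real.norm_eq_abs, Real.norm_eq_abs, Real.norm_eq_abs, Complex.norm_ofNat]
    gcongr
  calc _ ≤ (C / ρ ^ 2 * (1 / ρ) + 2 * (C / ρ) * (1 / ρ ^ 2) + 1 * (1 / ρ ^ 3)) +
        2 * ((C / ρ * (1 / ρ) + 1 * (1 / ρ ^ 2)) / ρ) := by gcongr
    _ = _ := by field_simp; ring

/-- The smoothed Hessian of `g - g₀` is `O(ρ⁻²)` uniformly in the smoothing radius. -/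
lemma exists_bound_cutHess_sub (k M : ℝ) : ∃ C, 0 ≤ C ∧ ∀ η, 0 < η → ∀ r x : Space, x ≠ r →
    ‖x - r‖ ≤ M → ∀ i j, ‖(cutHess k (innerCut η) r x - cutHess 0 (innerCut η) r x) i j‖ ≤
      C / ‖x - r‖ ^ 2 := by
  obtain ⟨C, hC, hb⟩ := exists_bound_deriv_innerCut
  obtain ⟨c, hc, hbr⟩ := exists_bound_outProf_sub k M
  refine ⟨c * (C + 2 * C * |M| + |M| ^ 2) + 2 * (c * (C + |M|)), by positivity,
    fun η hη r x h hM i j => ?_⟩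
  have hp := norm_pos_iff.2 (sub_ne_zero.2 h)
  obtain ⟨d1, d2⟩ := (hb η hη ‖x - r‖).2.2 hp
  have d0 := abs_innerCut_le η ‖x - r‖
  obtain ⟨h0, h1, h2⟩ := hbr _ hp hM
  have hM' : ‖x - r‖ ≤ |M| := hM.trans (le_abs_self M)
  rw [cutHess, cutHess, ← radialHess_sub]
  set ρ := ‖x - r‖
  refine (norm_radialHess_le _ _ _ _ _ _).trans ?_
  have n1 : ‖(deriv (innerCut η) ρ * outProf k ρ + innerCut η ρ * outProf₁ k ρ -
      (deriv (innerCut η) ρ * outProf 0 ρ + innerCut η ρ * outProf₁ 0 ρ) : ℂ)‖ ≤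
      C / ρ * c + 1 * c := by
    have e : (deriv (innerCut η) ρ * outProf k ρ + innerCut η ρ * outProf₁ k ρ -
      (deriv (innerCut η) ρ * outProf 0 ρ + innerCut η ρ * outProf₁ 0 ρ) : ℂ) =
      deriv (innerCut η) ρ * (outProf k ρ - outProf 0 ρ) +
        innerCut η ρ * (outProf₁ k ρ - outProf₁ 0 ρ) := by ring
    rw [e]
    refine (norm_add_le _ _).trans ?_
    rw [norm_mul, norm_mul, Complex.norm_real, Complex.norm_real, Real.norm_eq_abs,
      Real.norm_eq_abs]
    gcongr
  have n2 : ‖(deriv (deriv (innerCut η)) ρ * outProf k ρ + 2 * deriv (innerCut η) ρ * outProf₁ k ρ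
      + innerCut η ρ * outProf₂ k ρ - (deriv (deriv (innerCut η)) ρ * outProf 0 ρ +
        2 * deriv (innerCut η) ρ * outProf₁ 0 ρ + innerCut η ρ * outProf₂ 0 ρ) : ℂ)‖ ≤
      C / ρ ^ 2 * c + 2 * (C / ρ) * c + 1 * c := by
    have e : (deriv (deriv (innerCut η)) ρ * outProf k ρ + 2 * deriv (innerCut η) ρ * outProf₁ k ρ
      + innerCut η ρ * outProf₂ k ρ - (deriv (deriv (innerCut η)) ρ * outProf 0 ρ +
        2 * deriv (innerCut η) ρ * outProf₁ 0 ρ + innerCut η ρ * outProf₂ 0 ρ) : ℂ) =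
      deriv (deriv (innerCut η)) ρ * (outProf k ρ - outProf 0 ρ) +
        2 * deriv (innerCut η) ρ * (outProf₁ k ρ - outProf₁ 0 ρ) +
        innerCut η ρ * (outProf₂ k ρ - outProf₂ 0 ρ) := by ring
    rw [e]
    refine (norm_add_le _ _).trans ((add_le_add (norm_add_le _ _) le_rfl).trans ?_)
    rw [norm_mul, norm_mul, norm_mul, norm_mul, Complex.norm_real, Complex.norm_real,
      Complex.norm_real, Real.norm_eq_abs, Real.norm_eq_abs, Real.norm_eq_abs, Complex.norm_ofNat]
    gcongr
  calc _ ≤ (C / ρ ^ 2 * c + 2 * (C / ρ) * c + 1 * c) + 2 * ((C / ρ * c + 1 * c) / ρ) := by gcongr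
    _ = (c * (C + 2 * C * ρ + ρ ^ 2) + 2 * (c * (C + ρ))) / ρ ^ 2 := by field_simp
    _ ≤ _ := by gcongr

lemma innerCut_eventuallyEq_one {η t : ℝ} (hη : 0 < η) (h : η < t) :
    innerCut η t = 1 ∧ deriv (innerCut η) t = 0 ∧ deriv (deriv (innerCut η)) t = 0 :=
  ⟨innerCut_of_ge hη h.le, deriv_innerCut_of_ge hη t h.le, deriv_deriv_innerCut_of_ge hη t h.le⟩

lemma cutG_innerCut_of_lt (k : ℝ) {η : ℝ} (hη : 0 < η) {r x : Space} (h : η < ‖x - r‖) :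
    cutG k (innerCut η) r x = g k r x := by
  rw [cutG, innerCut_of_ge hη h.le, g_eq, norm_sub_rev r x]; simp

lemma cutHess_innerCut_of_lt (k : ℝ) {η : ℝ} (hη : 0 < η) {r x : Space} (h : η < ‖x - r‖) :
    cutHess k (innerCut η) r x = hessG k r x := by
  have hx : x ≠ r := by rintro rfl; simp at h; linarith
  obtain ⟨h1, h2, h3⟩ := innerCut_eventuallyEq_one hη h
  rw [cutHess, h1, h2, h3, hessG_eq' k hx]
  simp

lemma hessG_zero (r x : Space) (h : x ≠ r) : hessG 0 r x = hessG₀ r x := by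
  rw [hessG_eq' 0 h, hessG₀_eq' h]

/-! ### Measurability of the kernels -/

lemma measurable_radialHess {a b : ℝ → ℂ} (ha : Measurable a) (hb : Measurable b) (r : Space)
    (i j : Fin 3) : Measurable fun x => radialHess (a ‖x - r‖) (b ‖x - r‖) r x i j := by
  have hd : ∀ i, Measurable fun x => (dir r x i : ℂ) := fun i => by
    unfold dir; fun_prop
  have hn : Measurable fun x : Space => ‖x - r‖ := by fun_prop
  have h1 := ha.comp hn
  have h2 := hb.comp hn
  simp only [Function.comp_def] at h1 h2
  have h3 := hd i
  have h4 := hd j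
  simp only [radialHess, Matrix.of_apply]
  fun_prop

lemma measurable_outProf (κ : ℝ) : Measurable (outProf κ) := by unfold outProf; fun_prop

lemma measurable_outProf₁ (κ : ℝ) : Measurable (outProf₁ κ) := by unfold outProf₁; fun_prop

lemma measurable_outProf₂ (κ : ℝ) : Measurable (outProf₂ κ) := by unfold outProf₂; fun_prop

lemma measurable_g (k : ℝ) (r : Space) : Measurable (fun x => g k r x) := by
  unfold g; fun_prop

lemma aestronglyMeasurable_of_eq_off {f h : Space → ℂ} (hh : Measurable h) {r : Space}
    (he : ∀ x, x ≠ r → f x = h x) (s : Measure Space) (hs : s ≪ volume) :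
    AEStronglyMeasurable f s :=
  ⟨h, hh.stronglyMeasurable, hs.ae_le ((ae_ne r).mono he)⟩

section Measurability

variable (k : ℝ) (r : Space) (V : Set Space) (i j : Fin 3)

lemma aesm_hessG₀ : AEStronglyMeasurable (fun x => hessG₀ r x i j) (volume.restrict V) :=
  aestronglyMeasurable_of_eq_off
    (measurable_radialHess (measurable_outProf₁ 0) (measurable_outProf₂ 0) r i j)
    (fun x hx => by rw [hessG₀_eq' hx]) _ Measure.restrict_le_self.absolutelyContinuous

lemma aesm_hessGReg : AEStronglyMeasurable (fun x => hessGReg k r x i j) (volume.restrict V) :=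
  aestronglyMeasurable_of_eq_off
    (measurable_radialHess ((measurable_outProf₁ k).sub (measurable_outProf₁ 0))
      ((measurable_outProf₂ k).sub (measurable_outProf₂ 0)) r i j)
    (fun x hx => by rw [hessGReg_eq' k hx]; rfl) _ Measure.restrict_le_self.absolutelyContinuous

lemma measurable_cutHess (κ η : ℝ) : Measurable fun x => cutHess κ (innerCut η) r x i j := by
  have c0 := (contDiff_innerCut η)
  have c1 := contDiff_deriv_of_smooth c0
  have c2 := contDiff_deriv_of_smooth c1
  have m0 := c0.continuous.measurable
  have m1 := c1.continuous.measurable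
  have m2 := c2.continuous.measurable
  have o0 := measurable_outProf κ
  have o1 := measurable_outProf₁ κ
  have o2 := measurable_outProf₂ κ
  exact measurable_radialHess (a := fun t => deriv (innerCut η) t * outProf κ t +
      innerCut η t * outProf₁ κ t)
    (b := fun t => deriv (deriv (innerCut η)) t * outProf κ t +
      2 * deriv (innerCut η) t * outProf₁ κ t + innerCut η t * outProf₂ κ t)
    (by fun_prop) (by fun_prop) r i j

lemma measurable_cutG (κ η : ℝ) : Measurable fun x => cutG κ (innerCut η) r x := by
  have m0 := (contDiff_innerCut η).continuous.measurable
  have o0 := measurable_outProf κ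
  unfold cutG
  fun_prop

end Measurability

/-! ### Dominated integrals of matrix kernels -/

lemma norm_mulVec_le (M : Dyadic) (v : CVec) {c : ℝ} (h : ∀ i j, ‖M i j‖ ≤ c) :
    ‖M *ᵥ v‖ ≤ 3 * (c * ‖v‖) := by
  have hc : 0 ≤ c := (norm_nonneg _).trans (h 0 0)
  rw [pi_norm_le_iff_of_nonneg (by positivity)]
  intro i
  change ‖∑ j, M i j * v j‖ ≤ _
  refine (norm_sum_le _ _).trans ?_
  refine (Finset.sum_le_sum fun j _ => ?_ : _ ≤ ∑ _j : Fin 3, c * ‖v‖).trans (by simp)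
  rw [norm_mul]
  exact mul_le_mul (h i j) (norm_le_pi_norm v j) (norm_nonneg _) hc

lemma aesm_mulVec {s : Measure Space} {M : Space → Dyadic} {Q : Space → CVec}
    (hM : ∀ i j, AEStronglyMeasurable (fun x => M x i j) s) (hQ : AEStronglyMeasurable Q s) :
    AEStronglyMeasurable (fun x => M x *ᵥ Q x) s := by
  have hQi : ∀ i, AEStronglyMeasurable (fun x => Q x i) s := fun i =>
    (continuous_apply i).comp_aestronglyMeasurable hQ
  refine AEMeasurable.aestronglyMeasurable (aemeasurable_pi_iff.2 fun i => ?_)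
  have : AEStronglyMeasurable (fun x => ∑ j, M x i j * Q x j) s :=
    Finset.aestronglyMeasurable_fun_sum _ fun j _ => (hM i j).mul (hQi j)
  exact this.aemeasurable

/-- A kernel of size `O(ρ⁻ˢ)` applied to an integrable field of size `O(ρ^γ)` near the pole is
dominated by an integrable function if `γ - s > -3`. -/
lemma exists_dominating {V : Set Space} {r : Space} {Q : Space → CVec}
    (hQ : IntegrableOn Q V) {δ B γ : ℝ} (hδ : 0 < δ)
    (hnear : ∀ x ∈ Metric.ball r δ, ‖Q x‖ ≤ B * ‖x - r‖ ^ γ) (s : ℕ) (hs : 0 < γ - s + 3)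
    {C : ℝ} (hC : 0 ≤ C) :
    ∃ h : Space → ℝ, IntegrableOn h V ∧
      ∀ x, x ≠ r → ∀ c, c ≤ C / ‖x - r‖ ^ s → 3 * (c * ‖Q x‖) ≤ h x := by
  set h₁ : Space → ℝ := (Metric.ball r δ).indicator fun x => ‖x - r‖ ^ (γ - s + 3 - 3)
  have hi₁ : Integrable h₁ :=
    (integrableOn_norm_sub_rpow hs r δ).integrable_indicator measurableSet_ball
  refine ⟨fun x => 3 * C * (|B| * h₁ x + 1 / δ ^ s * ‖Q x‖),
    ((hi₁.integrableOn.const_mul _).add (hQ.norm.const_mul _)).const_mul _, fun x hx c hc => ?_⟩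
  have hp := norm_pos_iff.2 (sub_ne_zero.2 hx)
  have h1 : c * ‖Q x‖ ≤ C / ‖x - r‖ ^ s * ‖Q x‖ := by gcongr
  have h0 : 0 ≤ h₁ x := Set.indicator_nonneg (fun x _ => Real.rpow_nonneg (norm_nonneg _) _) x
  suffices C / ‖x - r‖ ^ s * ‖Q x‖ ≤ C * (|B| * h₁ x + 1 / δ ^ s * ‖Q x‖) by
    linarith [h1.trans this]
  rw [div_mul_eq_mul_div, mul_div_assoc]
  gcongr
  by_cases hb : x ∈ Metric.ball r δ
  · have e : h₁ x = ‖x - r‖ ^ γ / ‖x - r‖ ^ s := by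
      simp only [h₁, Set.indicator_of_mem hb]
      rw [add_sub_cancel_right, Real.rpow_sub hp, Real.rpow_natCast]
    rw [e]
    have : ‖Q x‖ ≤ |B| * ‖x - r‖ ^ γ := (hnear x hb).trans (by gcongr; exact le_abs_self B)
    have h2 : ‖Q x‖ / ‖x - r‖ ^ s ≤ |B| * ‖x - r‖ ^ γ / ‖x - r‖ ^ s := by gcongr
    rw [mul_div_assoc] at h2
    have h3 : 0 ≤ 1 / δ ^ s * ‖Q x‖ := by positivity
    linarith
  · have : δ ≤ ‖x - r‖ := by simpa [dist_eq_norm] using hb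
    have h2 : ‖Q x‖ / ‖x - r‖ ^ s ≤ 1 / δ ^ s * ‖Q x‖ := by
      rw [one_div_mul_eq_div]; gcongr
    have h3 : 0 ≤ |B| * h₁ x := by positivity
    linarith

lemma integrableOn_mulVec {V : Set Space} {r : Space} {M : Space → Dyadic} {Q : Space → CVec}
    (hV : MeasurableSet V)
    (hM : ∀ i j, AEStronglyMeasurable (fun x => M x i j) (volume.restrict V))
    (hQ : AEStronglyMeasurable Q (volume.restrict V)) {h : Space → ℝ} (hh : IntegrableOn h V)
    {c : Space → ℝ} (hc : ∀ x ∈ V, x ≠ r → ∀ i j, ‖M x i j‖ ≤ c x)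
    (hb : ∀ x ∈ V, x ≠ r → 3 * (c x * ‖Q x‖) ≤ h x) :
    IntegrableOn (fun x => M x *ᵥ Q x) V := by
  refine Integrable.mono' hh (aesm_mulVec hM hQ) ((ae_restrict_iff' hV).2 ?_)
  filter_upwards [ae_ne r] with x hx hxV
  exact (norm_mulVec_le _ _ (hc x hxV hx)).trans (hb x hxV hx)

/-- Dominated convergence for kernels that are eventually equal to a limit kernel off the pole. -/
lemma tendsto_integral_mulVec {V : Set Space} {r : Space} {M : ℝ → Space → Dyadic}
    {M₀ : Space → Dyadic} {Q : Space → CVec} (hV : MeasurableSet V)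
    (hM : ∀ η i j, AEStronglyMeasurable (fun x => M η x i j) (volume.restrict V))
    (hQ : AEStronglyMeasurable Q (volume.restrict V)) {h : Space → ℝ} (hh : IntegrableOn h V)
    {c : Space → ℝ} (hc : ∀ η, 0 < η → ∀ x ∈ V, x ≠ r → ∀ i j, ‖M η x i j‖ ≤ c x)
    (hb : ∀ x ∈ V, x ≠ r → 3 * (c x * ‖Q x‖) ≤ h x)
    (hlim : ∀ η x, 0 < η → η < ‖x - r‖ → M η x = M₀ x) :
    Tendsto (fun η => ∫ x in V, M η x *ᵥ Q x) (𝓝[>] 0) (𝓝 (∫ x in V, M₀ x *ᵥ Q x)) := by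
  refine tendsto_integral_filter_of_dominated_convergence h
    (Eventually.of_forall fun η => aesm_mulVec (hM η) hQ) ?_ hh ?_
  · filter_upwards [self_mem_nhdsWithin] with η hη
    refine (ae_restrict_iff' hV).2 ?_
    filter_upwards [ae_ne r] with x hx hxV
    exact (norm_mulVec_le _ _ (hc η hη x hxV hx)).trans (hb x hxV hx)
  · refine ae_restrict_of_ae ?_
    filter_upwards [ae_ne r] with x hx
    have hp := norm_pos_iff.2 (sub_ne_zero.2 hx)
    refine tendsto_const_nhds.congr' ?_
    filter_upwards [self_mem_nhdsWithin, nhdsWithin_le_nhds (Iio_mem_nhds hp)] with η h1 h2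
    rw [hlim η x h1 h2]

/-! ### The representation with a smoothed Green's dyadic -/

/-- The dyadic Green's function smoothed near its pole. -/
def cutGE (k η : ℝ) (r x : Space) : Dyadic :=
  cutG k (innerCut η) r x • (1 : Dyadic) + (1 / (k : ℂ) ^ 2) • cutHess k (innerCut η) r x

lemma cutGE_of_lt (k : ℝ) {η : ℝ} (hη : 0 < η) {r x : Space} (h : η < ‖x - r‖) :
    cutGE k η r x = GE k r x := by
  rw [cutGE, cutG_innerCut_of_lt k hη h, cutHess_innerCut_of_lt k hη h, GE]

lemma measurable_cutGE (k η : ℝ) (r : Space) (i j : Fin 3) :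
    Measurable fun x => cutGE k η r x i j := by
  simp only [cutGE, Matrix.add_apply, Matrix.smul_apply, smul_eq_mul]
  exact ((measurable_cutG r k η).mul_const _).add ((measurable_cutHess r i j k η).const_mul _)

lemma cutHess_innerCut_of_le (k : ℝ) {η : ℝ} (hη : 0 < η) {r x : Space} (h : ‖x - r‖ ≤ η / 2) :
    cutHess k (innerCut η) r x = 0 := by
  rw [cutHess, innerCut_of_le hη h, deriv_innerCut_of_le hη _ h, deriv_deriv_innerCut_of_le hη _ h]
  ext i j
  simp [radialHess]

lemma exists_bound_cutHess_zero' {η : ℝ} (hη : 0 < η) (r : Space) : ∃ C, 0 ≤ C ∧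
    ∀ x, x ≠ r → ∀ i j, ‖cutHess 0 (innerCut η) r x i j‖ ≤ C := by
  obtain ⟨C, hC, hb⟩ := exists_bound_cutHess_zero
  refine ⟨C / (η / 2) ^ 3, by positivity, fun x hx i j => ?_⟩
  rcases le_or_gt ‖x - r‖ (η / 2) with h | h
  · rw [cutHess_innerCut_of_le 0 hη h]; simp; positivity
  · exact (hb η hη r x hx i j).trans (by gcongr)

lemma norm_cutG_le (k η : ℝ) {r x : Space} (hx : x ≠ r) :
    ‖cutG k (innerCut η) r x‖ ≤ 1 / ‖x - r‖ := by
  rw [cutG, norm_mul, Complex.norm_real]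
  have := norm_outProf_le k (norm_pos_iff.2 (sub_ne_zero.2 hx))
  exact (mul_le_of_le_one_left (norm_nonneg _) (abs_innerCut_le η _)).trans this

lemma norm_smul_one_le (z : ℂ) (i j : Fin 3) : ‖(z • (1 : Dyadic)) i j‖ ≤ ‖z‖ := by
  by_cases h : i = j <;> simp [h]

lemma exists_bound_cutGE (k : ℝ) {η : ℝ} (hη : 0 < η) (r : Space) (M : ℝ) : ∃ C, 0 ≤ C ∧
    ∀ x, x ≠ r → ‖x - r‖ ≤ M → ∀ i j, ‖cutGE k η r x i j‖ ≤ C := by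
  obtain ⟨C₀, hC₀, h₀⟩ := exists_bound_cutHess_zero' hη r
  obtain ⟨C₁, hC₁, h₁⟩ := exists_bound_cutHess_sub k M
  refine ⟨2 / η + ‖1 / (k : ℂ) ^ 2‖ * (C₁ / (η / 2) ^ 2 + C₀), by positivity,
    fun x hx hM i j => ?_⟩
  have e : cutGE k η r x i j = (cutG k (innerCut η) r x • (1 : Dyadic)) i j +
      1 / (k : ℂ) ^ 2 * ((cutHess k (innerCut η) r x - cutHess 0 (innerCut η) r x) i j +
        cutHess 0 (innerCut η) r x i j) := by
    simp [cutGE]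
  rcases le_or_gt ‖x - r‖ (η / 2) with h | h
  · have : cutGE k η r x i j = 0 := by
      rw [cutGE, cutHess_innerCut_of_le k hη h, cutG, innerCut_of_le hη h]; simp
    rw [this, norm_zero]; positivity
  · rw [e]
    refine (norm_add_le _ _).trans (add_le_add ?_ ?_)
    · refine (norm_smul_one_le _ i j).trans ((norm_cutG_le k η hx).trans ?_)
      rw [div_le_div_iff₀ (by linarith) hη]; linarith
    · rw [norm_mul]
      gcongr
      refine (norm_add_le _ _).trans (add_le_add ((h₁ η hη r x hx hM i j).trans ?_) (h₀ x hx i j))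
      gcongr

lemma integrable_cutGE_mulVec (k : ℝ) {η : ℝ} (hη : 0 < η) {r : Space} {M : ℝ}
    {Q : Space → CVec} (hQ : Integrable Q) (hQM : ∀ x, x ∉ Metric.ball r M → Q x = 0) :
    Integrable (fun x => cutGE k η r x *ᵥ Q x) := by
  obtain ⟨C, hC, hb⟩ := exists_bound_cutGE k hη r M
  have h : IntegrableOn (fun x => cutGE k η r x *ᵥ Q x) (Metric.ball r M) :=
    integrableOn_mulVec (r := r) (c := fun _ => C) (h := fun x => 3 * (C * ‖Q x‖))
      measurableSet_ball (fun i j => (measurable_cutGE k η r i j).aestronglyMeasurable)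
      hQ.aestronglyMeasurable.restrict ((hQ.norm.const_mul C).const_mul 3).integrableOn
      (fun x hx hxr i j => hb x hxr (by
        rw [Metric.mem_ball, dist_eq_norm] at hx; exact hx.le) i j)
      (fun x _ _ => le_rfl)
  refine (integrableOn_iff_integrable_of_support_subset fun x hx => ?_).1 h
  by_contra hh
  exact hx (by simp [hQM x hh])

lemma isRadiating_apply {k : ℝ} {E : Space → CVec} (hrad : IsRadiating k E) (j : Fin 3) :
    (∀ᶠ x in Bornology.cobounded Space, DifferentiableAt ℝ (fun x => E x j) x) ∧
      Tendsto (fun x : Space => ‖x‖ •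
        (fderiv ℝ (fun x => E x j) x (‖x‖⁻¹ • x) + (Complex.I * k) * E x j))
      (Bornology.cobounded Space) (𝓝 0) := by
  refine ⟨hrad.1.mono fun x hx => differentiableAt_pi.1 hx j, ?_⟩
  refine ((tendsto_pi_nhds.1 hrad.2) j).congr' ?_
  filter_upwards [hrad.1] with x hx
  have : fderiv ℝ (fun x => E x j) x = (ContinuousLinearMap.proj j).comp (fderiv ℝ E x) :=
    ((ContinuousLinearMap.proj (R := ℝ) (φ := fun _ : Fin 3 => ℂ) j).hasFDerivAt.comp x
      hx.hasFDerivAt).fderiv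
  rw [this]
  simp

/-- The wave equation tested with the columns of the Green's dyadic, smoothed near its pole; the
cut-off at infinity is removed by the radiation condition. -/
theorem integral_cutRes_eq {ω μ εL k : ℝ} (hω : 0 < ω) (hμ : 0 < μ)
    (hk : 0 < k) (hk2 : k ^ 2 = ω ^ 2 * εL * μ) {Δε : Space → ℂ} {Je E : Space → CVec}
    (hJe : Integrable Je) (hE : LocallyIntegrable E) (hΔεE : Integrable (fun x => Δε x • E x))
    (hwave : IsWeakWaveSolution ω μ (fun x => (εL : ℂ) + Δε x) Je E) (hrad : IsRadiating k E)
    {r : Space} {M η : ℝ} (hη : 0 < η)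
    (hM : ∀ x, x ∉ Metric.ball r M → source ω μ Je (fun x => Δε x • E x) x = 0) (j : Fin 3) :
    ∫ x, E x j * cutRes k (innerCut η) r x =
      -∫ x, (cutGE k η r x *ᵥ source ω μ Je (fun x => Δε x • E x) x) j := by
  set src := source ω μ Je (fun x => Δε x • E x) with hsrc
  have hsi : Integrable src :=
    (hJe.smul (-Complex.I * ω * μ : ℂ)).add (hΔεE.smul ((ω : ℂ) ^ 2 * μ))
  have hEj : LocallyIntegrable (fun x => E x j) := by
    intro x
    obtain ⟨s, hs, h⟩ := hE x
    exact ⟨s, hs, h.eval j⟩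
  obtain ⟨hd, ht⟩ := isRadiating_apply hrad j
  -- the outer residual tends to `0`, and nothing else depends on the outer cut-off radius
  have hlim := tendsto_integral_cutRes_outerCut hk r hEj hd ht
  have hev : ∀ᶠ R in atTop, ∫ x, E x j * cutRes k (outerCut k R) r x =
      -(∫ x, (cutGE k η r x *ᵥ src x) j) - ∫ x, E x j * cutRes k (innerCut η) r x := by
    filter_upwards [eventually_ge_atTop η, eventually_ge_atTop M] with R hR hRM
    have hRp : 0 < R := hη.trans_le hR
    have hS := contDiff_annCut k η R
    have hζ := contDiff_cutG_annCut k hk hη hR r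
    have hζc := hasCompactSupport_cutG_annCut k hk hη hR r
    have hweak := weak_helmholtz hω hμ hk hk2 hJe hE hΔεE hwave hζ hζc j
    rw [← hsrc] at hweak
    have mulI : ∀ {h : Space → ℂ}, ContDiff ℝ (⊤ : ℕ∞) h → HasCompactSupport h →
        Integrable (fun x => E x j * h x) := fun h1 h2 =>
      LocallyIntegrable.integrable_mul_test hE h1.continuous h2 j
    have e1 : ∫ x, E x j * (∑ i, hess (cutG k (annCut k η R) r) x i i +
        (k : ℂ) ^ 2 * cutG k (annCut k η R) r x) =
        (∫ x, E x j * cutRes k (innerCut η) r x) +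
          ∫ x, E x j * cutRes k (outerCut k R) r x := by
      rw [← integral_add (mulI (contDiff_cutRes_innerCut k hη r)
          (hasCompactSupport_cutRes_innerCut k hη r))
        (mulI (contDiff_cutRes_outerCut hk hRp r) (hasCompactSupport_cutRes_outerCut hk r))]
      refine integral_congr_ae ?_
      filter_upwards [ae_ne r] with x hx
      rw [laplacian_cutG k hS hx, ← mul_add, ← cutRes_annCut]
      rfl
    have e2 : (∫ x, src x j * cutG k (annCut k η R) r x) + 1 / (k : ℂ) ^ 2 *
        ∫ x, ∑ i, src x i * hess (cutG k (annCut k η R) r) x i j =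
        ∫ x, (cutGE k η r x *ᵥ src x) j := by
      rw [← integral_const_mul, ← integral_add
        (LocallyIntegrable.integrable_mul_test hsi.locallyIntegrable hζ.continuous hζc j)
        ((integrable_finsetSum _ fun i _ => LocallyIntegrable.integrable_mul_test
          hsi.locallyIntegrable (contDiff_hess hζ i j).continuous
          (hasCompactSupport_hess hζc i j) i).const_mul _)]
      refine integral_congr_ae ?_
      filter_upwards [ae_ne r] with x hx
      by_cases hxM : x ∈ Metric.ball r M
      · rw [Metric.mem_ball, dist_eq_norm] at hxM
        have hxR : ‖x - r‖ ≤ R := by linarith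
        rw [hess_cutG k hS hx, cutHess_annCut k hk hxR, cutG_annCut k hk hxR, cutGE,
          Matrix.add_mulVec, Matrix.smul_mulVec, Matrix.smul_mulVec, Matrix.one_mulVec]
        simp only [Pi.add_apply, Pi.smul_apply, smul_eq_mul, Matrix.mulVec, dotProduct]
        congr 1
        · ring
        · congr 1
          refine Finset.sum_congr rfl fun i _ => ?_
          rw [cutHess, radialHess_comm, mul_comm]
      · simp [hM x hxM]
    rw [e1] at hweak
    rw [← e2]
    linear_combination hweak
  have h0 := tendsto_nhds_unique (hlim.congr' hev) tendsto_const_nhds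
  linear_combination h0

/-! ### The limit of vanishing smoothing radius -/

lemma exists_near_bounds {P : Space → CVec} {r : Space} {U : Set Space} (hU : U ∈ 𝓝 r) {K α : ℝ≥0}
    (hα : 0 < α) (h : HolderOnWith K α P U) : ∃ δ, 0 < δ ∧ ∃ B,
      (∀ x ∈ Metric.ball r δ, ‖P x‖ ≤ B * ‖x - r‖ ^ (0 : ℝ)) ∧
      ∀ x ∈ Metric.ball r δ, ‖P x - P r‖ ≤ K * ‖x - r‖ ^ (α : ℝ) := by
  obtain ⟨δ, hδ, hδU⟩ := Metric.mem_nhds_iff.1 hU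
  have hd : ∀ x ∈ Metric.ball r δ, ‖P x - P r‖ ≤ K * ‖x - r‖ ^ (α : ℝ) := fun x hx => by
    have := h.edist_le (hδU hx) (hδU (Metric.mem_ball_self hδ))
    rw [← dist_eq_norm, ← dist_eq_norm]
    rw [edist_nndist, edist_nndist, ← ENNReal.coe_rpow_of_nonneg _ α.coe_nonneg,
      ← ENNReal.coe_mul, ENNReal.coe_le_coe] at this
    exact_mod_cast this
  refine ⟨δ, hδ, ‖P r‖ + K * δ ^ (α : ℝ), fun x hx => ?_, hd⟩
  rw [Real.rpow_zero, mul_one]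
  have h1 : ‖P x‖ ≤ ‖P r‖ + ‖P x - P r‖ := by
    simpa using norm_add_le (P r) (P x - P r)
  refine h1.trans (add_le_add le_rfl ((hd x hx).trans ?_))
  rw [Metric.mem_ball, dist_eq_norm] at hx
  gcongr

/-- A family of kernels of size `O(ρ⁻ˢ)`, uniformly in the smoothing radius, applied to a field of
size `O(ρ^γ)` with `γ - s > -3`. -/
lemma weaklySingular_limit {V : Set Space} {r : Space} {M : ℝ → Space → Dyadic}
    {M₀ : Space → Dyadic} {Q : Space → CVec} (hV : MeasurableSet V) (hQ : IntegrableOn Q V)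
    {δ B γ : ℝ} (hδ : 0 < δ) (hnear : ∀ x ∈ Metric.ball r δ, ‖Q x‖ ≤ B * ‖x - r‖ ^ γ)
    (s : ℕ) (hs : 0 < γ - s + 3) {C : ℝ} (hC : 0 ≤ C)
    (hM : ∀ η i j, AEStronglyMeasurable (fun x => M η x i j) (volume.restrict V))
    (hM₀ : ∀ i j, AEStronglyMeasurable (fun x => M₀ x i j) (volume.restrict V))
    (hc : ∀ η, 0 < η → ∀ x ∈ V, x ≠ r → ∀ i j, ‖M η x i j‖ ≤ C / ‖x - r‖ ^ s)
    (hlim : ∀ η x, 0 < η → η < ‖x - r‖ → M η x = M₀ x) :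
    IntegrableOn (fun x => M₀ x *ᵥ Q x) V ∧
    (∀ η, 0 < η → IntegrableOn (fun x => M η x *ᵥ Q x) V) ∧
    Tendsto (fun η => ∫ x in V, M η x *ᵥ Q x) (𝓝[>] 0) (𝓝 (∫ x in V, M₀ x *ᵥ Q x)) := by
  obtain ⟨h, hh, hb⟩ := exists_dominating hQ hδ hnear s hs hC
  have hb' : ∀ x ∈ V, x ≠ r → 3 * (C / ‖x - r‖ ^ s * ‖Q x‖) ≤ h x := fun x _ hx =>
    hb x hx _ le_rfl
  refine ⟨integrableOn_mulVec hV hM₀ hQ.aestronglyMeasurable hh (fun x hxV hx i j => ?_) hb',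
    fun η hη => integrableOn_mulVec hV (hM η) hQ.aestronglyMeasurable hh (hc η hη) hb',
    tendsto_integral_mulVec hV hM hQ.aestronglyMeasurable hh hc hb' hlim⟩
  have hp := norm_pos_iff.2 (sub_ne_zero.2 hx)
  rw [← hlim _ x (half_pos hp) (half_lt_self hp)]
  exact hc _ (half_pos hp) x hxV hx i j

lemma limit_cutG {V : Set Space} {r : Space} {P : Space → CVec} {δ B : ℝ} (k : ℝ)
    (hV : MeasurableSet V) (hP : Integrable P) (hδ : 0 < δ)
    (hB : ∀ x ∈ Metric.ball r δ, ‖P x‖ ≤ B * ‖x - r‖ ^ (0 : ℝ)) :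
    IntegrableOn (fun x => (g k r x • (1 : Dyadic)) *ᵥ P x) V ∧
    (∀ η, 0 < η → IntegrableOn (fun x => (cutG k (innerCut η) r x • (1 : Dyadic)) *ᵥ P x) V) ∧
    Tendsto (fun η => ∫ x in V, (cutG k (innerCut η) r x • (1 : Dyadic)) *ᵥ P x) (𝓝[>] 0)
      (𝓝 (∫ x in V, (g k r x • (1 : Dyadic)) *ᵥ P x)) :=
  weaklySingular_limit hV hP.integrableOn hδ hB 1 (by norm_num) zero_le_one
    (fun η i j => ((measurable_cutG r k η).mul_const _).aestronglyMeasurable)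
    (fun i j => ((measurable_g k r).mul_const _).aestronglyMeasurable)
    (fun η _ x _ hx i j => (norm_smul_one_le _ i j).trans (by
      rw [pow_one]; exact norm_cutG_le k η hx))
    (fun η x hη hx => by rw [cutG_innerCut_of_lt k hη hx])

lemma limit_cutHess_sub {V : Set Space} {r : Space} {P : Space → CVec} {δ B : ℝ} (k : ℝ)
    (hV : MeasurableSet V) (hP : Integrable P) (hδ : 0 < δ)
    (hVb : Bornology.IsBounded V)
    (hB : ∀ x ∈ Metric.ball r δ, ‖P x‖ ≤ B * ‖x - r‖ ^ (0 : ℝ)) :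
    IntegrableOn (fun x => hessGReg k r x *ᵥ P x) V ∧
    (∀ η, 0 < η → IntegrableOn (fun x =>
      (cutHess k (innerCut η) r x - cutHess 0 (innerCut η) r x) *ᵥ P x) V) ∧
    Tendsto (fun η => ∫ x in V,
      (cutHess k (innerCut η) r x - cutHess 0 (innerCut η) r x) *ᵥ P x) (𝓝[>] 0)
      (𝓝 (∫ x in V, hessGReg k r x *ᵥ P x)) := by
  obtain ⟨M, hM⟩ := hVb.subset_ball r
  obtain ⟨C, hC, hb⟩ := exists_bound_cutHess_sub k M
  refine weaklySingular_limit hV hP.integrableOn hδ hB 2 (by norm_num) hC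
    (fun η i j => ((measurable_cutHess r i j k η).sub
      (measurable_cutHess r i j 0 η)).aestronglyMeasurable)
    (fun i j => aesm_hessGReg k r V i j)
    (fun η hη x hxV hx i j => hb η hη r x hx ?_ i j) (fun η x hη hx => ?_)
  · have := hM hxV
    rw [Metric.mem_ball, dist_eq_norm] at this
    exact this.le
  · have hxr : x ≠ r := by rintro rfl; simp at hx; linarith
    rw [cutHess_innerCut_of_lt k hη hx, cutHess_innerCut_of_lt 0 hη hx, hessG_zero r x hxr,
      hessG_eq_add k hxr, add_sub_cancel_left]

lemma limit_cutHess_zero {V : Set Space} {r : Space} {P : Space → CVec} {δ : ℝ}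
    (hV : MeasurableSet V) (hP : Integrable P) (hδ : 0 < δ)
    {K α : ℝ≥0} (hα : 0 < α) (hVb : Bornology.IsBounded V)
    (hK : ∀ x ∈ Metric.ball r δ, ‖P x - P r‖ ≤ K * ‖x - r‖ ^ (α : ℝ)) :
    IntegrableOn (fun x => hessG₀ r x *ᵥ (P x - P r)) V ∧
    (∀ η, 0 < η → IntegrableOn (fun x => cutHess 0 (innerCut η) r x *ᵥ (P x - P r)) V) ∧
    Tendsto (fun η => ∫ x in V, cutHess 0 (innerCut η) r x *ᵥ (P x - P r)) (𝓝[>] 0)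
      (𝓝 (∫ x in V, hessG₀ r x *ᵥ (P x - P r))) := by
  obtain ⟨C, hC, hb⟩ := exists_bound_cutHess_zero
  have hα' : (0 : ℝ) < α := hα
  refine weaklySingular_limit hV
    (hP.integrableOn.sub (integrableOn_const hVb.measure_lt_top.ne)) hδ hK 3
    (by push_cast; linarith) hC
    (fun η i j => (measurable_cutHess r i j 0 η).aestronglyMeasurable)
    (fun i j => aesm_hessG₀ r V i j)
    (fun η hη x _ hx i j => hb η hη r x hx i j) (fun η x hη hx => ?_)
  have hxr : x ≠ r := by rintro rfl; simp at hx; linarith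
  rw [cutHess_innerCut_of_lt 0 hη hx, hessG_zero r x hxr]

lemma integrableOn_cutHess_zero {V : Set Space}
    (hVb : Bornology.IsBounded V) {η : ℝ} (hη : 0 < η) (r : Space) (i j : Fin 3) :
    IntegrableOn (fun x => cutHess 0 (innerCut η) r x i j) V := by
  obtain ⟨C, hC, hb⟩ := exists_bound_cutHess_zero' hη r
  refine Integrable.mono' (g := fun _ => C) (integrableOn_const hVb.measure_lt_top.ne)
    (measurable_cutHess r i j 0 η).aestronglyMeasurable ?_
  exact ae_restrict_of_ae ((ae_ne r).mono fun x hx => hb x hx i j)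

lemma integral_mulVec_const {V : Set Space} {M : Space → Dyadic}
    (hM : ∀ i j, IntegrableOn (fun x => M x i j) V) (v : CVec) :
    IntegrableOn (fun x => M x *ᵥ v) V ∧
    ∫ x in V, M x *ᵥ v = (Matrix.of fun i j => ∫ x in V, M x i j) *ᵥ v := by
  have h : ∀ i, IntegrableOn (fun x => ∑ j, M x i j * v j) V := fun i =>
    integrable_finsetSum _ fun j _ => (hM i j).mul_const _
  have hI : IntegrableOn (fun x => M x *ᵥ v) V := Integrable.of_eval h
  refine ⟨hI, funext fun i => ?_⟩
  rw [eval_integral fun i => hI.eval i]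
  change ∫ x in V, ∑ j, M x i j * v j = ∑ j, (∫ x in V, M x i j) * v j
  rw [integral_finsetSum _ fun j _ => (hM i j).mul_const _]
  exact Finset.sum_congr rfl fun j _ => integral_mul_const _ _

/-- The splitting of the smoothed Green's dyadic over the exclusion volume. The Hessian of the
static kernel, applied to the constant value of the field at the pole, gives the dyadic of the exclusion
volume and so does not depend on the smoothing radius. -/
lemma integral_cutGE_mulVec {k : ℝ} {V : Set Space} {r : Space} {P : Space → CVec} {δ B : ℝ}
    (hV : MeasurableSet V) (hVb : Bornology.IsBounded V) (hP : Integrable P) (hδ : 0 < δ)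
    (hB : ∀ x ∈ Metric.ball r δ, ‖P x‖ ≤ B * ‖x - r‖ ^ (0 : ℝ)) {K α : ℝ≥0} (hα : 0 < α)
    (hK : ∀ x ∈ Metric.ball r δ, ‖P x - P r‖ ≤ K * ‖x - r‖ ^ (α : ℝ)) {η R : ℝ} (hη : 0 < η)
    (hR : η ≤ R) (hVη : Metric.ball r (2 * η) ⊆ V) (hVR : V ⊆ Metric.ball r (R - η)) :
    ∫ x in V, cutGE k η r x *ᵥ P x =
      (∫ x in V, (cutG k (innerCut η) r x • (1 : Dyadic)) *ᵥ P x) +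
      (1 / (k : ℂ) ^ 2) • ((∫ x in V,
        (cutHess k (innerCut η) r x - cutHess 0 (innerCut η) r x) *ᵥ P x) +
        (∫ x in V, cutHess 0 (innerCut η) r x *ᵥ (P x - P r)) - LDyadic V r *ᵥ P r) := by
  have i1 := (limit_cutG k hV hP hδ hB).2.1 η hη
  have i2 := (limit_cutHess_sub k hV hP hδ hVb hB).2.1 η hη
  have i3 := (limit_cutHess_zero hV hP hδ hα hVb hK).2.1 η hη
  obtain ⟨i4, e4⟩ := integral_mulVec_const (fun i j => integrableOn_cutHess_zero hVb hη r i j)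
    (P r)
  have hL : LDyadic V r = -Matrix.of fun i j => ∫ x in V, cutHess 0 (innerCut η) r x i j := by
    ext i j
    rw [LDyadic_eq hV hη hR hVη hVR i j]
    rfl
  have i23 : IntegrableOn (fun x =>
      (cutHess k (innerCut η) r x - cutHess 0 (innerCut η) r x) *ᵥ P x +
        cutHess 0 (innerCut η) r x *ᵥ (P x - P r)) V := i2.add i3
  have i234 : IntegrableOn (fun x =>
      (cutHess k (innerCut η) r x - cutHess 0 (innerCut η) r x) *ᵥ P x +
        cutHess 0 (innerCut η) r x *ᵥ (P x - P r) + cutHess 0 (innerCut η) r x *ᵥ P r) V :=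
    i23.add i4
  rw [hL, Matrix.neg_mulVec, sub_neg_eq_add, ← e4, ← integral_add i2 i3,
    ← integral_add i23 i4, ← integral_smul,
    ← integral_add i1 (i234.integrable.fun_smul (1 / (k : ℂ) ^ 2))]
  refine integral_congr_ae (Eventually.of_forall fun x => ?_)
  simp only [cutGE, Matrix.add_mulVec, Matrix.sub_mulVec, Matrix.mulVec_sub, Matrix.smul_mulVec]
  congr 2
  abel

/-- The volume integral equation before the coefficients are collected: the residual of the smoothed
equation reproduces the field at the pole, and every other term converges. -/
theorem field_eq {ω μ εL k : ℝ} (hω : 0 < ω) (hμ : 0 < μ)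
    (hk : 0 < k) (hk2 : k ^ 2 = ω ^ 2 * εL * μ) {Ω : Set Space} (hΩm : MeasurableSet Ω)
    (hΩb : Bornology.IsBounded Ω) {Δε : Space → ℂ} (hΔε : ∀ x, x ∉ Ω → Δε x = 0)
    {Je E : Space → CVec} (hJe : Integrable Je) (hJec : HasCompactSupport Je)
    (hJeΩ : Disjoint (tsupport Je) Ω) (hE : LocallyIntegrable E)
    (hΔεE : Integrable (fun x => Δε x • E x))
    (hwave : IsWeakWaveSolution ω μ (fun x => (εL : ℂ) + Δε x) Je E) (hrad : IsRadiating k E)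
    {r : Space} (hEr : ContinuousAt E r) {δ B : ℝ} (hδ : 0 < δ)
    (hB : ∀ x ∈ Metric.ball r δ, ‖Δε x • E x‖ ≤ B * ‖x - r‖ ^ (0 : ℝ)) {K α : ℝ≥0} (hα : 0 < α)
    (hK : ∀ x ∈ Metric.ball r δ, ‖Δε x • E x - Δε r • E r‖ ≤ K * ‖x - r‖ ^ (α : ℝ))
    {V : Set Space} (hV : MeasurableSet V) (hVn : V ∈ 𝓝 r) (hVΩ : V ⊆ Ω) :
    Integrable (fun x => GE k r x *ᵥ Je x) ∧
    IntegrableOn (fun x => GE k r x *ᵥ (Δε x • E x)) (Ω \ V) ∧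
    E r = (-Complex.I * ω * μ) • (∫ x, GE k r x *ᵥ Je x) +
      ((ω : ℂ) ^ 2 * μ) • ((∫ x in Ω \ V, GE k r x *ᵥ (Δε x • E x)) +
        ((∫ x in V, (g k r x • (1 : Dyadic)) *ᵥ (Δε x • E x)) +
        (1 / (k : ℂ) ^ 2) • ((∫ x in V, hessGReg k r x *ᵥ (Δε x • E x)) +
          (∫ x in V, hessG₀ r x *ᵥ (Δε x • E x - Δε r • E r)) -
          LDyadic V r *ᵥ (Δε r • E r)))) := by
  set P : Space → CVec := fun x => Δε x • E x with hPdef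
  have hVb : Bornology.IsBounded V := hΩb.subset hVΩ
  have hPΩ : ∀ x, x ∉ Ω → P x = 0 := fun x hx => by simp [hPdef, hΔε x hx]
  have hJV : ∀ x ∈ V, Je x = 0 := fun x hx => by
    by_contra h
    exact Set.disjoint_left.1 hJeΩ (subset_tsupport _ h) (hVΩ hx)
  obtain ⟨M, hM⟩ := (hJec.isCompact.isBounded.union hΩb).subset_ball r
  have hMJ : ∀ x, x ∉ Metric.ball r M → Je x = 0 := fun x hx => by
    by_contra h
    exact hx (hM (Or.inl (subset_tsupport _ h)))
  have hMP : ∀ x, x ∉ Metric.ball r M → P x = 0 := fun x hx =>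
    hPΩ x fun h => hx (hM (Or.inr h))
  obtain ⟨η₀, hη₀, R, hηR⟩ := exists_exclusion_radii hVn hVb
  -- outside `V` the smoothing has no effect
  have hfar : ∀ η, 0 < η → η ≤ η₀ → ∀ x, x ∉ V → cutGE k η r x = GE k r x := by
    intro η hη hη' x hx
    refine cutGE_of_lt k hη ?_
    by_contra h
    refine hx ((hηR η hη hη' R le_rfl).2.1 ?_)
    rw [Metric.mem_ball, dist_eq_norm]
    linarith
  have eJ : ∀ η, 0 < η → η ≤ η₀ →
      (fun x => cutGE k η r x *ᵥ Je x) = fun x => GE k r x *ᵥ Je x := fun η hη hη' => by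
    funext x
    by_cases hx : x ∈ V
    · simp [hJV x hx]
    · rw [hfar η hη hη' x hx]
  have iJ := fun η hη => integrable_cutGE_mulVec k (η := η) hη hJe hMJ
  have iP := fun η hη => integrable_cutGE_mulVec k (η := η) hη hΔεE hMP
  have eP : ∀ η, 0 < η → η ≤ η₀ →
      Set.EqOn (fun x => cutGE k η r x *ᵥ P x) (fun x => GE k r x *ᵥ P x) (Ω \ V) :=
    fun η hη hη' x hx => by simp only [hfar η hη hη' x hx.2]
  refine ⟨eJ η₀ hη₀ le_rfl ▸ iJ η₀ hη₀, ((iP η₀ hη₀).integrableOn).congr_fun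
    (eP η₀ hη₀ le_rfl) (hΩm.diff hV), ?_⟩
  have hsplit : ∀ η, 0 < η → η ≤ η₀ → ∫ x, cutGE k η r x *ᵥ source ω μ Je P x =
      (-Complex.I * ω * μ) • (∫ x, GE k r x *ᵥ Je x) +
      ((ω : ℂ) ^ 2 * μ) • ((∫ x in Ω \ V, GE k r x *ᵥ P x) +
      ((∫ x in V, (cutG k (innerCut η) r x • (1 : Dyadic)) *ᵥ P x) +
      (1 / (k : ℂ) ^ 2) • ((∫ x in V,
        (cutHess k (innerCut η) r x - cutHess 0 (innerCut η) r x) *ᵥ P x) +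
        (∫ x in V, cutHess 0 (innerCut η) r x *ᵥ (P x - P r)) - LDyadic V r *ᵥ P r))) := by
    intro η hη hη'
    obtain ⟨hR, hVη, hVR⟩ := hηR η hη hη' R le_rfl
    have iJ' : Integrable (fun x => (-Complex.I * ω * μ) • (cutGE k η r x *ᵥ Je x)) :=
      (iJ η hη).smul (-Complex.I * ω * μ : ℂ)
    have iP' : Integrable (fun x => ((ω : ℂ) ^ 2 * μ) • (cutGE k η r x *ᵥ P x)) :=
      (iP η hη).smul ((ω : ℂ) ^ 2 * μ)
    rw [← integral_cutGE_mulVec hV hVb hΔεE hδ hB hα hK hη hR hVη hVR, ← eJ η hη hη',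
      ← setIntegral_congr_fun (hΩm.diff hV) (eP η hη hη'),
      ← setIntegral_eq_of_subset_of_forall_sdiff_eq_zero hV.compl
        (fun x hx => hx.2 : Ω \ V ⊆ Vᶜ) (fun x hx => by
          simp [hPΩ x fun h => hx.2 ⟨h, hx.1⟩]),
      add_comm (∫ x in Vᶜ, _), integral_add_compl hV (iP η hη), ← integral_smul, ← integral_smul,
      ← integral_add iJ' iP']
    refine integral_congr_ae (Eventually.of_forall fun x => ?_)
    simp only [source, Matrix.mulVec_add, Matrix.mulVec_smul, hPdef]
  have hlim := ((((limit_cutG k hV hΔεE hδ hB).2.2.add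
    (((limit_cutHess_sub k hV hΔεE hδ hVb hB).2.2.add
      (limit_cutHess_zero hV hΔεE hδ hα hVb hK).2.2).sub_const
        (LDyadic V r *ᵥ P r) |>.const_smul (1 / (k : ℂ) ^ 2))).const_add
      (∫ x in Ω \ V, GE k r x *ᵥ P x)).const_smul ((ω : ℂ) ^ 2 * μ)).const_add
      ((-Complex.I * ω * μ) • (∫ x, GE k r x *ᵥ Je x))
  refine tendsto_nhds_unique (tendsto_pi_nhds.2 fun j => ?_) hlim
  have hEj : LocallyIntegrable (fun x => E x j) := fun x => by
    obtain ⟨s, hs, h⟩ := hE x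
    exact ⟨s, hs, h.eval j⟩
  have hres := (tendsto_integral_cutRes_innerCut k hEj
    ((continuous_apply j).continuousAt.comp hEr)).neg
  rw [neg_neg] at hres
  refine hres.congr' ?_
  filter_upwards [Ioc_mem_nhdsGT hη₀] with η hη
  have hsrc : Integrable (fun x => cutGE k η r x *ᵥ source ω μ Je P x) :=
    integrable_cutGE_mulVec k hη.1
      (Q := source ω μ Je P)
      ((hJe.smul (-Complex.I * ω * μ : ℂ)).add (hΔεE.smul ((ω : ℂ) ^ 2 * μ)))
      (fun x hx => by rw [source, hMJ x hx, hMP x hx]; simp)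
  rw [integral_cutRes_eq hω hμ hk hk2 hJe hE hΔεE hwave hrad hη.1
    (fun x hx => by
      have : Δε x • E x = 0 := hMP x hx
      rw [source, hMJ x hx, this]; simp) j, neg_neg,
    ← eval_integral fun i => hsrc.eval i]
  exact congrFun (hsplit η hη.1 hη.2) j

/-! ### Order of the singularities at the pole -/

section Singularities

variable {r : Space} {δ B : ℝ} {P : Space → CVec} (k : ℝ)

lemma isBigO_g_smul (hδ : 0 < δ)
    (hB : ∀ x ∈ Metric.ball r δ, ‖P x‖ ≤ B * ‖x - r‖ ^ (0 : ℝ)) :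
    (fun x => g k r x • P x) =O[𝓝[≠] r] (fun x => ‖x - r‖⁻¹) := by
  refine IsBigO.of_bound B ?_
  filter_upwards [self_mem_nhdsWithin, mem_nhdsWithin_of_mem_nhds (Metric.ball_mem_nhds r hδ)]
    with x hx hxδ
  have h1 := hB x hxδ
  rw [Real.rpow_zero, mul_one] at h1
  rw [norm_smul, norm_inv, norm_norm, mul_comm B, ← one_div]
  exact mul_le_mul (norm_g_le k hx) h1 (norm_nonneg _) (by positivity)

lemma isBigO_hessGReg_mulVec (hδ : 0 < δ)
    (hB : ∀ x ∈ Metric.ball r δ, ‖P x‖ ≤ B * ‖x - r‖ ^ (0 : ℝ)) :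
    (fun x => hessGReg k r x *ᵥ P x) =O[𝓝[≠] r] (fun x => ‖x - r‖⁻¹) := by
  obtain ⟨C, hC, hb⟩ := exists_bound_hessGReg k δ
  refine IsBigO.of_bound (3 * (C * B)) ?_
  filter_upwards [self_mem_nhdsWithin, mem_nhdsWithin_of_mem_nhds (Metric.ball_mem_nhds r hδ)]
    with x hx hxδ
  have h1 := hB x hxδ
  rw [Real.rpow_zero, mul_one] at h1
  have hd : ‖x - r‖ ≤ δ := by
    rw [Metric.mem_ball, dist_eq_norm] at hxδ
    exact hxδ.le
  refine (norm_mulVec_le _ _ (hb r x hx hd)).trans ?_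
  rw [norm_inv, norm_norm]
  calc 3 * (C / ‖x - r‖ * ‖P x‖) ≤ 3 * (C / ‖x - r‖ * B) := by gcongr
    _ = _ := by ring

lemma isBigO_hessG₀_mulVec {K α : ℝ≥0} (hδ : 0 < δ)
    (hK : ∀ x ∈ Metric.ball r δ, ‖P x - P r‖ ≤ K * ‖x - r‖ ^ (α : ℝ)) :
    (fun x => hessG₀ r x *ᵥ (P x - P r)) =O[𝓝[≠] r] (fun x => ‖x - r‖ ^ ((α : ℝ) - 3)) := by
  refine IsBigO.of_bound (3 * (3 * K)) ?_
  filter_upwards [self_mem_nhdsWithin, mem_nhdsWithin_of_mem_nhds (Metric.ball_mem_nhds r hδ)]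
    with x hx hxδ
  have hp : 0 < ‖x - r‖ := norm_pos_iff.2 (sub_ne_zero.2 hx)
  refine (norm_mulVec_le _ _ (norm_hessG₀_le hx)).trans ?_
  rw [Real.norm_of_nonneg (by positivity), Real.rpow_sub hp]
  calc 3 * (3 / ‖x - r‖ ^ 3 * ‖P x - P r‖) ≤
      3 * (3 / ‖x - r‖ ^ 3 * (K * ‖x - r‖ ^ (α : ℝ))) := by gcongr; exact hK x hxδ
    _ = _ := by
      rw [show ‖x - r‖ ^ (3 : ℝ) = ‖x - r‖ ^ 3 by exact_mod_cast Real.rpow_natCast ‖x - r‖ 3]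
      ring

end Singularities

end VIE

end

theorem mainTheorem1
    -- homogeneous background medium, frequency and wave number
    (ω μ εL k : ℝ) (hω : 0 < ω) (hμ : 0 < μ) (hεL : 0 < εL)
    (hk : 0 < k) (hk2 : k ^ 2 = ω ^ 2 * εL * μ)
    -- the scatterer and its dielectric contrast
    (Ω : Set VIE.Space) (hΩm : MeasurableSet Ω) (hΩb : Bornology.IsBounded Ω)
    (Δε : VIE.Space → ℂ) (hΔε : ∀ x, x ∉ Ω → Δε x = 0)
    -- the source, away from the scatterer
    (Je : VIE.Space → VIE.CVec) (hJe : Integrable Je) (hJec : HasCompactSupport Je)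
    (hJeΩ : Disjoint (tsupport Je) Ω)
    -- the electric field: the outgoing solution of the vector wave equation
    (E : VIE.Space → VIE.CVec) (hE : LocallyIntegrable E)
    (hΔεE : Integrable (fun x => Δε x • E x))
    (hwave : VIE.IsWeakWaveSolution ω μ (fun x => (εL : ℂ) + Δε x) Je E)
    (hrad : VIE.IsRadiating k E)
    -- regularity near the observation point
    (r : VIE.Space) (hEr : ContinuousAt E r)
    (U : Set VIE.Space) (hU : U ∈ 𝓝 r) (K α : ℝ≥0) (hα : 0 < α)
    (hHolder : HolderOnWith K α (fun x => Δε x • E x) U) :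
    -- every exclusion volume
    (∀ V : Set VIE.Space, MeasurableSet V → V ∈ 𝓝 r → V ⊆ Ω →
      -- all the integrals converge absolutely
      Integrable (fun r' => VIE.GE k r r' *ᵥ Je r') ∧
      IntegrableOn (fun r' => (Complex.I * ω * Δε r') • (VIE.GE k r r' *ᵥ E r')) (Ω \ V) ∧
      IntegrableOn (fun r' => (Δε r' * VIE.g k r r') • E r') V ∧
      IntegrableOn (fun r' => Δε r' • (VIE.hessGReg k r r' *ᵥ E r')) V ∧
      IntegrableOn (fun r' => VIE.hessG₀ r r' *ᵥ (Δε r' • E r' - Δε r • E r)) V ∧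
      -- the dyadic of the exclusion volume is well defined
      ContDiffAt ℝ (⊤ : ℕ∞) (VIE.newtonPotential V) r ∧
      -- the volume integral equation
      (1 + (Δε r / εL) • VIE.LDyadic V r) *ᵥ E r =
        VIE.incidentField ω μ k Je r
          - (Complex.I * ω * μ) •
              (∫ r' in Ω \ V, (Complex.I * ω * Δε r') • (VIE.GE k r r' *ᵥ E r'))
          + ((ω : ℂ) ^ 2 * μ) • (∫ r' in V, (Δε r' * VIE.g k r r') • E r')
          + ((ω : ℂ) ^ 2 / (k : ℂ) ^ 2 * μ) •
              (∫ r' in V, Δε r' • (VIE.hessGReg k r r' *ᵥ E r'))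
          + ((ω : ℂ) ^ 2 / (k : ℂ) ^ 2 * μ) •
              (∫ r' in V, VIE.hessG₀ r r' *ᵥ (Δε r' • E r' - Δε r • E r)) ∧
      -- the dyadic as a surface integral
      (∀ (σ : Measure VIE.Space) (n : VIE.Space → VIE.Space), VIE.HasBoundary V σ n →
        ∀ i j, VIE.LDyadic V r i j =
          ((∫ r', (r' - r) i * n r' j / (4 * Real.pi * ‖r' - r‖ ^ 3) ∂σ : ℝ) : ℂ))) ∧
    -- the dyadic of a ball centred at the observation point
    (∀ δ : ℝ, 0 < δ → VIE.LDyadic (Metric.ball r δ) r = (1 / 3 : ℂ) • (1 : VIE.Dyadic)) ∧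
    -- the three correction integrands are weakly singular
    (fun r' => (Δε r' * VIE.g k r r') • E r') =O[𝓝[≠] r] (fun r' => ‖r' - r‖⁻¹) ∧
    (fun r' => Δε r' • (VIE.hessGReg k r r' *ᵥ E r')) =O[𝓝[≠] r] (fun r' => ‖r' - r‖⁻¹) ∧
    (fun r' => VIE.hessG₀ r r' *ᵥ (Δε r' • E r' - Δε r • E r))
      =O[𝓝[≠] r] (fun r' => ‖r' - r‖ ^ ((α : ℝ) - 3)) := by
  obtain ⟨δ, hδ, B, hB, hK⟩ := VIE.exists_near_bounds hU hα hHolder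
  have s1 : ∀ x, (Δε x * VIE.g k r x) • E x = VIE.g k r x • (Δε x • E x) := fun x => by
    rw [mul_comm, mul_smul]
  have s2 : ∀ x, Δε x • (VIE.hessGReg k r x *ᵥ E x) = VIE.hessGReg k r x *ᵥ (Δε x • E x) :=
    fun x => (Matrix.mulVec_smul _ _ _).symm
  have s3 : ∀ x, (Complex.I * ω * Δε x) • (VIE.GE k r x *ᵥ E x) =
      (Complex.I * ω : ℂ) • (VIE.GE k r x *ᵥ (Δε x • E x)) := fun x => by
    rw [Matrix.mulVec_smul, mul_smul]
  have s4 : ∀ x, VIE.g k r x • (Δε x • E x) =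
      (VIE.g k r x • (1 : VIE.Dyadic)) *ᵥ (Δε x • E x) := fun x => by
    rw [Matrix.smul_mulVec, Matrix.one_mulVec]
  simp only [s1, s2, s3]
  refine ⟨fun V hV hVn hVΩ => ?_, fun δ hδ => VIE.LDyadic_ball r hδ,
    VIE.isBigO_g_smul k hδ hB, VIE.isBigO_hessGReg_mulVec k hδ hB,
    VIE.isBigO_hessG₀_mulVec (P := fun x => Δε x • E x) hδ hK⟩
  have hVb : Bornology.IsBounded V := hΩb.subset hVΩ
  obtain ⟨iJ, iΩ, hfield⟩ := VIE.field_eq hω hμ hk hk2 hΩm hΩb hΔε hJe hJec hJeΩ hE hΔεE hwave hrad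
    hEr hδ hB hα hK hV hVn hVΩ
  obtain ⟨η, hη, R, hηR⟩ := VIE.exists_exclusion_radii hVn hVb
  obtain ⟨hR, hVη, hVR⟩ := hηR η hη le_rfl R le_rfl
  simp only [s4]
  refine ⟨iJ, iΩ.smul (Complex.I * ω : ℂ), (VIE.limit_cutG k hV hΔεE hδ hB).1,
    (VIE.limit_cutHess_sub k hV hΔεE hδ hVb hB).1,
    (VIE.limit_cutHess_zero hV hΔεE hδ hα hVb hK).1,
    VIE.contDiffAt_newtonPotential hV hη hR hVη hVR, ?_,
    fun σ n hB i j => VIE.LDyadic_eq_surface_integral hV hVn hVb hB i j⟩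
  have hcoef : (ω : ℂ) ^ 2 * μ * (1 / (k : ℂ) ^ 2) = 1 / εL := by
    have hk2' : (k : ℂ) ^ 2 = ω ^ 2 * εL * μ := by exact_mod_cast hk2
    have h1 : (ω : ℂ) ≠ 0 := by exact_mod_cast hω.ne'
    have h2 : (μ : ℂ) ≠ 0 := by exact_mod_cast hμ.ne'
    have h3 : (εL : ℂ) ≠ 0 := by exact_mod_cast hεL.ne'
    rw [hk2']
    field_simp
  rw [integral_smul, VIE.incidentField, Matrix.add_mulVec, Matrix.one_mulVec, Matrix.smul_mulVec]
  rw [Matrix.mulVec_smul] at hfield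
  funext j
  have hj := congrFun hfield j
  simp only [Pi.add_apply, Pi.sub_apply, Pi.smul_apply, smul_eq_mul] at hj ⊢
  linear_combination hj - Δε r * (VIE.LDyadic V r *ᵥ E r) j * hcoef +
    (ω : ℂ) ^ 2 * μ * (∫ x in Ω \ V, VIE.GE k r x *ᵥ (Δε x • E x)) j * Complex.I_sq
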